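/- All functions are real-valued and measurable on $[0,1]$ with Lebesgue measure $\mathrm{mes}$, and are identified when equal a.e. For a measurable $f$ on a probability space $(\Omega,P)$ put $f^*(t)=\inf\{\tau\ge 0: P\{|f|>\tau\}<t\}$, $0<t\le 1$; two functions are equimeasurable if $P\{|f|>\tau\}=P'\{|g|>\tau\}$ for all $\tau>0$. A Banach space $E\ne\{0\}$ of measurable functions on $[0,1]$ is an r.i. space if (i) $|x|\le|y|$ a.e. and $y\in E$ imply $x\in E$ and $\|x\|_E\le\|y\|_E$, (ii) $y\in E$ and $x$ equimeasurable with $y$ imply $x\in E$ and $\|x\|_E=\|y\|_E$, and (iii) $E$ is separable or $E=E''$ isometrically, where $E'$ is the Köthe dual, with norm $\|x\|_{E'}=\sup_{\|y\|_E\le1}\int_0^1|xy|\,dt$. For measurable $f$ let $\pi(f)=\sum_{i=1}^N f_i$, where $f_1,f_2,\dots$ are independent copies of $f$ and $N$ is a Poisson random variable with parameter $1$ independent of them. An r.i. space $E$ has the Kruglov property ($E\in\mathbb K$) if for every measurable $f$ we have $f\in E\iff\pi(f)\in E$, where a random variable belongs to $E$ if it is equimeasurable with a function in $E$. For a positive increasing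 function $\varphi$ on $(0,1]$, $M_\varphi$ is the space of all $x$ with $\|x\|_{M_\varphi}=\sup_{0<t\le1}\frac1{\varphi(t)}\int_0^t x^*(s)\,ds<\infty$. The space $\exp L_1$ is the Orlicz space with norm $\|x\|=\inf\{\lambda>0:\int_0^1(e^{|x|/\lambda}-1)\,dt\le1\}$, and $(\exp L_1)_0$ is the closure of $L_\infty$ in it. Let $h_0=1$ and $h_{n+1}=(\pi(h_n))^*$ for $n\ge0$; thus $h_n=(K^n1)^*$, where $K$ is the Kruglov operator ($Kf$ is a realization of $\pi(f)$). For $0<\varepsilon<1$ put $g_\varepsilon=\sum_{n\ge0}\varepsilon^nh_n$ and $\psi_\varepsilon(t)=\int_0^tg_\varepsilon(s)\,ds$. **Theorem.** For every $0<\varepsilon<1$ the series defining $g_\varepsilon$ converges everywhere on $(0,1]$ and in $L_1$, $g_\varepsilon$ is integrable, and $\psi_\varepsilon$ is a strictly increasing concave function on $[0,1]$ with $\psi_\varepsilon(0)=0$. The family $\{M_{\psi_\varepsilon}\}_{0<\varepsilon<1}$ satisfies $M_{\psi_\varepsilon}\subset M_{\psi_\delta}$ for $0<\varepsilon\le\delta<1$,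 and: 1. for every $0<\varepsilon<1$, $M_{\psi_\varepsilon}$ is an r.i. space and $M_{\psi_\varepsilon}\in\mathbb K$; 2. for every r.i. space $E\in\mathbb K$ there is $\varepsilon_0\in(0,1)$ such that $M_{\psi_\varepsilon}\subset E$ for all $0<\varepsilon<\varepsilon_0$; 3. $\lim_{t\to0+}\psi_\varepsilon(t)/\psi_\delta(t)=0$ whenever $0<\varepsilon<\delta<1$; 4. there is $\varepsilon_0\in(0,1)$ such that $M_{\psi_\varepsilon}\subsetneq(\exp L_1)_0$ for all $0<\varepsilon<\varepsilon_0$. -/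

import Mathlib

open MeasureTheory ProbabilityTheory Filter Set Topology
open scoped ENNReal NNReal unitInterval

namespace Kruglov

noncomputable section

/-- Measurable real functions on `[0,1]`, identified when equal almost everywhere. -/
abbrev L0 : Type := I →ₘ[(volume : Measure I)] ℝ

/-- `|f|` and `|g|` have the same distribution function on `(0, ∞)`. -/
def Equimeasurable {α β : Type*} [MeasurableSpace α] [MeasurableSpace β]
    (μ : Measure α) (f : α → ℝ) (ν : Measure β) (g : β → ℝ) : Prop :=
  ∀ τ : ℝ, 0 < τ → μ {a | τ < |f a|} = ν {b | τ < |g b|}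

/-- The non-increasing left-continuous rearrangement `f^*(t)`, used for `0 < t ≤ 1`. -/
def rearr {α : Type*} [MeasurableSpace α] (μ : Measure α) (f : α → ℝ) (t : ℝ) : ℝ :=
  sInf {τ : ℝ | 0 ≤ τ ∧ μ {a | τ < |f a|} < ENNReal.ofReal t}

/-- The norm of the Köthe dual, `‖x‖' = sup {∫ |x y| : ‖y‖ ≤ 1}`, for an extended function norm. -/
def kotheDual (ρ : L0 → ℝ≥0∞) (x : L0) : ℝ≥0∞ :=
  ⨆ (y : L0) (_ : ρ y ≤ 1), ∫⁻ t : I, ‖x t * y t‖ₑ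

/-- A rearrangement invariant Banach function space `E ≠ {0}` on `[0,1]` that is separable or
coincides with its second Köthe dual. It is given by its norm, extended by `∞` outside `E`, so
that `E = {x | norm x < ∞}`. -/
structure RISpace where
  norm : L0 → ℝ≥0∞
  norm_add_le : ∀ x y : L0, norm (x + y) ≤ norm x + norm y
  norm_smul : ∀ (c : ℝ) (x : L0), norm (c • x) = ‖c‖ₑ * norm x
  eq_zero_of_norm : ∀ x : L0, norm x = 0 → x = 0
  complete : ∀ u : ℕ → L0, (∀ n, norm (u n) < ∞) →
    (∀ ε : ℝ≥0∞, 0 < ε → ∃ N : ℕ, ∀ m ≥ N, ∀ n ≥ N, norm (u m - u n) < ε) →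
    ∃ x : L0, norm x < ∞ ∧ Tendsto (fun n => norm (u n - x)) atTop (𝓝 0)
  ideal : ∀ x y : L0, (∀ᵐ t : I, |x t| ≤ |y t|) → norm x ≤ norm y
  symmetric : ∀ x y : L0, Equimeasurable volume x volume y → norm x = norm y
  nontrivial : ∃ x : L0, x ≠ 0 ∧ norm x < ∞
  separable_or_maximal :
    (∃ s : Set L0, s.Countable ∧ (∀ y ∈ s, norm y < ∞) ∧
      ∀ x : L0, norm x < ∞ → ∀ ε : ℝ≥0∞, 0 < ε → ∃ y ∈ s, norm (x - y) < ε) ∨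
    (∀ x : L0, norm x = kotheDual (kotheDual norm) x)

/-- The set of functions of a space given by its extended norm. -/
def space (ρ : L0 → ℝ≥0∞) : Set L0 := {x | ρ x < ∞}

/-- The probability space carrying a Poisson variable with parameter `1` and, independently of
it, a sequence of independent uniformly distributed points of `[0,1]`. -/
abbrev Ω : Type := ℕ × (ℕ → I)

/-- The probability measure on `Ω`. -/
def P : Measure Ω :=
  (poissonMeasure 1).prod (Measure.infinitePi (fun _ : ℕ => (volume : Measure I)))

/-- `π(f) = ∑_{i ≤ N} f_i`: `N` is Poisson with parameter `1`, and the `f_i` are independent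
copies of `f`, independent of `N`. This is also the Kruglov operator `f ↦ K f`. -/
def kruglov (f : I → ℝ) (ω : Ω) : ℝ := ∑ i ∈ Finset.range ω.1, f (ω.2 i)

/-- The Kruglov property: `f ∈ E ↔ π(f) ∈ E`, where a random variable on `Ω` is in `E` when it is
equimeasurable with a function in `E`. -/
def RISpace.HasKruglovProperty (E : RISpace) : Prop :=
  ∀ f : L0, f ∈ space E.norm ↔
    ∃ g : L0, g ∈ space E.norm ∧ Equimeasurable volume g P (kruglov f)

/-- `K^n 1` as a function on `[0,1]`: each (non-negative) `K f` is carried from `Ω` to `[0,1]` by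
its decreasing rearrangement. -/
def kruglovPow : ℕ → I → ℝ
  | 0 => fun _ => 1
  | n + 1 => fun t => rearr P (kruglov (kruglovPow n)) t

/-- `h_n = (K^n 1)^*`. -/
def h (n : ℕ) (t : ℝ) : ℝ := rearr (volume : Measure I) (kruglovPow n) t

/-- `g_ε = ∑_{n ≥ 0} ε^n h_n`. -/
def g (ε t : ℝ) : ℝ := ∑' n : ℕ, ε ^ n * h n t

/-- `ψ_ε(t) = ∫_0^t g_ε(s) ds`. -/
def psi (ε t : ℝ) : ℝ := ∫ s in (0 : ℝ)..t, g ε s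

/-- The norm of the Marcinkiewicz space `M_φ`, with value `∞` outside the space. -/
def marcinkiewiczNorm (φ : ℝ → ℝ) (x : L0) : ℝ≥0∞ :=
  ⨆ (t : ℝ) (_ : t ∈ Ioc (0 : ℝ) 1),
    (∫⁻ s in Ioc (0 : ℝ) t, ENNReal.ofReal (rearr (volume : Measure I) x s)) /
      ENNReal.ofReal (φ t)

/-- The Luxemburg norm of the Orlicz space `exp L_1`, with value `∞` outside the space. -/
def expNorm (x : L0) : ℝ≥0∞ :=
  ⨅ (l : ℝ) (_ : 0 < l) (_ : ∫⁻ t : I, ENNReal.ofReal (Real.exp (|x t| / l) - 1) ≤ 1),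
    ENNReal.ofReal l

/-- `(exp L_1)_0`, the closure of `L_∞` in `exp L_1`. -/
def expL1Zero : Set L0 :=
  {x | expNorm x < ∞ ∧ ∀ ε : ℝ≥0∞, 0 < ε →
    ∃ y : L0, (∃ C : ℝ, ∀ᵐ t : I, |y t| ≤ C) ∧ expNorm (x - y) < ε}

end

end Kruglov

/-!
The proof rests on two elementary facts about the iterates `h_n`.

*Mean residual life.* For `f ≥ 0` of mean `1`, if `E (f - c)^+ ≤ A P(f > c)` for all `c ≥ 0`, then
`π(f)` satisfies the same with `A + e` in place of `A`: the random sum crosses the level `c` with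
one summand, which overshoots by at most `A` on average, and the number of the summands that remain
is bounded on average (`stopLoss_kruglov_le`). Hence the averages `(1/t) ∫_0^t h_n` exceed `h_n(t)` by
at most a constant which is linear in `n`, so that `ψ_ε(t) ≤ C t g_ε(t)` (`psi_le_mul_g`), and
`M_{ψ_ε}` consists of the functions `x` with `x^* ≤ C g_ε` for some `C` (`exists_rearr_le_mul_g`).
This reduces all inclusions to pointwise domination and makes interpolation theory superfluous.

* The Kruglov property of `M_{ψ_ε}`: `π` acts linearly on the series `g_ε`, shifting it by one term,
  and `f ↦ ∫_0^t f^*` is countably subadditive (`topIntegral_kruglov_gI_le`). Conversely `π(f)` is a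
  copy of `f` with probability `e⁻¹` (`stopLoss_le_kruglov`).
* That `M_φ` is an r.i. space follows from the variational formula
  `∫_0^t f^* = min_c (E (|f| - c)^+ + c t)` (`topIntegral_eq`) and from the dual description of this
  integral as the maximum of `E |f| w` over weights `0 ≤ w ≤ 1` of mass `t` (`exists_weight`).
* If `E` has the Kruglov property, then `π` is bounded on `E` by a gliding hump argument
  (`RISpace.exists_norm_realize_le`). So the norms of the `h_n` in `E` grow at most geometrically,
  and `g_ε ∈ E` for small `ε` (`exists_space_subset`).

*Growth at zero.* With `L = log (1/t)`, `h_n(t)` is of the order of `L` divided by the `n`-fold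
iterated logarithm of `L`. The upper bound is Chebyshev's inequality, because `E exp(s h_n)` is
bounded by an `(n+1)`-fold iterated exponential of `s`; for the lower one considers the event that
`π(h_n)` has `k` summands, all of them at least `h_n(1/k)`, with `k` close to `L / log L`. Therefore
`h_n = o(h_{n+1})` and `ψ_ε = o(ψ_δ)` for `ε < δ` (`tendsto_psi_div_psi`). As the norm of `h_n` in
`exp L_1` is at most `2^{n+1}`, the series shows that `g_ε(t) = o(log (1/t))` for `ε < 1/2`, which
gives all exponential moments of the elements of `M_{ψ_ε}`. The inclusion into `(exp L_1)_0` is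
strict because `g_δ`, for `ε < δ < 1/2`, does not belong to `M_{ψ_ε}`.
-/

namespace Kruglov

/-! ### Decreasing rearrangements -/

section Rearrangement

variable {α β : Type*} [MeasurableSpace α] [MeasurableSpace β] {μ : Measure α} {ν : Measure β}
  {f : α → ℝ} {f' : β → ℝ} {s t τ c : ℝ}

lemma rearr_nonneg (μ : Measure α) (f : α → ℝ) (t : ℝ) : 0 ≤ rearr μ f t :=
  Real.sInf_nonneg fun _ h => h.1

lemma rearr_of_nonpos (ht : t ≤ 0) : rearr μ f t = 0 := by
  simp [rearr, ENNReal.ofReal_of_nonpos ht]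

lemma exists_measure_lt [IsProbabilityMeasure μ] (hf : Measurable f) (ht : 0 < t) :
    ∃ τ, 0 ≤ τ ∧ μ {a | τ < |f a|} < ENNReal.ofReal t := by
  have h1 : Tendsto (fun n : ℕ => μ {a | (n : ℝ) < |f a|}) atTop
      (𝓝 (μ (⋂ n : ℕ, {a | (n : ℝ) < |f a|}))) := by
    refine tendsto_measure_iInter_atTop
      (fun n => (measurableSet_lt measurable_const hf.abs).nullMeasurableSet) ?_
      ⟨0, measure_ne_top _ _⟩
    intro m n hmn a (ha : (n : ℝ) < |f a|)
    exact lt_of_le_of_lt (by exact_mod_cast hmn) ha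
  have h2 : (⋂ n : ℕ, {a | (n : ℝ) < |f a|}) = ∅ := by
    ext a
    simp only [mem_iInter, mem_ofPred_eq, mem_empty_iff_false, iff_false, not_forall, not_lt]
    exact exists_nat_ge _
  rw [h2, measure_empty] at h1
  obtain ⟨n, hn⟩ := (h1.eventually (gt_mem_nhds (ENNReal.ofReal_pos.2 ht))).exists
  exact ⟨n, n.cast_nonneg, hn⟩

lemma rearr_le_of_measure_lt (hτ : 0 ≤ τ) (h : μ {a | τ < |f a|} < ENNReal.ofReal t) :
    rearr μ f t ≤ τ :=
  csInf_le ⟨0, fun _ h => h.1⟩ ⟨hτ, h⟩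

/-- The distribution function of `|f|` at `f^*(t)` is at most `t`, by its right continuity. -/
lemma measure_rearr_lt_le [IsProbabilityMeasure μ] (hf : Measurable f) (ht : 0 < t) :
    μ {a | rearr μ f t < |f a|} ≤ ENNReal.ofReal t := by
  have h1 : {a | rearr μ f t < |f a|} =
      ⋃ n : ℕ, {a | rearr μ f t + 1 / ((n : ℝ) + 1) < |f a|} := by
    ext a
    simp only [mem_ofPred_eq, mem_iUnion]
    constructor
    · intro h
      obtain ⟨n, hn⟩ := exists_nat_one_div_lt (sub_pos.2 h)
      exact ⟨n, by linarith⟩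
    · rintro ⟨n, hn⟩
      have : 0 < 1 / ((n : ℝ) + 1) := Nat.one_div_pos_of_nat
      linarith
  have h2 : Monotone fun n : ℕ => {a | rearr μ f t + 1 / ((n : ℝ) + 1) < |f a|} := by
    intro m n hmn a (ha : rearr μ f t + 1 / ((m : ℝ) + 1) < |f a|)
    have := Nat.one_div_le_one_div (α := ℝ) hmn
    exact lt_of_le_of_lt (by linarith) ha
  rw [h1, h2.measure_iUnion]
  refine iSup_le fun n => ?_
  obtain ⟨τ, hτ, hlt⟩ := exists_lt_of_csInf_lt (exists_measure_lt hf ht)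
    (show rearr μ f t < rearr μ f t + 1 / ((n : ℝ) + 1) by
      linarith [Nat.one_div_pos_of_nat (α := ℝ) (n := n)])
  exact (measure_mono fun a (ha : _ < _) => hlt.trans ha).trans hτ.2.le

lemma lt_rearr_of_lt_measure [IsProbabilityMeasure μ] (hf : Measurable f) (ht : 0 < t)
    (h : ENNReal.ofReal t < μ {a | τ < |f a|}) : τ < rearr μ f t := by
  by_contra! hle
  exact absurd h (not_lt.2 <| (measure_mono fun a (ha : _ < _) => hle.trans_lt ha).trans
    (measure_rearr_lt_le hf ht))

lemma le_rearr_of_le_measure [IsProbabilityMeasure μ] (hf : Measurable f) (ht : 0 < t)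
    (h : ENNReal.ofReal t ≤ μ {a | c ≤ |f a|}) : c ≤ rearr μ f t := by
  refine le_csInf (exists_measure_lt hf ht) fun τ hτ => ?_
  by_contra! hc
  exact absurd hτ.2 (not_lt.2 <| h.trans <| measure_mono fun a (ha : _ ≤ _) => hc.trans_le ha)

lemma rearr_le_rearr [IsProbabilityMeasure ν] (hf' : Measurable f') (ht : 0 < t)
    (h : ∀ τ, 0 ≤ τ → μ {a | τ < |f a|} ≤ ν {b | τ < |f' b|}) :
    rearr μ f t ≤ rearr ν f' t :=
  csInf_le_csInf ⟨0, fun _ h => h.1⟩ (exists_measure_lt hf' ht)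
    fun τ hτ => ⟨hτ.1, (h τ hτ.1).trans_lt hτ.2⟩

lemma rearr_mono_ae [IsProbabilityMeasure μ] {f₁ f₂ : α → ℝ} (hf : Measurable f₂) (ht : 0 < t)
    (h : ∀ᵐ a ∂μ, |f₁ a| ≤ |f₂ a|) : rearr μ f₁ t ≤ rearr μ f₂ t := by
  refine rearr_le_rearr hf ht fun τ _ => measure_mono_ae ?_
  filter_upwards [h] with a ha hτ using lt_of_lt_of_le hτ ha

lemma rearr_antitoneOn [IsProbabilityMeasure μ] (hf : Measurable f) :
    AntitoneOn (rearr μ f) (Ioi 0) := by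
  intro s hs t _ hst
  exact csInf_le_csInf ⟨0, fun _ h => h.1⟩ (exists_measure_lt hf hs)
    fun τ hτ => ⟨hτ.1, hτ.2.trans_le (ENNReal.ofReal_le_ofReal hst)⟩

lemma measurable_rearr [IsProbabilityMeasure μ] (hf : Measurable f) :
    Measurable (rearr μ f) := by
  refine measurable_of_Ioi fun τ => ?_
  by_cases hτ : τ < 0
  · convert MeasurableSet.univ
    ext t
    simpa using hτ.trans_le (rearr_nonneg μ f t)
  · refine OrdConnected.measurableSet (ordConnected_def.2 ?_)
    intro x hx y hy z hz
    have hx0 : 0 < x := by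
      by_contra! hx0
      simp only [mem_preimage, mem_Ioi, rearr_of_nonpos hx0] at hx
      exact hτ hx
    exact lt_of_lt_of_le (show τ < rearr μ f y from hy)
      (rearr_antitoneOn hf (hx0.trans_le hz.1) (hx0.trans_le (hz.1.trans hz.2)) hz.2)

/-- The law of `|f|`. -/
noncomputable def absLaw (μ : Measure α) (f : α → ℝ) : Measure ℝ := μ.map fun a => |f a|

lemma absLaw_Ioi (hf : Measurable f) (τ : ℝ) : absLaw μ f (Ioi τ) = μ {a | τ < |f a|} := by
  rw [absLaw, Measure.map_apply hf.abs measurableSet_Ioi]; rfl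

lemma isProbabilityMeasure_absLaw [IsProbabilityMeasure μ] (hf : Measurable f) :
    IsProbabilityMeasure (absLaw μ f) :=
  Measure.isProbabilityMeasure_map hf.abs.aemeasurable

lemma measure_abs_pos_eq_iSup (μ : Measure α) (f : α → ℝ) :
    μ {a | 0 < |f a|} = ⨆ n : ℕ, μ {a | 1 / ((n : ℝ) + 1) < |f a|} := by
  have h2 : Monotone fun n : ℕ => {a | 1 / ((n : ℝ) + 1) < |f a|} := by
    intro m n hmn a (ha : 1 / ((m : ℝ) + 1) < |f a|)
    exact lt_of_le_of_lt (Nat.one_div_le_one_div (α := ℝ) hmn) ha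
  rw [← h2.measure_iUnion]
  congr 1
  ext a
  simp only [mem_ofPred_eq, mem_iUnion]
  exact ⟨fun h => exists_nat_one_div_lt h, fun ⟨n, hn⟩ => Nat.one_div_pos_of_nat.trans hn⟩

lemma absLaw_eq_of_measure_lt [IsProbabilityMeasure μ] [IsProbabilityMeasure ν] (hf : Measurable f)
    (hf' : Measurable f') (h : ∀ τ, 0 < τ → μ {a | τ < |f a|} = ν {b | τ < |f' b|}) :
    absLaw μ f = absLaw ν f' := by
  have h0 : μ {a | 0 < |f a|} = ν {b | 0 < |f' b|} := by
    rw [measure_abs_pos_eq_iSup, measure_abs_pos_eq_iSup]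
    exact iSup_congr fun n => h _ Nat.one_div_pos_of_nat
  have := isProbabilityMeasure_absLaw (μ := μ) hf
  have := isProbabilityMeasure_absLaw (μ := ν) hf'
  refine Measure.ext_of_Iic _ _ fun τ => ?_
  have key : absLaw μ f (Ioi τ) = absLaw ν f' (Ioi τ) := by
    rw [absLaw_Ioi hf, absLaw_Ioi hf']
    rcases lt_trichotomy τ 0 with hτ | rfl | hτ
    · simp [hτ.trans_le (abs_nonneg _)]
    · exact h0
    · exact h τ hτ
  rw [← compl_Ioi, prob_compl_eq_one_sub measurableSet_Ioi, prob_compl_eq_one_sub measurableSet_Ioi,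
    key]

lemma equimeasurable_iff [IsProbabilityMeasure μ] [IsProbabilityMeasure ν] (hf : Measurable f)
    (hf' : Measurable f') : Equimeasurable μ f ν f' ↔ absLaw μ f = absLaw ν f' := by
  refine ⟨fun h => absLaw_eq_of_measure_lt hf hf' h, fun h τ _ => ?_⟩
  rw [← absLaw_Ioi hf, ← absLaw_Ioi hf', h]

lemma rearr_congr (hf : Measurable f) (hf' : Measurable f') (h : absLaw μ f = absLaw ν f') :
    rearr μ f = rearr ν f' := by
  funext t
  simp only [rearr, ← absLaw_Ioi hf, ← absLaw_Ioi hf', h]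

lemma lintegral_absLaw (hf : Measurable f) {Φ : ℝ → ℝ≥0∞} (hΦ : Measurable Φ) :
    ∫⁻ x, Φ x ∂absLaw μ f = ∫⁻ a, Φ |f a| ∂μ :=
  lintegral_map hΦ hf.abs

lemma isProbabilityMeasure_Ioc : IsProbabilityMeasure (volume.restrict (Ioc (0 : ℝ) 1)) :=
  ⟨by simp⟩

/-- On `(0,1]` the rearrangement of `f` has the same law as `|f|`. -/
lemma absLaw_rearr [IsProbabilityMeasure μ] (hf : Measurable f) :
    absLaw (volume.restrict (Ioc (0 : ℝ) 1)) (rearr μ f) = absLaw μ f := by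
  have := isProbabilityMeasure_Ioc
  refine absLaw_eq_of_measure_lt (measurable_rearr hf) hf fun τ hτ => ?_
  simp only [abs_of_nonneg (rearr_nonneg μ f _)]
  rw [Measure.restrict_apply (measurableSet_lt measurable_const (measurable_rearr hf))]
  have hd : μ {a | τ < |f a|} ≤ 1 := prob_le_one
  set d := (μ {a | τ < |f a|}).toReal with hd'
  have hdd : μ {a | τ < |f a|} = ENNReal.ofReal d :=
    (ENNReal.ofReal_toReal (measure_ne_top _ _)).symm
  have hd1 : d ≤ 1 := ENNReal.toReal_le_of_le_ofReal zero_le_one (by simpa using hd)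
  apply le_antisymm
  · calc _ ≤ volume (Ioc 0 d) := measure_mono ?_
      _ = _ := by rw [Real.volume_Ioc, sub_zero, hdd]
    rintro t ⟨ht : τ < _, ht0, ht1⟩
    refine ⟨ht0, ?_⟩
    by_contra! hdt
    refine absurd ht (not_lt.2 (rearr_le_of_measure_lt hτ.le ?_))
    rw [hdd]
    exact (ENNReal.ofReal_lt_ofReal_iff ht0).2 hdt
  · calc _ = volume (Ioo 0 d) := by rw [Real.volume_Ioo, sub_zero, hdd]
      _ ≤ _ := measure_mono ?_
    rintro t ⟨ht0, htd⟩
    refine ⟨lt_rearr_of_lt_measure hf ht0 ?_, ht0, htd.le.trans hd1⟩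
    rw [hdd]
    exact (ENNReal.ofReal_lt_ofReal_iff (ht0.trans htd)).2 htd

lemma lintegral_rearr [IsProbabilityMeasure μ] (hf : Measurable f) {Φ : ℝ → ℝ≥0∞}
    (hΦ : Measurable Φ) : ∫⁻ s in Ioc (0 : ℝ) 1, Φ (rearr μ f s) = ∫⁻ a, Φ |f a| ∂μ := by
  rw [← lintegral_absLaw hf hΦ, ← absLaw_rearr hf, lintegral_absLaw (measurable_rearr hf) hΦ]
  simp only [abs_of_nonneg (rearr_nonneg μ f _)]

lemma lintegral_unitInterval {F : ℝ → ℝ≥0∞} (hF : Measurable F) :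
    ∫⁻ u : I, F u = ∫⁻ s in Ioc (0 : ℝ) 1, F s := by
  rw [unitInterval.measurePreserving_coe.lintegral_comp hF]
  exact setLIntegral_congr Ioc_ae_eq_Icc.symm

lemma absLaw_unitInterval {F : ℝ → ℝ} (hF : Measurable F) :
    absLaw (volume : Measure I) (fun u : I => F u) =
      absLaw (volume.restrict (Ioc (0 : ℝ) 1)) F := by
  have h1 : (volume.restrict (Ioc (0 : ℝ) 1)) = Measure.map ((↑) : I → ℝ) volume := by
    rw [unitInterval.measurePreserving_coe.map_eq]
    exact Measure.restrict_congr_set Ioc_ae_eq_Icc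
  rw [absLaw, absLaw, h1, Measure.map_map hF.abs measurable_subtype_coe]
  rfl

/-- The rearrangement, viewed on `[0,1]`, is equimeasurable with the function. -/
lemma absLaw_rearr_unitInterval [IsProbabilityMeasure μ] (hf : Measurable f) :
    absLaw (volume : Measure I) (fun u : I => rearr μ f u) = absLaw μ f := by
  rw [absLaw_unitInterval (measurable_rearr hf), absLaw_rearr hf]

/-- The stop-loss functional `E (|f| - c)^+`. -/
noncomputable def stopLoss (μ : Measure α) (f : α → ℝ) (c : ℝ) : ℝ≥0∞ :=
  ∫⁻ a, ENNReal.ofReal (|f a| - c) ∂μ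

/-- The integral `∫_0^t f^*(s) ds`. -/
noncomputable def topIntegral (μ : Measure α) (f : α → ℝ) (t : ℝ) : ℝ≥0∞ :=
  ∫⁻ s in Ioc (0 : ℝ) t, ENNReal.ofReal (rearr μ f s)

lemma topIntegral_congr (hf : Measurable f) (hf' : Measurable f') (h : absLaw μ f = absLaw ν f') :
    topIntegral μ f = topIntegral ν f' := by
  funext t
  rw [topIntegral, topIntegral, rearr_congr hf hf' h]

lemma stopLoss_eq [IsProbabilityMeasure μ] (hf : Measurable f) (c : ℝ) :
    stopLoss μ f c = ∫⁻ s in Ioc (0 : ℝ) 1, ENNReal.ofReal (rearr μ f s - c) :=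
  (lintegral_rearr hf (Φ := fun x => ENNReal.ofReal (x - c)) (by fun_prop)).symm

lemma topIntegral_le [IsProbabilityMeasure μ] (hf : Measurable f) (hc : 0 ≤ c) (ht : t ≤ 1) :
    topIntegral μ f t ≤ stopLoss μ f c + ENNReal.ofReal (c * t) := by
  rw [stopLoss_eq hf]
  calc topIntegral μ f t
      ≤ ∫⁻ s in Ioc (0 : ℝ) t, (ENNReal.ofReal (rearr μ f s - c) + ENNReal.ofReal c) := by
        refine lintegral_mono fun s => ?_
        refine le_trans (ENNReal.ofReal_le_ofReal ?_) ENNReal.ofReal_add_le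
        linarith
    _ = (∫⁻ s in Ioc (0 : ℝ) t, ENNReal.ofReal (rearr μ f s - c)) + ENNReal.ofReal (c * t) := by
        rw [lintegral_add_right _ measurable_const, lintegral_const]
        simp [ENNReal.ofReal_mul hc]
    _ ≤ _ := by
        gcongr

/-- The infimum of `c ↦ E (|f| - c)^+ + c t` is `∫_0^t f^*` and is attained at `c = f^*(t)`. -/
lemma topIntegral_eq [IsProbabilityMeasure μ] (hf : Measurable f) (ht : t ∈ Ioc (0 : ℝ) 1) :
    topIntegral μ f t = stopLoss μ f (rearr μ f t) + ENNReal.ofReal (rearr μ f t * t) := by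
  refine le_antisymm (topIntegral_le hf (rearr_nonneg _ _ _) ht.2) ?_
  set c := rearr μ f t with hc
  have hc0 : 0 ≤ c := rearr_nonneg _ _ _
  rw [stopLoss_eq hf, ← Ioc_union_Ioc_eq_Ioc ht.1.le ht.2,
    lintegral_union measurableSet_Ioc (Ioc_disjoint_Ioc_of_le le_rfl)]
  have h2 : ∫⁻ s in Ioc t 1, ENNReal.ofReal (rearr μ f s - c) = 0 := by
    rw [setLIntegral_congr_fun (g := fun _ => 0) measurableSet_Ioc]
    · simp
    · intro s hs
      have := rearr_antitoneOn (μ := μ) hf ht.1 (ht.1.trans hs.1) hs.1.le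
      exact ENNReal.ofReal_of_nonpos (by linarith)
  have h3 : ENNReal.ofReal (c * t) = ∫⁻ s in Ioc (0 : ℝ) t, ENNReal.ofReal c := by
    simp [ENNReal.ofReal_mul hc0]
  rw [h2, add_zero, h3, ← lintegral_add_right _ measurable_const, topIntegral]
  refine setLIntegral_mono (measurable_rearr hf).ennreal_ofReal fun s hs => ?_
  have : c ≤ rearr μ f s := rearr_antitoneOn hf hs.1 ht.1 hs.2
  rw [← ENNReal.ofReal_add (by linarith) hc0]
  simp

lemma topIntegral_le_of_stopLoss [IsProbabilityMeasure μ] [IsProbabilityMeasure ν]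
    (hf : Measurable f) (hf' : Measurable f') {C : ℝ} (hC : 1 ≤ C)
    (h : ∀ c, 0 ≤ c → stopLoss μ f c ≤ ENNReal.ofReal C * stopLoss ν f' c)
    (ht : t ∈ Ioc (0 : ℝ) 1) :
    topIntegral μ f t ≤ ENNReal.ofReal C * topIntegral ν f' t := by
  have h0 := rearr_nonneg ν f' t
  rw [topIntegral_eq hf' ht, mul_add]
  refine (topIntegral_le hf h0 ht.2).trans (add_le_add (h _ h0) ?_)
  exact le_mul_of_one_le_left' (by simpa using ENNReal.ofReal_le_ofReal hC)

lemma topIntegral_one [IsProbabilityMeasure μ] (hf : Measurable f) :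
    topIntegral μ f 1 = ∫⁻ a, ‖f a‖ₑ ∂μ := by
  rw [topIntegral, lintegral_rearr hf (Φ := ENNReal.ofReal) (by fun_prop)]
  simp only [Real.enorm_eq_ofReal_abs]

lemma topIntegral_mono (hst : s ≤ t) : topIntegral μ f s ≤ topIntegral μ f t :=
  lintegral_mono_set (Ioc_subset_Ioc_right hst)

/-- Countable subadditivity of `f ↦ ∫_0^t f^*`. -/
lemma topIntegral_tsum_le [IsProbabilityMeasure μ] (hf : Measurable f) {u : ℕ → α → ℝ}
    (hu : ∀ n, Measurable (u n)) (ht : t ∈ Ioc (0 : ℝ) 1)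
    (hs : Summable fun n => rearr μ (u n) t)
    (h : ∀ᵐ a ∂μ, ENNReal.ofReal |f a| ≤ ∑' n, ENNReal.ofReal |u n a|) :
    topIntegral μ f t ≤ ∑' n, topIntegral μ (u n) t := by
  have h0 : ∀ n, 0 ≤ rearr μ (u n) t := fun n => rearr_nonneg _ _ _
  set c := ∑' n, rearr μ (u n) t with hc
  have hc0 : 0 ≤ c := tsum_nonneg h0
  have hcE : ENNReal.ofReal c = ∑' n, ENNReal.ofReal (rearr μ (u n) t) :=
    ENNReal.ofReal_tsum_of_nonneg h0 hs
  refine (topIntegral_le hf hc0 ht.2).trans ?_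
  have h1 : stopLoss μ f c ≤ ∑' n, stopLoss μ (u n) (rearr μ (u n) t) := by
    simp only [stopLoss]
    rw [← lintegral_tsum fun n => by have := hu n; fun_prop]
    refine lintegral_mono_ae ?_
    filter_upwards [h] with a ha
    rw [ENNReal.ofReal_sub _ hc0, tsub_le_iff_right]
    refine ha.trans ?_
    rw [hcE, ← ENNReal.tsum_add]
    refine ENNReal.tsum_le_tsum fun n => ?_
    refine le_trans (ENNReal.ofReal_le_ofReal ?_) ENNReal.ofReal_add_le
    linarith
  have h2 : ENNReal.ofReal (c * t) = ∑' n, ENNReal.ofReal (rearr μ (u n) t * t) := by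
    simp_rw [ENNReal.ofReal_mul hc0, ENNReal.ofReal_mul (h0 _), ENNReal.tsum_mul_right, hcE]
  calc _ ≤ _ := add_le_add h1 h2.le
    _ = _ := by
      rw [← ENNReal.tsum_add]
      exact tsum_congr fun n => (topIntegral_eq (hu n) ht).symm

lemma topIntegral_add_le [IsProbabilityMeasure μ] {f₁ f₂ f₃ : α → ℝ} (h₁ : Measurable f₁)
    (h₂ : Measurable f₂) (h₃ : Measurable f₃) (ht : t ∈ Ioc (0 : ℝ) 1)
    (h : ∀ᵐ a ∂μ, |f₁ a| ≤ |f₂ a| + |f₃ a|) :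
    topIntegral μ f₁ t ≤ topIntegral μ f₂ t + topIntegral μ f₃ t := by
  have h20 := rearr_nonneg μ f₂ t
  have h30 := rearr_nonneg μ f₃ t
  refine (topIntegral_le h₁ (add_nonneg h20 h30) ht.2).trans ?_
  rw [topIntegral_eq h₂ ht, topIntegral_eq h₃ ht, add_add_add_comm, add_mul,
    ENNReal.ofReal_add (mul_nonneg h20 ht.1.le) (mul_nonneg h30 ht.1.le)]
  gcongr
  simp only [stopLoss]
  rw [← lintegral_add_left (by fun_prop)]
  refine lintegral_mono_ae ?_
  filter_upwards [h] with a ha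
  refine le_trans (ENNReal.ofReal_le_ofReal ?_) ENNReal.ofReal_add_le
  linarith

lemma topIntegral_mono_ae [IsProbabilityMeasure μ] {f₁ f₂ : α → ℝ} (h₂ : Measurable f₂)
    (h : ∀ᵐ a ∂μ, |f₁ a| ≤ |f₂ a|) (t : ℝ) : topIntegral μ f₁ t ≤ topIntegral μ f₂ t :=
  setLIntegral_mono (measurable_rearr h₂).ennreal_ofReal
    fun _ hs => ENNReal.ofReal_le_ofReal (rearr_mono_ae h₂ hs.1 h)

lemma rearr_smul [IsProbabilityMeasure μ] (hf : Measurable f) (c t : ℝ) (ht : 0 < t) :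
    rearr μ (fun a => c * f a) t = |c| * rearr μ f t := by
  rcases eq_or_ne c 0 with rfl | hc
  · simp only [zero_mul, abs_zero]
    refine le_antisymm (rearr_le_of_measure_lt le_rfl ?_) (rearr_nonneg _ _ _)
    simpa using ht
  have hc' : 0 < |c| := abs_pos.2 hc
  have key : ∀ τ, {a | |c| * τ < |c * f a|} = {a | τ < |f a|} := by
    intro τ
    ext a
    simp [abs_mul, hc']
  apply le_antisymm
  · rw [← div_le_iff₀' hc']
    refine le_csInf (exists_measure_lt hf ht) fun τ hτ => ?_
    rw [div_le_iff₀' hc']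
    refine rearr_le_of_measure_lt (mul_nonneg hc'.le hτ.1) ?_
    rw [key]
    exact hτ.2
  · refine le_csInf (exists_measure_lt (hf.const_mul c) ht) fun τ hτ => ?_
    rw [← le_div_iff₀' hc']
    refine rearr_le_of_measure_lt (div_nonneg hτ.1 hc'.le) ?_
    rw [← key, mul_div_cancel₀ _ hc'.ne']
    exact hτ.2

lemma topIntegral_smul [IsProbabilityMeasure μ] (hf : Measurable f) (c t : ℝ) :
    topIntegral μ (fun a => c * f a) t = ‖c‖ₑ * topIntegral μ f t := by
  rw [topIntegral, topIntegral, ← lintegral_const_mul _ (measurable_rearr hf).ennreal_ofReal]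
  refine setLIntegral_congr_fun measurableSet_Ioc fun s hs => ?_
  simp only [rearr_smul hf c s hs.1]
  rw [ENNReal.ofReal_mul (abs_nonneg _), Real.enorm_eq_ofReal_abs]

end Rearrangement

/-! ### The Kruglov operator -/

section Operator

instance : IsProbabilityMeasure P := by unfold P; infer_instance

/-- The law of a sequence of independent uniformly distributed points of `[0,1]`. -/
noncomputable def seqLaw : Measure (ℕ → I) :=
  Measure.infinitePi (fun _ : ℕ => (volume : Measure I))

instance : IsProbabilityMeasure seqLaw := by unfold seqLaw; infer_instance

/-- The weight `e⁻¹ / k!` of the Poisson distribution with parameter `1`. -/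
noncomputable def poissonWeight (k : ℕ) : ℝ≥0∞ :=
  ENNReal.ofReal (Real.exp (-1) / (k.factorial : ℝ))

/-- The sum `f(x_0) + ⋯ + f(x_{k-1})`. -/
def sumFirst (f : I → ℝ) (k : ℕ) (x : ℕ → I) : ℝ := ∑ i ∈ Finset.range k, f (x i)

variable {f f' : I → ℝ}

@[fun_prop]
lemma measurable_sumFirst (hf : Measurable f) (k : ℕ) : Measurable (sumFirst f k) := by
  unfold sumFirst
  fun_prop

lemma measurable_kruglov (hf : Measurable f) : Measurable (kruglov f) :=
  measurable_from_prod_countable_right fun k => measurable_sumFirst hf k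

lemma sumFirst_succ (k : ℕ) (x : ℕ → I) : sumFirst f (k + 1) x = sumFirst f k x + f (x k) :=
  Finset.sum_range_succ _ _

lemma sumFirst_nonneg (hf : ∀ u, 0 ≤ f u) (k : ℕ) (x : ℕ → I) : 0 ≤ sumFirst f k x :=
  Finset.sum_nonneg fun _ _ => hf _

lemma kruglov_nonneg (hf : ∀ u, 0 ≤ f u) (ω : Ω) : 0 ≤ kruglov f ω :=
  Finset.sum_nonneg fun _ _ => hf _

lemma tsum_poissonWeight : ∑' k, poissonWeight k = 1 := by
  have := hasSum_one_poissonMeasure 1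
  simp only [NNReal.coe_one, one_pow, mul_one] at this
  rw [← ENNReal.ofReal_one, ← this.tsum_eq, ENNReal.ofReal_tsum_of_nonneg (fun k => by positivity)
    this.summable]
  rfl

/-- Conditioning on the number of summands. -/
lemma lintegral_P {F : Ω → ℝ≥0∞} (hF : Measurable F) :
    ∫⁻ ω, F ω ∂P = ∑' k, poissonWeight k * ∫⁻ x, F (k, x) ∂seqLaw := by
  rw [P, lintegral_prod _ hF.aemeasurable, lintegral_countable']
  refine tsum_congr fun k => ?_
  rw [poissonMeasure_singleton, mul_comm, poissonWeight]
  simp [seqLaw]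

lemma lintegral_kruglov (hf : Measurable f) {Φ : ℝ → ℝ≥0∞} (hΦ : Measurable Φ) :
    ∫⁻ ω, Φ (kruglov f ω) ∂P = ∑' k, poissonWeight k * ∫⁻ x, Φ (sumFirst f k x) ∂seqLaw :=
  lintegral_P (hΦ.comp (measurable_kruglov hf))

/-- The `k`-th summand is independent of the sum of the preceding ones. -/
lemma lintegral_sumFirst_succ (hf : Measurable f) (k : ℕ) {Φ : ℝ → ℝ≥0∞} (hΦ : Measurable Φ) :
    ∫⁻ x, Φ (sumFirst f (k + 1) x) ∂seqLaw =
      ∫⁻ x, (∫⁻ u : I, Φ (sumFirst f k x + f u)) ∂seqLaw := by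
  have hind : IndepFun (∑ j ∈ Finset.range k, fun x : ℕ → I => f (x j)) (fun x => f (x k)) seqLaw :=
    (iIndepFun_infinitePi (X := fun (_ : ℕ) => f) fun _ => hf).indepFun_finsetSum_of_notMem
      (fun i => by fun_prop) (by simp)
  have hS : (∑ j ∈ Finset.range k, fun x : ℕ → I => f (x j)) = sumFirst f k := by
    ext x; simp [sumFirst]
  have hk : Measurable fun x : ℕ → I => f (x k) := by fun_prop
  have hsk := measurable_sumFirst hf k
  rw [hS] at hind
  have hmap := hind.map_prod_eq_prod_map_map hsk.aemeasurable hk.aemeasurable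
  have hlaw : seqLaw.map (fun x : ℕ → I => f (x k)) = (volume : Measure I).map f := by
    have : (fun x : ℕ → I => f (x k)) = f ∘ fun x : ℕ → I => x k := rfl
    rw [this, ← Measure.map_map hf (by fun_prop), seqLaw, Measure.infinitePi_map_eval]
  have := Measure.isProbabilityMeasure_map (μ := (volume : Measure I)) hf.aemeasurable
  have hΦ2 : Measurable fun p : ℝ × ℝ => Φ (p.1 + p.2) := hΦ.comp (by fun_prop)
  calc ∫⁻ x, Φ (sumFirst f (k + 1) x) ∂seqLaw
      = ∫⁻ x, (fun p : ℝ × ℝ => Φ (p.1 + p.2)) (sumFirst f k x, f (x k)) ∂seqLaw := by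
        simp only [sumFirst_succ]
    _ = ∫⁻ p, Φ (p.1 + p.2) ∂(seqLaw.map fun x => (sumFirst f k x, f (x k))) :=
        (lintegral_map hΦ2 (hsk.prodMk hk)).symm
    _ = ∫⁻ s, (∫⁻ v, Φ (s + v) ∂(volume : Measure I).map f) ∂seqLaw.map (sumFirst f k) := by
        rw [hmap, hlaw, lintegral_prod _ hΦ2.aemeasurable]
    _ = ∫⁻ s, (∫⁻ u : I, Φ (s + f u)) ∂seqLaw.map (sumFirst f k) := by
        refine lintegral_congr fun s => ?_
        exact lintegral_map (f := fun v => Φ (s + v)) (hΦ.comp (by fun_prop)) hf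
    _ = _ := by
        refine lintegral_map ?_ hsk
        exact Measurable.lintegral_prod_right' (f := fun p : ℝ × I => Φ (p.1 + f p.2))
          (hΦ.comp (by fun_prop))

lemma measurable_lintegral_shift (hf : Measurable f) {Φ : ℝ → ℝ≥0∞} (hΦ : Measurable Φ) :
    Measurable fun s : ℝ => ∫⁻ u : I, Φ (s + f u) :=
  Measurable.lintegral_prod_right' (f := fun p : ℝ × I => Φ (p.1 + f p.2)) (hΦ.comp (by fun_prop))

lemma lintegral_sumFirst_congr (hf : Measurable f) (hf' : Measurable f')
    (h : Measure.map f volume = Measure.map f' volume) (k : ℕ) {Φ : ℝ → ℝ≥0∞}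
    (hΦ : Measurable Φ) :
    ∫⁻ x, Φ (sumFirst f k x) ∂seqLaw = ∫⁻ x, Φ (sumFirst f' k x) ∂seqLaw := by
  induction k generalizing Φ with
  | zero => simp [sumFirst]
  | succ k ih =>
    rw [lintegral_sumFirst_succ hf k hΦ, lintegral_sumFirst_succ hf' k hΦ,
      ih (measurable_lintegral_shift hf hΦ)]
    refine lintegral_congr fun x => ?_
    have hΨ : Measurable fun v => Φ (sumFirst f' k x + v) := hΦ.comp (by fun_prop)
    rw [← lintegral_map (f := fun v => Φ (sumFirst f' k x + v)) hΨ hf, h, lintegral_map hΨ hf']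

/-- The law of `π(f)` depends only on that of `f`. -/
lemma absLaw_kruglov_congr_of_map (hf : Measurable f) (hf' : Measurable f')
    (h : Measure.map f volume = Measure.map f' volume) :
    absLaw P (kruglov f) = absLaw P (kruglov f') := by
  refine absLaw_eq_of_measure_lt (measurable_kruglov hf) (measurable_kruglov hf') fun τ _ => ?_
  have key : ∀ {v : I → ℝ}, Measurable v → P {ω | τ < |kruglov v ω|} =
      ∫⁻ ω, {x : ℝ | τ < |x|}.indicator 1 (kruglov v ω) ∂P := by
    intro v hv
    rw [← lintegral_indicator_one
      (measurableSet_lt measurable_const (measurable_kruglov hv).abs)]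
    rfl
  have hΦ : Measurable ({x : ℝ | τ < |x|}.indicator (1 : ℝ → ℝ≥0∞)) :=
    measurable_one.indicator (measurableSet_lt measurable_const (by fun_prop))
  rw [key hf, key hf', lintegral_kruglov hf hΦ, lintegral_kruglov hf' hΦ]
  exact tsum_congr fun k => by rw [lintegral_sumFirst_congr hf hf' h k hΦ]

lemma absLaw_kruglov_congr (hf : Measurable f) (hf' : Measurable f') (h0 : ∀ u, 0 ≤ f u)
    (h0' : ∀ u, 0 ≤ f' u) (h : absLaw volume f = absLaw volume f') :
    absLaw P (kruglov f) = absLaw P (kruglov f') := by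
  refine absLaw_kruglov_congr_of_map hf hf' ?_
  simpa only [absLaw, abs_of_nonneg (h0 _), abs_of_nonneg (h0' _)] using h

lemma lintegral_sumFirst (hf : Measurable f) (h0 : ∀ u, 0 ≤ f u) (k : ℕ) :
    ∫⁻ x, ENNReal.ofReal (sumFirst f k x) ∂seqLaw = k * ∫⁻ u : I, ENNReal.ofReal (f u) := by
  induction k with
  | zero => simp [sumFirst]
  | succ k ih =>
    rw [lintegral_sumFirst_succ hf k ENNReal.measurable_ofReal]
    simp_rw [ENNReal.ofReal_add (sumFirst_nonneg h0 k _) (h0 _)]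
    have h1 : ∀ x : ℕ → I, ∫⁻ u : I, ENNReal.ofReal (sumFirst f k x) + ENNReal.ofReal (f u) =
        ENNReal.ofReal (sumFirst f k x) + ∫⁻ u : I, ENNReal.ofReal (f u) := by
      intro x
      rw [lintegral_add_left measurable_const]
      simp
    simp_rw [h1]
    rw [lintegral_add_right _ measurable_const, ih]
    simp [add_mul]

lemma poissonWeight_succ_mul (k : ℕ) : poissonWeight (k + 1) * ((k + 1 : ℕ) : ℝ≥0∞) =
    poissonWeight k := by
  rw [poissonWeight, poissonWeight, ← ENNReal.ofReal_natCast, ← ENNReal.ofReal_mul (by positivity)]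
  congr 1
  rw [Nat.factorial_succ]
  push_cast
  field_simp

/-- `E π(f) = E f`, as the Poisson parameter is `1`. -/
lemma lintegral_kruglov_id (hf : Measurable f) (h0 : ∀ u, 0 ≤ f u) :
    ∫⁻ ω, ENNReal.ofReal (kruglov f ω) ∂P = ∫⁻ u : I, ENNReal.ofReal (f u) := by
  rw [lintegral_kruglov hf ENNReal.measurable_ofReal]
  simp_rw [lintegral_sumFirst hf h0, ← mul_assoc]
  rw [ENNReal.tsum_mul_right, tsum_eq_zero_add' ENNReal.summable]
  simp_rw [poissonWeight_succ_mul]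
  simp [tsum_poissonWeight]

lemma lintegral_exp_sumFirst (hf : Measurable f) (s : ℝ) (k : ℕ) :
    ∫⁻ x, ENNReal.ofReal (Real.exp (s * sumFirst f k x)) ∂seqLaw =
      (∫⁻ u : I, ENNReal.ofReal (Real.exp (s * f u))) ^ k := by
  induction k with
  | zero => simp [sumFirst]
  | succ k ih =>
    rw [lintegral_sumFirst_succ (Φ := fun y => ENNReal.ofReal (Real.exp (s * y))) hf k
      (by fun_prop)]
    simp_rw [mul_add, Real.exp_add, ENNReal.ofReal_mul (Real.exp_pos _).le]
    have h1 : ∀ x : ℕ → I, ∫⁻ u : I, ENNReal.ofReal (Real.exp (s * sumFirst f k x)) *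
        ENNReal.ofReal (Real.exp (s * f u)) = ENNReal.ofReal (Real.exp (s * sumFirst f k x)) *
        ∫⁻ u : I, ENNReal.ofReal (Real.exp (s * f u)) := fun x =>
      lintegral_const_mul _ (by fun_prop)
    simp_rw [h1]
    rw [lintegral_mul_const _ (by fun_prop), ih, pow_succ]

/-- `E exp(s π(f)) = exp(E exp(s f) - 1)`, stated as an upper bound. -/
lemma lintegral_exp_kruglov_le (hf : Measurable f) {s m : ℝ} (hm : 0 ≤ m)
    (h : ∫⁻ u : I, ENNReal.ofReal (Real.exp (s * f u)) ≤ ENNReal.ofReal m) :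
    ∫⁻ ω, ENNReal.ofReal (Real.exp (s * kruglov f ω)) ∂P ≤ ENNReal.ofReal (Real.exp (m - 1)) := by
  rw [lintegral_kruglov (Φ := fun y => ENNReal.ofReal (Real.exp (s * y))) hf (by fun_prop)]
  simp_rw [lintegral_exp_sumFirst hf]
  calc _ ≤ ∑' k, ENNReal.ofReal (Real.exp (-1) * (m ^ k / (k.factorial : ℝ))) := by
        refine ENNReal.tsum_le_tsum fun k => ?_
        refine (mul_le_mul_right (pow_le_pow_left' h k) _).trans (le_of_eq ?_)
        rw [← ENNReal.ofReal_pow hm, poissonWeight, ← ENNReal.ofReal_mul (by positivity)]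
        congr 1
        ring
    _ = _ := by
        have hs := (Real.summable_pow_div_factorial m).mul_left (Real.exp (-1))
        rw [← ENNReal.ofReal_tsum_of_nonneg (fun k => by positivity) hs, tsum_mul_left,
          show m - 1 = -1 + m by ring, Real.exp_add, Real.exp_eq_exp_ℝ,
          NormedSpace.exp_eq_tsum_div]

lemma lintegral_sumFirst_one (hf : Measurable f) {Φ : ℝ → ℝ≥0∞} (hΦ : Measurable Φ) :
    ∫⁻ x, Φ (sumFirst f 1 x) ∂seqLaw = ∫⁻ u : I, Φ (f u) := by
  rw [lintegral_sumFirst_succ hf 0 hΦ]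
  simp [sumFirst]

/-- On the event `N = 1`, of probability `e⁻¹`, `π(f)` is a copy of `f`. -/
lemma stopLoss_le_kruglov (hf : Measurable f) (c : ℝ) :
    stopLoss volume f c ≤ ENNReal.ofReal (Real.exp 1) * stopLoss P (kruglov f) c := by
  have hΦ : Measurable fun y : ℝ => ENNReal.ofReal (|y| - c) := by fun_prop
  rw [stopLoss, stopLoss, lintegral_kruglov hf hΦ]
  calc _ = ENNReal.ofReal (Real.exp 1) *
        (poissonWeight 1 * ∫⁻ x, ENNReal.ofReal (|sumFirst f 1 x| - c) ∂seqLaw) := by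
        rw [lintegral_sumFirst_one hf hΦ, ← mul_assoc, poissonWeight,
          ← ENNReal.ofReal_mul (Real.exp_pos _).le]
        simp [← Real.exp_add]
    _ ≤ _ := by
        gcongr
        exact ENNReal.le_tsum (f := fun k => poissonWeight k *
          ∫⁻ x, ENNReal.ofReal (|sumFirst f k x| - c) ∂seqLaw) 1

lemma pow_le_measure_sumFirst (hf : Measurable f) (τ : ℝ) (k : ℕ) :
    (volume {u : I | τ ≤ f u}) ^ k ≤ seqLaw {x | k * τ ≤ sumFirst f k x} := by
  have hind : ∀ k : ℕ, seqLaw {x | k * τ ≤ sumFirst f k x} =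
      ∫⁻ x, (Ici ((k : ℝ) * τ)).indicator 1 (sumFirst f k x) ∂seqLaw := by
    intro k
    rw [← lintegral_indicator_one (measurableSet_le measurable_const (measurable_sumFirst hf k))]
    rfl
  induction k with
  | zero => simp [sumFirst]
  | succ k ih =>
    rw [hind, lintegral_sumFirst_succ hf k (measurable_one.indicator measurableSet_Ici)]
    calc _ ≤ (∫⁻ x, (Ici ((k : ℝ) * τ)).indicator 1 (sumFirst f k x) ∂seqLaw) *
          volume {u : I | τ ≤ f u} := by
          rw [pow_succ, ← hind]
          gcongr
      _ = ∫⁻ x, (∫⁻ u : I, (Ici ((k : ℝ) * τ)).indicator 1 (sumFirst f k x) *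
            {u : I | τ ≤ f u}.indicator 1 u) ∂seqLaw := by
          have hm : Measurable fun x =>
              (Ici ((k : ℝ) * τ)).indicator (1 : ℝ → ℝ≥0∞) (sumFirst f k x) :=
            (measurable_one.indicator measurableSet_Ici).comp (measurable_sumFirst hf k)
          rw [← lintegral_mul_const _ hm]
          refine lintegral_congr fun x => ?_
          rw [lintegral_const_mul _ (measurable_one.indicator
            (measurableSet_le measurable_const hf)),
            lintegral_indicator_one (measurableSet_le measurable_const hf)]
      _ ≤ _ := by
          refine lintegral_mono fun x => lintegral_mono fun u => ?_
          simp only [indicator, mem_Ici, mem_ofPred_eq, Pi.one_apply]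
          split_ifs with h1 h2 h3 <;> simp
          push_cast at h3
          linarith

/-- If `N = k` and all of `f_1, …, f_k` are at least `τ`, then `π(f) ≥ k τ`. -/
lemma le_measure_kruglov (hf : Measurable f) (τ : ℝ) (k : ℕ) :
    poissonWeight k * (volume {u : I | τ ≤ f u}) ^ k ≤ P {ω | k * τ ≤ kruglov f ω} := by
  have hm : Measurable ((Ici ((k : ℝ) * τ)).indicator (1 : ℝ → ℝ≥0∞)) :=
    measurable_one.indicator measurableSet_Ici
  have h1 : P {ω | k * τ ≤ kruglov f ω} =
      ∫⁻ ω, (Ici ((k : ℝ) * τ)).indicator 1 (kruglov f ω) ∂P := by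
    rw [← lintegral_indicator_one (measurableSet_le measurable_const (measurable_kruglov hf))]
    rfl
  rw [h1, lintegral_kruglov hf hm]
  refine le_trans ?_ (ENNReal.le_tsum k)
  gcongr
  refine (pow_le_measure_sumFirst hf τ k).trans (le_of_eq ?_)
  rw [← lintegral_indicator_one (measurableSet_le measurable_const (measurable_sumFirst hf k))]
  rfl

lemma lintegral_indicator_Ioi {α : Type*} [MeasurableSpace α] {μ : Measure α} {v : α → ℝ}
    (hv : Measurable v) (c : ℝ) :
    ∫⁻ a, (Ioi c).indicator 1 (v a) ∂μ = μ {a | c < v a} := by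
  rw [← lintegral_indicator_one (measurableSet_lt measurable_const hv)]
  rfl

/-- One step of the random walk: below the level `c` the new summand overshoots by at most `A` on
average, above the level it adds its mean, which is `1`. -/
lemma stopLoss_step (hf : Measurable f) (h0 : ∀ u, 0 ≤ f u)
    (hmean : ∫⁻ u : I, ENNReal.ofReal (f u) = 1) {A : ℝ≥0∞}
    (hres : ∀ c, 0 ≤ c → stopLoss volume f c ≤ A * volume {u : I | c < f u}) (c s : ℝ) :
    (∫⁻ u : I, ENNReal.ofReal (s + f u - c)) + A * (Ioi c).indicator 1 s ≤
      ENNReal.ofReal (s - c) + (Ioi c).indicator 1 s +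
        A * ∫⁻ u : I, (Ioi c).indicator 1 (s + f u) := by
  rw [lintegral_indicator_Ioi (by fun_prop)]
  rcases lt_or_ge c s with hcs | hcs
  · have h1 : {u : I | c < s + f u} = univ := by
      ext u
      simpa using hcs.trans_le (le_add_of_nonneg_right (h0 u))
    have h2 : ∫⁻ u : I, ENNReal.ofReal (s + f u - c) = ENNReal.ofReal (s - c) + 1 := by
      rw [← hmean]
      have : ∀ u : I, ENNReal.ofReal (s + f u - c) =
          ENNReal.ofReal (s - c) + ENNReal.ofReal (f u) := by
        intro u
        rw [← ENNReal.ofReal_add (by linarith) (h0 u)]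
        congr 1
        ring
      simp_rw [this]
      rw [lintegral_add_left measurable_const]
      simp
    rw [h1, h2]
    simp [hcs]
  · have h1 := hres (c - s) (by linarith)
    simp only [stopLoss, abs_of_nonneg (h0 _)] at h1
    have h2 : ∀ u : I, s + f u - c = f u - (c - s) := fun u => by ring
    have h3 : {u : I | c < s + f u} = {u : I | c - s < f u} := by
      ext u
      simp only [mem_ofPred_eq]
      constructor <;> intro h <;> linarith
    simp_rw [h2]
    rw [h3]
    simpa [not_lt.2 hcs, ENNReal.ofReal_of_nonpos (sub_nonpos.2 hcs)] using h1

/-- The mean excess of `f_1 + ⋯ + f_k` over the level `c` is at most `A` times the probability of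
having crossed it plus the mean number of the earlier partial sums above it. -/
lemma stopLoss_sumFirst_le (hf : Measurable f) (h0 : ∀ u, 0 ≤ f u)
    (hmean : ∫⁻ u : I, ENNReal.ofReal (f u) = 1) {A : ℝ≥0∞} (hA : A ≠ ∞)
    (hres : ∀ c, 0 ≤ c → stopLoss volume f c ≤ A * volume {u : I | c < f u}) {c : ℝ} (hc : 0 ≤ c)
    (k : ℕ) :
    ∫⁻ x, ENNReal.ofReal (sumFirst f k x - c) ∂seqLaw ≤
      A * seqLaw {x | c < sumFirst f k x} +
        ∑ j ∈ Finset.range k, seqLaw {x | c < sumFirst f j x} := by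
  induction k with
  | zero => simp [sumFirst, ENNReal.ofReal_of_nonpos (neg_nonpos.2 hc)]
  | succ k ih =>
    have hk := measurable_sumFirst hf k
    have hind : Measurable ((Ioi c).indicator (1 : ℝ → ℝ≥0∞)) :=
      measurable_one.indicator measurableSet_Ioi
    have hindk : Measurable fun x => (Ioi c).indicator (1 : ℝ → ℝ≥0∞) (sumFirst f k x) :=
      hind.comp hk
    have hΦ : Measurable fun y : ℝ => ENNReal.ofReal (y - c) := by fun_prop
    have key : (∫⁻ x, ENNReal.ofReal (sumFirst f (k + 1) x - c) ∂seqLaw) +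
        A * seqLaw {x | c < sumFirst f k x} ≤
        (∫⁻ x, ENNReal.ofReal (sumFirst f k x - c) ∂seqLaw) + seqLaw {x | c < sumFirst f k x} +
          A * seqLaw {x | c < sumFirst f (k + 1) x} := by
      rw [← lintegral_indicator_Ioi hk, ← lintegral_indicator_Ioi (measurable_sumFirst hf (k + 1)),
        lintegral_sumFirst_succ hf k hΦ, lintegral_sumFirst_succ hf k hind,
        ← lintegral_const_mul _ hindk, ← lintegral_const_mul' _ _ hA,
        ← lintegral_add_right _ (by fun_prop), ← lintegral_add_right _ (by fun_prop),
        ← lintegral_add_left (by fun_prop)]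
      exact lintegral_mono fun x => stopLoss_step hf h0 hmean hres c _
    have hfin : A * seqLaw {x | c < sumFirst f k x} ≠ ∞ :=
      ENNReal.mul_ne_top hA (measure_ne_top _ _)
    rw [Finset.sum_range_succ]
    refine (ENNReal.add_le_add_iff_right hfin).1 (key.trans ?_)
    calc _ ≤ A * seqLaw {x | c < sumFirst f k x} +
          ∑ j ∈ Finset.range k, seqLaw {x | c < sumFirst f j x} +
          seqLaw {x | c < sumFirst f k x} + A * seqLaw {x | c < sumFirst f (k + 1) x} := by
          gcongr
      _ = _ := by ring

/-- `P(N > j) ≤ e P(N = j)` for a Poisson variable `N` with parameter `1`. -/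
lemma tsum_poissonWeight_tail_le (j : ℕ) :
    ∑' i, poissonWeight (i + (j + 1)) ≤ ENNReal.ofReal (Real.exp 1) * poissonWeight j := by
  calc _ ≤ ∑' i, (poissonWeight i * (ENNReal.ofReal (Real.exp 1) * poissonWeight j)) := by
        refine ENNReal.tsum_le_tsum fun i => ?_
        rw [poissonWeight, poissonWeight, poissonWeight, ← ENNReal.ofReal_mul (by positivity),
          ← ENNReal.ofReal_mul (by positivity)]
        refine ENNReal.ofReal_le_ofReal ?_
        have h1 : i.factorial * j.factorial ≤ (i + (j + 1)).factorial :=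
          (Nat.le_of_dvd (Nat.factorial_pos _) (Nat.factorial_mul_factorial_dvd_factorial_add i j)
            ).trans (Nat.factorial_le (by omega))
        have h2 : (i.factorial : ℝ) * j.factorial ≤ (i + (j + 1)).factorial := by exact_mod_cast h1
        have h3 : Real.exp (-1) / (i.factorial : ℝ) * (Real.exp 1 * (Real.exp (-1) / j.factorial)) =
            Real.exp (-1) / (i.factorial * j.factorial) := by
          have : Real.exp 1 * Real.exp (-1) = 1 := by rw [← Real.exp_add]; simp
          field_simp
          linear_combination this
        rw [h3]
        gcongr
    _ = _ := by rw [ENNReal.tsum_mul_right, tsum_poissonWeight, one_mul]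

/-- Interchange of summation: `∑_k w_k ∑_{j<k} b_j = ∑_j b_j ∑_{k>j} w_k`. -/
lemma tsum_mul_sum_range_eq (w b : ℕ → ℝ≥0∞) :
    ∑' k, w k * ∑ j ∈ Finset.range k, b j = ∑' j, b j * ∑' i, w (i + (j + 1)) := by
  have h1 : ∀ k, w k * ∑ j ∈ Finset.range k, b j = ∑' j, if j < k then b j * w k else 0 := by
    intro k
    rw [tsum_eq_sum (s := Finset.range k), Finset.mul_sum]
    · refine Finset.sum_congr rfl fun j hj => ?_
      rw [if_pos (Finset.mem_range.1 hj), mul_comm]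
    · intro j hj
      rw [if_neg (by simpa using hj)]
  simp_rw [h1]
  rw [ENNReal.tsum_comm]
  refine tsum_congr fun j => ?_
  rw [← ENNReal.summable.sum_add_tsum_nat_add' (k := j + 1), Finset.sum_eq_zero, zero_add,
    ← ENNReal.tsum_mul_left]
  · exact tsum_congr fun i => if_pos (by omega)
  · intro i hi
    exact if_neg (by simp at hi; omega)

/-- The mean residual life of `π(f)` exceeds that of `f` by at most a constant: the sum jumps over
the level `c` with one summand, which overshoots as much as a copy of `f` does, and the number of
the remaining summands is bounded on average. -/
lemma stopLoss_kruglov_le (hf : Measurable f) (h0 : ∀ u, 0 ≤ f u)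
    (hmean : ∫⁻ u : I, ENNReal.ofReal (f u) = 1) {A : ℝ≥0∞} (hA : A ≠ ∞)
    (hres : ∀ c, 0 ≤ c → stopLoss volume f c ≤ A * volume {u : I | c < f u}) {c : ℝ}
    (hc : 0 ≤ c) :
    stopLoss P (kruglov f) c ≤
      (A + ENNReal.ofReal (Real.exp 1)) * P {ω | c < kruglov f ω} := by
  have hΦ : Measurable fun y : ℝ => ENNReal.ofReal (y - c) := by fun_prop
  have hind : Measurable ((Ioi c).indicator (1 : ℝ → ℝ≥0∞)) :=
    measurable_one.indicator measurableSet_Ioi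
  simp only [stopLoss, abs_of_nonneg (kruglov_nonneg h0 _)]
  rw [← lintegral_indicator_Ioi (measurable_kruglov hf), lintegral_kruglov hf hΦ,
    lintegral_kruglov hf hind]
  simp_rw [lintegral_indicator_Ioi (measurable_sumFirst hf _)]
  set b : ℕ → ℝ≥0∞ := fun k => seqLaw {x | c < sumFirst f k x}
  calc _ ≤ ∑' k, poissonWeight k * (A * b k + ∑ j ∈ Finset.range k, b j) := by
        refine ENNReal.tsum_le_tsum fun k => ?_
        gcongr
        exact stopLoss_sumFirst_le hf h0 hmean hA hres hc k
    _ = A * ∑' k, poissonWeight k * b k + ∑' j, b j * ∑' i, poissonWeight (i + (j + 1)) := by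
        rw [← tsum_mul_sum_range_eq, ← ENNReal.tsum_mul_left, ← ENNReal.tsum_add]
        exact tsum_congr fun k => by ring
    _ ≤ A * ∑' k, poissonWeight k * b k +
        ∑' j, b j * (ENNReal.ofReal (Real.exp 1) * poissonWeight j) := by
        gcongr
        exact tsum_poissonWeight_tail_le _
    _ = _ := by
        rw [add_mul, ← ENNReal.tsum_mul_left (a := ENNReal.ofReal (Real.exp 1))]
        congr 1
        exact tsum_congr fun k => by ring

end Operator

/-! ### The iterates `h_n` and the series `g_ε` -/

section Iterates

variable {ε δ t : ℝ} {n : ℕ}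

lemma measurable_kruglovPow (n : ℕ) : Measurable (kruglovPow n) := by
  induction n with
  | zero => exact measurable_const
  | succ n ih => exact (measurable_rearr (measurable_kruglov ih)).comp measurable_subtype_coe

lemma kruglovPow_nonneg (n : ℕ) (u : I) : 0 ≤ kruglovPow n u := by
  cases n with
  | zero => exact zero_le_one
  | succ n => exact rearr_nonneg _ _ _

/-- The restriction of `h_n` to `[0,1]`. -/
noncomputable def hI (n : ℕ) (u : I) : ℝ := h n u

@[fun_prop]
lemma measurable_h (n : ℕ) : Measurable (h n) := measurable_rearr (measurable_kruglovPow n)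

@[fun_prop]
lemma measurable_hI (n : ℕ) : Measurable (hI n) := (measurable_h n).comp measurable_subtype_coe

lemma h_nonneg (n : ℕ) (t : ℝ) : 0 ≤ h n t := rearr_nonneg _ _ _

lemma hI_nonneg (n : ℕ) (u : I) : 0 ≤ hI n u := h_nonneg _ _

lemma h_antitoneOn (n : ℕ) : AntitoneOn (h n) (Ioi 0) := rearr_antitoneOn (measurable_kruglovPow n)

lemma h_of_nonpos (ht : t ≤ 0) : h n t = 0 := rearr_of_nonpos ht

lemma h_of_one_lt (ht : 1 < t) : h n t = 0 := by
  refine le_antisymm (rearr_le_of_measure_lt le_rfl ?_) (h_nonneg _ _)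
  refine prob_le_one.trans_lt ?_
  rw [← ENNReal.ofReal_one]
  exact (ENNReal.ofReal_lt_ofReal_iff (by linarith)).2 ht

lemma absLaw_hI (n : ℕ) : absLaw volume (hI n) = absLaw volume (kruglovPow n) :=
  absLaw_rearr_unitInterval (measurable_kruglovPow n)

lemma h_eq_rearr (n : ℕ) : h n = rearr volume (hI n) :=
  (rearr_congr (measurable_hI n) (measurable_kruglovPow n) (absLaw_hI n)).symm

lemma absLaw_hI_succ (n : ℕ) : absLaw volume (hI (n + 1)) = absLaw P (kruglov (hI n)) := by
  rw [absLaw_hI, absLaw_kruglov_congr (measurable_hI n) (measurable_kruglovPow n) (hI_nonneg n)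
    (kruglovPow_nonneg n) (absLaw_hI n)]
  exact absLaw_rearr_unitInterval (measurable_kruglov (measurable_kruglovPow n))

/-- `h_{n+1} = (π(h_n))^*`. -/
lemma h_succ (n : ℕ) : h (n + 1) = rearr P (kruglov (hI n)) := by
  rw [h_eq_rearr, rearr_congr (measurable_hI _) (measurable_kruglov (measurable_hI n))
    (absLaw_hI_succ n)]

lemma h_zero (ht : t ∈ Ioc (0 : ℝ) 1) : h 0 t = 1 := by
  apply le_antisymm
  · refine rearr_le_of_measure_lt zero_le_one ?_
    simpa [kruglovPow] using ht.1
  · refine le_rearr_of_le_measure (measurable_kruglovPow 0) ht.1 ?_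
    simpa [kruglovPow] using ht.2

/-- `h_{n+1}` has the law of `π(h_n)`. -/
lemma lintegral_hI_succ (n : ℕ) {Φ : ℝ → ℝ≥0∞} (hΦ : Measurable Φ) :
    ∫⁻ u, Φ (hI (n + 1) u) = ∫⁻ ω, Φ (kruglov (hI n) ω) ∂P := by
  have h1 := lintegral_absLaw (μ := volume) (measurable_hI (n + 1)) hΦ
  rw [absLaw_hI_succ, lintegral_absLaw (measurable_kruglov (measurable_hI n)) hΦ] at h1
  simpa only [abs_of_nonneg (hI_nonneg _ _), abs_of_nonneg (kruglov_nonneg (hI_nonneg n) _)]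
    using h1.symm

lemma lintegral_hI_eq (n : ℕ) {Φ : ℝ → ℝ≥0∞} (hΦ : Measurable Φ) :
    ∫⁻ u, Φ (hI n u) = ∫⁻ s in Ioc (0 : ℝ) 1, Φ (h n s) :=
  lintegral_unitInterval (hΦ.comp (measurable_h n))

lemma lintegral_hI_zero {Φ : ℝ → ℝ≥0∞} (hΦ : Measurable Φ) : ∫⁻ u, Φ (hI 0 u) = Φ 1 := by
  rw [lintegral_hI_eq 0 hΦ, setLIntegral_congr_fun (g := fun _ => Φ 1) measurableSet_Ioc]
  · simp
  · intro s hs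
    simp only [h_zero hs]

lemma lintegral_hI (n : ℕ) : ∫⁻ u, ENNReal.ofReal (hI n u) = 1 := by
  induction n with
  | zero => rw [lintegral_hI_zero ENNReal.measurable_ofReal, ENNReal.ofReal_one]
  | succ n ih =>
    rw [lintegral_hI_succ n ENNReal.measurable_ofReal,
      lintegral_kruglov_id (measurable_hI n) (hI_nonneg n), ih]

lemma topIntegral_hI (n : ℕ) (t : ℝ) :
    topIntegral volume (hI n) t = ∫⁻ s in Ioc (0 : ℝ) t, ENNReal.ofReal (h n s) := by
  rw [topIntegral, ← h_eq_rearr]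

lemma topIntegral_hI_le_one (ht : t ≤ 1) : topIntegral volume (hI n) t ≤ 1 := by
  refine (topIntegral_mono ht).trans (le_of_eq ?_)
  rw [topIntegral_hI, ← lintegral_hI_eq n ENNReal.measurable_ofReal, lintegral_hI]

/-- `t f^*(t) ≤ ∫_0^t f^*`. -/
lemma mul_rearr_le_topIntegral {α : Type*} [MeasurableSpace α] {μ : Measure α}
    [IsProbabilityMeasure μ] {f : α → ℝ} (hf : Measurable f) (ht : 0 < t) :
    ENNReal.ofReal (t * rearr μ f t) ≤ topIntegral μ f t := by
  calc _ = ∫⁻ s in Ioc (0 : ℝ) t, ENNReal.ofReal (rearr μ f t) := by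
        simp [ENNReal.ofReal_mul ht.le, mul_comm]
    _ ≤ _ := setLIntegral_mono (measurable_rearr hf).ennreal_ofReal fun s hs =>
        ENNReal.ofReal_le_ofReal (rearr_antitoneOn hf hs.1 ht hs.2)

lemma h_le_inv (ht : t ∈ Ioc (0 : ℝ) 1) : h n t ≤ 1 / t := by
  have h1 := (mul_rearr_le_topIntegral (μ := volume) (measurable_hI n) ht.1).trans
    (topIntegral_hI_le_one ht.2)
  rw [← h_eq_rearr, ← ENNReal.ofReal_one, ENNReal.ofReal_le_ofReal_iff zero_le_one] at h1
  rw [le_div_iff₀ ht.1]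
  linarith

/-- The mean residual life of `h_n` is bounded by a constant growing linearly in `n`. -/
lemma stopLoss_hI_le (n : ℕ) {c : ℝ} (hc : 0 ≤ c) :
    stopLoss volume (hI n) c ≤
      ENNReal.ofReal (1 + n * Real.exp 1) * volume {u : I | c < hI n u} := by
  induction n generalizing c with
  | zero =>
    rw [← lintegral_indicator_Ioi (measurable_hI 0), lintegral_hI_zero
      (measurable_one.indicator measurableSet_Ioi), stopLoss, lintegral_hI_zero
      (Φ := fun x => ENNReal.ofReal (|x| - c)) (by fun_prop)]
    rcases lt_or_ge c 1 with h1 | h1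
    · simpa [h1] using hc
    · simp [ENNReal.ofReal_of_nonpos (sub_nonpos.2 h1)]
  | succ n ih =>
    have h1 := stopLoss_kruglov_le (measurable_hI n) (hI_nonneg n) (lintegral_hI n)
      ENNReal.ofReal_ne_top (fun c hc => ih hc) hc
    have h2 : stopLoss volume (hI (n + 1)) c = stopLoss P (kruglov (hI n)) c :=
      lintegral_hI_succ n (Φ := fun x => ENNReal.ofReal (|x| - c)) (by fun_prop)
    have h3 : volume {u : I | c < hI (n + 1) u} = P {ω | c < kruglov (hI n) ω} := by
      rw [← lintegral_indicator_Ioi (measurable_hI _), ← lintegral_indicator_Ioi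
        (measurable_kruglov (measurable_hI n)),
        lintegral_hI_succ n (measurable_one.indicator measurableSet_Ioi)]
    rw [h2, h3]
    refine h1.trans (le_of_eq ?_)
    rw [← ENNReal.ofReal_add (by positivity) (Real.exp_pos _).le]
    congr 2
    push_cast
    ring

lemma topIntegral_hI_le (ht : t ∈ Ioc (0 : ℝ) 1) :
    topIntegral volume (hI n) t ≤ ENNReal.ofReal (t * (h n t + (1 + n * Real.exp 1))) := by
  have h0 := h_nonneg n t
  rw [topIntegral_eq (measurable_hI n) ht, ← h_eq_rearr]
  have h1 : volume {u : I | h n t < hI n u} ≤ ENNReal.ofReal t := by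
    have := measure_rearr_lt_le (μ := volume) (measurable_hI n) ht.1
    simpa only [← h_eq_rearr, abs_of_nonneg (hI_nonneg _ _)] using this
  calc _ ≤ ENNReal.ofReal (1 + n * Real.exp 1) * ENNReal.ofReal t + ENNReal.ofReal (h n t * t) := by
        gcongr
        exact (stopLoss_hI_le n h0).trans (by gcongr)
    _ = _ := by
        rw [← ENNReal.ofReal_mul (by positivity), ← ENNReal.ofReal_add
          (mul_nonneg (by positivity) ht.1.le) (mul_nonneg h0 ht.1.le)]
        congr 1
        ring

lemma summable_g (hε : ε ∈ Ioo (0 : ℝ) 1) (t : ℝ) : Summable fun n : ℕ => ε ^ n * h n t := by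
  by_cases ht : t ∈ Ioc (0 : ℝ) 1
  · refine Summable.of_nonneg_of_le (fun n => mul_nonneg (pow_nonneg hε.1.le n) (h_nonneg n t))
      (fun n => mul_le_mul_of_nonneg_left (h_le_inv ht) (pow_nonneg hε.1.le n)) ?_
    exact (summable_geometric_of_lt_one hε.1.le hε.2).mul_right _
  · have : ∀ n, h n t = 0 := by
      intro n
      rcases le_or_gt t 0 with h0 | h0
      · exact h_of_nonpos h0
      · exact h_of_one_lt (by by_contra! h1; exact ht ⟨h0, h1⟩)
    simp [this, summable_zero]

lemma ofReal_g (hε : ε ∈ Ioo (0 : ℝ) 1) (t : ℝ) :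
    ENNReal.ofReal (g ε t) = ∑' n, ENNReal.ofReal (ε ^ n) * ENNReal.ofReal (h n t) := by
  rw [g, ENNReal.ofReal_tsum_of_nonneg
    (fun n => mul_nonneg (pow_nonneg hε.1.le n) (h_nonneg n t)) (summable_g hε t)]
  exact tsum_congr fun n => ENNReal.ofReal_mul (pow_nonneg hε.1.le n)

lemma g_nonneg (hε : 0 ≤ ε) (t : ℝ) : 0 ≤ g ε t :=
  tsum_nonneg fun n => mul_nonneg (pow_nonneg hε n) (h_nonneg n t)

lemma measurable_g (hε : ε ∈ Ioo (0 : ℝ) 1) : Measurable (g ε) := by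
  have h1 : g ε = fun t => (∑' n, ENNReal.ofReal (ε ^ n) * ENNReal.ofReal (h n t)).toReal := by
    funext t
    rw [← ofReal_g hε, ENNReal.toReal_ofReal (g_nonneg hε.1.le t)]
  rw [h1]
  exact (Measurable.tsum fun n => by fun_prop).ennreal_toReal

lemma g_antitoneOn (hε : ε ∈ Ioo (0 : ℝ) 1) : AntitoneOn (g ε) (Ioi 0) := by
  intro s hs t ht hst
  exact (summable_g hε t).tsum_le_tsum (fun n => mul_le_mul_of_nonneg_left
    (h_antitoneOn n hs ht hst) (pow_nonneg hε.1.le n)) (summable_g hε s)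

lemma one_le_g (hε : ε ∈ Ioo (0 : ℝ) 1) (ht : t ∈ Ioc (0 : ℝ) 1) : 1 ≤ g ε t := by
  have := (summable_g hε t).le_tsum 0
    (fun n _ => mul_nonneg (pow_nonneg hε.1.le n) (h_nonneg n t))
  rw [pow_zero, one_mul, h_zero ht] at this
  exact this

lemma lintegral_g (hε : ε ∈ Ioo (0 : ℝ) 1) (t : ℝ) :
    ∫⁻ s in Ioc (0 : ℝ) t, ENNReal.ofReal (g ε s) =
      ∑' n, ENNReal.ofReal (ε ^ n) * topIntegral volume (hI n) t := by
  simp_rw [ofReal_g hε]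
  rw [lintegral_tsum fun n => by fun_prop]
  refine tsum_congr fun n => ?_
  rw [lintegral_const_mul _ (by fun_prop), topIntegral_hI]

lemma tsum_ofReal_pow_ne_top (hε : ε ∈ Ioo (0 : ℝ) 1) :
    ∑' n : ℕ, ENNReal.ofReal (ε ^ n) ≠ ∞ := by
  rw [← ENNReal.ofReal_tsum_of_nonneg (fun n => pow_nonneg hε.1.le n)
    (summable_geometric_of_lt_one hε.1.le hε.2)]
  exact ENNReal.ofReal_ne_top

lemma integrableOn_g (hε : ε ∈ Ioo (0 : ℝ) 1) : IntegrableOn (g ε) (Ioc 0 1) := by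
  refine ⟨(measurable_g hε).aestronglyMeasurable, ?_⟩
  rw [hasFiniteIntegral_iff_ofReal (ae_of_all _ fun t => g_nonneg hε.1.le t), lintegral_g hε]
  refine lt_of_le_of_lt (ENNReal.tsum_le_tsum fun n =>
    mul_le_of_le_one_right' (topIntegral_hI_le_one le_rfl)) (tsum_ofReal_pow_ne_top hε).lt_top

lemma tendsto_lintegral_sub (hε : ε ∈ Ioo (0 : ℝ) 1) :
    Tendsto (fun N : ℕ => ∫⁻ t in Ioc (0 : ℝ) 1,
      ‖g ε t - ∑ n ∈ Finset.range N, ε ^ n * h n t‖ₑ) atTop (𝓝 0) := by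
  refine tendsto_of_tendsto_of_tendsto_of_le_of_le tendsto_const_nhds
    (ENNReal.tendsto_sum_nat_add (fun n => ENNReal.ofReal (ε ^ n)) (tsum_ofReal_pow_ne_top hε))
    (fun _ => zero_le) fun N => ?_
  have h1 : ∀ t, ‖g ε t - ∑ n ∈ Finset.range N, ε ^ n * h n t‖ₑ =
      ∑' n, ENNReal.ofReal (ε ^ (n + N)) * ENNReal.ofReal (h (n + N) t) := by
    intro t
    have hpos : ∀ n, 0 ≤ ε ^ (n + N) * h (n + N) t := fun n =>
      mul_nonneg (pow_nonneg hε.1.le _) (h_nonneg _ t)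
    rw [g, ← (summable_g hε t).sum_add_tsum_nat_add N, add_sub_cancel_left, Real.enorm_eq_ofReal
      (tsum_nonneg hpos), ENNReal.ofReal_tsum_of_nonneg hpos
      ((summable_nat_add_iff N).2 (summable_g hε t))]
    exact tsum_congr fun n => ENNReal.ofReal_mul (pow_nonneg hε.1.le _)
  simp_rw [h1]
  rw [lintegral_tsum fun n => by fun_prop]
  refine ENNReal.tsum_le_tsum fun n => ?_
  rw [lintegral_const_mul _ (by fun_prop), ← topIntegral_hI]
  exact mul_le_of_le_one_right' (topIntegral_hI_le_one le_rfl)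

lemma psi_eq_setIntegral (ht : 0 ≤ t) : psi ε t = ∫ s in Ioc (0 : ℝ) t, g ε s :=
  intervalIntegral.integral_of_le ht

lemma ofReal_psi (hε : ε ∈ Ioo (0 : ℝ) 1) (ht : t ∈ Icc (0 : ℝ) 1) :
    ENNReal.ofReal (psi ε t) = ∑' n, ENNReal.ofReal (ε ^ n) * topIntegral volume (hI n) t := by
  rw [psi_eq_setIntegral ht.1, ofReal_integral_eq_lintegral_ofReal
    ((integrableOn_g hε).mono_set (Ioc_subset_Ioc_right ht.2))
    (ae_of_all _ fun s => g_nonneg hε.1.le s), lintegral_g hε]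

lemma psi_nonneg (hε : 0 ≤ ε) (ht : 0 ≤ t) : 0 ≤ psi ε t :=
  intervalIntegral.integral_nonneg ht fun s _ => g_nonneg hε s

lemma psi_zero (ε : ℝ) : psi ε 0 = 0 := by simp [psi]

lemma intervalIntegrable_g (hε : ε ∈ Ioo (0 : ℝ) 1) {a b : ℝ} (ha : a ∈ Icc (0 : ℝ) 1)
    (hb : b ∈ Icc (0 : ℝ) 1) : IntervalIntegrable (g ε) volume a b := by
  have h1 : IntervalIntegrable (g ε) volume 0 1 :=
    (intervalIntegrable_iff_integrableOn_Ioc_of_le zero_le_one).2 (integrableOn_g hε)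
  refine h1.mono_set ?_
  rw [uIcc_of_le zero_le_one]
  exact uIcc_subset_Icc ha hb

lemma psi_sub (hε : ε ∈ Ioo (0 : ℝ) 1) {a b : ℝ} (ha : a ∈ Icc (0 : ℝ) 1)
    (hb : b ∈ Icc (0 : ℝ) 1) : psi ε b - psi ε a = ∫ s in a..b, g ε s := by
  have h0 : (0 : ℝ) ∈ Icc (0 : ℝ) 1 := by simp
  exact intervalIntegral.integral_interval_sub_left (intervalIntegrable_g hε h0 hb)
    (intervalIntegrable_g hε h0 ha)

lemma mul_le_psi_sub (hε : ε ∈ Ioo (0 : ℝ) 1) {a b m : ℝ} (ha : 0 ≤ a) (hab : a ≤ b) (hb : b ≤ 1)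
    (hm : ∀ s ∈ Ioc a b, m ≤ g ε s) : (b - a) * m ≤ psi ε b - psi ε a := by
  have hI := intervalIntegrable_g hε ⟨ha, hab.trans hb⟩ ⟨ha.trans hab, hb⟩
  rw [psi_sub hε ⟨ha, hab.trans hb⟩ ⟨ha.trans hab, hb⟩, ← smul_eq_mul,
    ← intervalIntegral.integral_const]
  rw [intervalIntegral.integral_of_le hab, intervalIntegral.integral_of_le hab]
  refine setIntegral_mono_on (by simp) ?_ measurableSet_Ioc hm
  exact (intervalIntegrable_iff_integrableOn_Ioc_of_le hab).1 hI

lemma psi_sub_le_mul (hε : ε ∈ Ioo (0 : ℝ) 1) {a b m : ℝ} (ha : 0 ≤ a) (hab : a ≤ b) (hb : b ≤ 1)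
    (hm : ∀ s ∈ Ioc a b, g ε s ≤ m) : psi ε b - psi ε a ≤ (b - a) * m := by
  have hI := intervalIntegrable_g hε ⟨ha, hab.trans hb⟩ ⟨ha.trans hab, hb⟩
  rw [psi_sub hε ⟨ha, hab.trans hb⟩ ⟨ha.trans hab, hb⟩, ← smul_eq_mul,
    ← intervalIntegral.integral_const]
  rw [intervalIntegral.integral_of_le hab, intervalIntegral.integral_of_le hab]
  refine setIntegral_mono_on ?_ (by simp) measurableSet_Ioc hm
  exact (intervalIntegrable_iff_integrableOn_Ioc_of_le hab).1 hI

lemma psi_strictMonoOn (hε : ε ∈ Ioo (0 : ℝ) 1) : StrictMonoOn (psi ε) (Icc 0 1) := by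
  intro a ha b hb hab
  have := mul_le_psi_sub hε (m := 1) ha.1 hab.le hb.2 fun s hs =>
    one_le_g hε ⟨ha.1.trans_lt hs.1, hs.2.trans hb.2⟩
  linarith

lemma psi_pos (hε : ε ∈ Ioo (0 : ℝ) 1) (ht : t ∈ Ioc (0 : ℝ) 1) : 0 < psi ε t := by
  rw [← psi_zero ε]
  exact psi_strictMonoOn hε (by simp) (Ioc_subset_Icc_self ht) ht.1

lemma psi_concaveOn (hε : ε ∈ Ioo (0 : ℝ) 1) : ConcaveOn ℝ (Icc 0 1) (psi ε) := by
  refine concaveOn_of_slope_anti_adjacent (convex_Icc 0 1) fun {x y z} hx hz hxy hyz => ?_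
  have hy : 0 < y := hx.1.trans_lt hxy
  have h1 := mul_le_psi_sub hε (m := g ε y) hx.1 hxy.le (hyz.le.trans hz.2) fun s hs =>
    g_antitoneOn hε (hx.1.trans_lt hs.1) hy hs.2
  have h2 := psi_sub_le_mul hε (m := g ε y) hy.le hyz.le hz.2 fun s hs =>
    g_antitoneOn hε hy (hy.trans hs.1) hs.1.le
  calc _ ≤ g ε y := by rw [div_le_iff₀ (by linarith)]; linarith
    _ ≤ _ := by rw [le_div_iff₀ (by linarith)]; linarith

/-- Averaging does not enlarge `g_ε` by more than a constant factor, because the mean residual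
lives of the `h_n` grow only linearly in `n`. -/
lemma psi_le_mul_g (hε : ε ∈ Ioo (0 : ℝ) 1) :
    ∃ C : ℝ, 0 < C ∧ ∀ t ∈ Ioc (0 : ℝ) 1, psi ε t ≤ C * (t * g ε t) := by
  have hA : Summable fun n : ℕ => ε ^ n * (1 + n * Real.exp 1) := by
    have h1 := summable_geometric_of_lt_one hε.1.le hε.2
    have h2 := (summable_pow_mul_geometric_of_norm_lt_one 1
      (r := ε) (by rw [Real.norm_of_nonneg hε.1.le]; exact hε.2)).mul_left (Real.exp 1)
    refine (h1.add h2).congr fun n => ?_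
    ring
  set A := ∑' n : ℕ, ε ^ n * (1 + n * Real.exp 1) with hAdef
  have hA0 : 0 ≤ A := tsum_nonneg fun n => mul_nonneg (pow_nonneg hε.1.le n) (by positivity)
  refine ⟨1 + A, by positivity, fun t ht => ?_⟩
  have hg := one_le_g hε ht
  have h1 : psi ε t ≤ t * (g ε t + A) := by
    have hnn : 0 ≤ t * (g ε t + A) := mul_nonneg ht.1.le (by linarith)
    rw [← ENNReal.ofReal_le_ofReal_iff hnn, ofReal_psi hε (Ioc_subset_Icc_self ht)]
    have hs := ((summable_g hε t).add hA).mul_left t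
    have hterm : ∀ n : ℕ, 0 ≤ t * (ε ^ n * h n t + ε ^ n * (1 + n * Real.exp 1)) := fun n => by
      have := h_nonneg n t
      have := hε.1
      have := ht.1
      positivity
    rw [g, hAdef, ← (summable_g hε t).tsum_add hA, ← tsum_mul_left,
      ENNReal.ofReal_tsum_of_nonneg hterm hs]
    refine ENNReal.tsum_le_tsum fun n => ?_
    refine (mul_le_mul_right (topIntegral_hI_le ht) _).trans (le_of_eq ?_)
    rw [← ENNReal.ofReal_mul (pow_nonneg hε.1.le n)]
    congr 1
    ring
  refine h1.trans ?_
  nlinarith [mul_nonneg (mul_nonneg hA0 ht.1.le) (sub_nonneg.2 hg)]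

end Iterates

/-! ### Marcinkiewicz spaces -/

section Weights

variable {α : Type*} [MeasurableSpace α] {μ : Measure α} [IsProbabilityMeasure μ] {f w : α → ℝ}
  {t : ℝ}

/-- No weight `0 ≤ w ≤ 1` of total mass at most `t` gives more than `∫_0^t f^*`. -/
lemma lintegral_mul_weight_le (hf : Measurable f) (hw : Measurable w) (hw0 : ∀ a, 0 ≤ w a)
    (hw1 : ∀ a, w a ≤ 1) (ht : t ∈ Ioc (0 : ℝ) 1)
    (hwt : ∫⁻ a, ENNReal.ofReal (w a) ∂μ ≤ ENNReal.ofReal t) :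
    ∫⁻ a, ENNReal.ofReal (|f a| * w a) ∂μ ≤ topIntegral μ f t := by
  have hc := rearr_nonneg μ f t
  set c := rearr μ f t with hcdef
  calc _ ≤ ∫⁻ a, (ENNReal.ofReal (|f a| - c) + ENNReal.ofReal c * ENNReal.ofReal (w a)) ∂μ := by
        refine lintegral_mono fun a => ?_
        rw [← ENNReal.ofReal_mul hc]
        rcases le_total c |f a| with h | h
        · rw [← ENNReal.ofReal_add (by linarith) (mul_nonneg hc (hw0 a))]
          refine ENNReal.ofReal_le_ofReal ?_
          nlinarith [hw1 a, hw0 a]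
        · refine le_add_left (ENNReal.ofReal_le_ofReal ?_)
          exact mul_le_mul_of_nonneg_right h (hw0 a)
    _ = stopLoss μ f c + ENNReal.ofReal c * ∫⁻ a, ENNReal.ofReal (w a) ∂μ := by
        rw [lintegral_add_left (by fun_prop), lintegral_const_mul _ (by fun_prop), stopLoss]
    _ ≤ stopLoss μ f c + ENNReal.ofReal c * ENNReal.ofReal t := by gcongr
    _ = _ := by rw [topIntegral_eq hf ht, ENNReal.ofReal_mul hc]

/-- The integral `∫_0^t f^*` is attained at a weight of total mass `t`: the indicator of
`{|f| > c}` plus a multiple of that of `{|f| = c}`, where `c = f^*(t)`. -/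
lemma exists_weight (hf : Measurable f) (ht : t ∈ Ioc (0 : ℝ) 1) :
    ∃ w : α → ℝ, Measurable w ∧ (∀ a, 0 ≤ w a) ∧ (∀ a, w a ≤ 1) ∧
      ∫⁻ a, ENNReal.ofReal (w a) ∂μ ≤ ENNReal.ofReal t ∧
      topIntegral μ f t ≤ ∫⁻ a, ENNReal.ofReal (|f a| * w a) ∂μ := by
  have hc := rearr_nonneg μ f t
  set c := rearr μ f t with hcdef
  have hm1 : MeasurableSet {a | c < |f a|} := measurableSet_lt measurable_const hf.abs
  have hm2 : MeasurableSet {a | |f a| = c} := measurableSet_eq_fun hf.abs measurable_const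
  set A := μ.real {a | c < |f a|} with hA
  set B := μ.real {a | |f a| = c} with hB
  have hA0 : 0 ≤ A := measureReal_nonneg
  have hB0 : 0 ≤ B := measureReal_nonneg
  have hAt : A ≤ t := ENNReal.toReal_le_of_le_ofReal ht.1.le (measure_rearr_lt_le hf ht.1)
  have hABt : t ≤ A + B := by
    have h1 : ENNReal.ofReal t ≤ μ {a | c ≤ |f a|} := by
      have h2 := lintegral_rearr (μ := μ) hf (Φ := (Ici c).indicator 1)
        (measurable_one.indicator measurableSet_Ici)
      have h3 : ∫⁻ a, (Ici c).indicator 1 |f a| ∂μ = μ {a | c ≤ |f a|} := by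
        rw [← lintegral_indicator_one (measurableSet_le measurable_const hf.abs)]
        rfl
      rw [← h3, ← h2]
      calc ENNReal.ofReal t = ∫⁻ s in Ioc (0 : ℝ) t, 1 := by simp
        _ ≤ ∫⁻ s in Ioc (0 : ℝ) t, (Ici c).indicator 1 (rearr μ f s) := by
          refine setLIntegral_mono' measurableSet_Ioc fun s hs => ?_
          rw [indicator_of_mem (show rearr μ f s ∈ Ici c from rearr_antitoneOn hf hs.1 ht.1 hs.2)]
          rfl
        _ ≤ _ := lintegral_mono_set (Ioc_subset_Ioc_right ht.2)
    have h2 : {a | c ≤ |f a|} = {a | c < |f a|} ∪ {a | |f a| = c} := by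
      ext a
      simp only [mem_ofPred_eq, mem_union, le_iff_lt_or_eq, eq_comm]
    have h4 : t ≤ μ.real {a | c ≤ |f a|} :=
      (ENNReal.ofReal_le_iff_le_toReal (measure_ne_top _ _)).1 h1
    rw [h2] at h4
    exact h4.trans (measureReal_union_le _ _)
  set θ := (t - A) / B with hθ
  have hθ0 : 0 ≤ θ := div_nonneg (by linarith) hB0
  have hθ1 : θ ≤ 1 := div_le_one_of_le₀ (by linarith) hB0
  have hsum : A + θ * B = t := by
    rcases eq_or_ne B 0 with h | h
    · rw [h] at hABt ⊢
      linarith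
    · rw [hθ, div_mul_cancel₀ _ h]
      ring
  classical
  set w : α → ℝ := fun a => if c < |f a| then 1 else if |f a| = c then θ else 0 with hw
  have hwm : Measurable w := Measurable.ite hm1 measurable_const
    (Measurable.ite hm2 measurable_const measurable_const)
  have hwint : ∫⁻ a, ENNReal.ofReal (w a) ∂μ = ENNReal.ofReal t := by
    have h1 : ∀ a, ENNReal.ofReal (w a) = {a | c < |f a|}.indicator 1 a +
        {a | |f a| = c}.indicator (fun _ => ENNReal.ofReal θ) a := by
      intro a
      simp only [hw, indicator, mem_ofPred_eq, Pi.one_apply]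
      split_ifs with h1 h2 h2
      · linarith
      · simp
      · simp
      · simp
    simp_rw [h1]
    rw [lintegral_add_left (measurable_one.indicator hm1), lintegral_indicator_one hm1,
      lintegral_indicator_const hm2, ← ofReal_measureReal, ← ofReal_measureReal,
      ← ENNReal.ofReal_mul hθ0, ← ENNReal.ofReal_add hA0 (mul_nonneg hθ0 hB0), hsum]
  refine ⟨w, hwm, fun a => ?_, fun a => ?_, hwint.le, ?_⟩
  · simp only [hw]; split_ifs <;> simp [hθ0]
  · simp only [hw]; split_ifs <;> simp [hθ1]
  · rw [topIntegral_eq hf ht, ENNReal.ofReal_mul hc, ← hcdef, ← hwint, stopLoss,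
      ← lintegral_const_mul _ (by fun_prop), ← lintegral_add_left (by fun_prop)]
    refine lintegral_mono fun a => ?_
    rw [← ENNReal.ofReal_mul hc]
    simp only [hw]
    split_ifs with h1 h2
    · rw [← ENNReal.ofReal_add (by linarith) (by linarith)]
      refine ENNReal.ofReal_le_ofReal (by linarith)
    · simp [h2]
    · simp [ENNReal.ofReal_of_nonpos (sub_nonpos.2 (not_lt.1 h1))]

end Weights

section Marcinkiewicz

variable {φ : ℝ → ℝ} {t : ℝ}

lemma measurable_coe (x : L0) : Measurable (x : I → ℝ) := x.measurable

lemma marcinkiewiczNorm_le_iff (hφ : ∀ t ∈ Ioc (0 : ℝ) 1, 0 < φ t) {x : L0} {C : ℝ≥0∞} :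
    marcinkiewiczNorm φ x ≤ C ↔
      ∀ t ∈ Ioc (0 : ℝ) 1, topIntegral volume x t ≤ C * ENNReal.ofReal (φ t) := by
  simp only [marcinkiewiczNorm, iSup_le_iff]
  refine forall₂_congr fun t ht => ?_
  exact ENNReal.div_le_iff (ENNReal.ofReal_pos.2 (hφ t ht)).ne' ENNReal.ofReal_ne_top

lemma topIntegral_le_marcinkiewiczNorm (hφ : ∀ t ∈ Ioc (0 : ℝ) 1, 0 < φ t) (x : L0)
    (ht : t ∈ Ioc (0 : ℝ) 1) :
    topIntegral volume x t ≤ marcinkiewiczNorm φ x * ENNReal.ofReal (φ t) :=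
  (marcinkiewiczNorm_le_iff hφ).1 le_rfl t ht

lemma marcinkiewiczNorm_mono {x y : L0} (h : ∀ᵐ t : I, |x t| ≤ |y t|) :
    marcinkiewiczNorm φ x ≤ marcinkiewiczNorm φ y :=
  iSup₂_mono fun _ _ => ENNReal.div_le_div_right (topIntegral_mono_ae (measurable_coe y) h _) _

lemma marcinkiewiczNorm_congr {x y : L0} (h : absLaw volume x = absLaw volume y) :
    marcinkiewiczNorm φ x = marcinkiewiczNorm φ y := by
  simp only [marcinkiewiczNorm]
  rw [rearr_congr (measurable_coe x) (measurable_coe y) h]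

lemma marcinkiewiczNorm_add_le (hφ : ∀ t ∈ Ioc (0 : ℝ) 1, 0 < φ t) (x y : L0) :
    marcinkiewiczNorm φ (x + y) ≤ marcinkiewiczNorm φ x + marcinkiewiczNorm φ y := by
  rw [marcinkiewiczNorm_le_iff hφ]
  intro t ht
  rw [add_mul]
  refine (topIntegral_add_le (measurable_coe _) (measurable_coe x) (measurable_coe y) ht ?_).trans
    (add_le_add (topIntegral_le_marcinkiewiczNorm hφ x ht)
      (topIntegral_le_marcinkiewiczNorm hφ y ht))
  filter_upwards [AEEqFun.coeFn_add x y] with u hu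
  rw [hu]
  exact abs_add_le _ _

lemma marcinkiewiczNorm_smul (c : ℝ) (x : L0) :
    marcinkiewiczNorm φ (c • x) = ‖c‖ₑ * marcinkiewiczNorm φ x := by
  simp only [marcinkiewiczNorm, ENNReal.mul_iSup]
  refine iSup_congr fun t => iSup_congr fun _ => ?_
  have h1 : topIntegral volume (c • x : L0) t = topIntegral volume (fun u => c * x u) t := by
    have h2 : ∀ᵐ u : I, (c • x : L0) u = c * x u := by
      filter_upwards [AEEqFun.coeFn_smul c x] with u hu
      rw [hu]; rfl
    refine le_antisymm (topIntegral_mono_ae ((measurable_coe x).const_mul c) ?_ t)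
      (topIntegral_mono_ae (measurable_coe _) ?_ t) <;>
    filter_upwards [h2] with u hu using by rw [hu]
  have h2 := topIntegral_smul (μ := volume) (measurable_coe x) c t
  rw [← mul_div_assoc, ← topIntegral, ← topIntegral, h1, h2]

lemma lintegral_le_marcinkiewiczNorm (hφ : ∀ t ∈ Ioc (0 : ℝ) 1, 0 < φ t) (x : L0) :
    ∫⁻ u : I, ‖x u‖ₑ ≤ marcinkiewiczNorm φ x * ENNReal.ofReal (φ 1) := by
  rw [← topIntegral_one (measurable_coe x)]
  exact topIntegral_le_marcinkiewiczNorm hφ x ⟨zero_lt_one, le_rfl⟩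

lemma eq_zero_of_marcinkiewiczNorm (hφ : ∀ t ∈ Ioc (0 : ℝ) 1, 0 < φ t) (x : L0)
    (hx : marcinkiewiczNorm φ x = 0) : x = 0 := by
  have h1 := lintegral_le_marcinkiewiczNorm hφ x
  rw [hx, zero_mul, nonpos_iff_eq_zero, lintegral_eq_zero_iff (measurable_coe x).enorm] at h1
  refine AEEqFun.ext ?_
  filter_upwards [h1, AEEqFun.coeFn_zero (α := I) (β := ℝ) (μ := volume)] with u hu hu0
  rw [hu0]
  simpa using hu

lemma topIntegral_le_lintegral {f : I → ℝ} (hf : Measurable f) (ht : t ≤ 1) :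
    topIntegral volume f t ≤ ∫⁻ u : I, ‖f u‖ₑ := by
  rw [← topIntegral_one hf]
  exact topIntegral_mono ht

lemma coe_sub_ae (x y : L0) : ∀ᵐ u : I, (x - y : L0) u = x u - y u := by
  filter_upwards [AEEqFun.coeFn_sub x y] with u hu
  rw [hu]; rfl

/-- A Cauchy sequence in a Marcinkiewicz space converges in `L_1`; its limit is the limit in the
space since `∫_0^t x^*` depends continuously on `x` in `L_1`. -/
lemma marcinkiewiczNorm_complete (hφ : ∀ t ∈ Ioc (0 : ℝ) 1, 0 < φ t) (u : ℕ → L0)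
    (hu : ∀ n, marcinkiewiczNorm φ (u n) < ∞)
    (hcau : ∀ ε : ℝ≥0∞, 0 < ε →
      ∃ N : ℕ, ∀ m ≥ N, ∀ n ≥ N, marcinkiewiczNorm φ (u m - u n) < ε) :
    ∃ x : L0, marcinkiewiczNorm φ x < ∞ ∧
      Tendsto (fun n => marcinkiewiczNorm φ (u n - x)) atTop (𝓝 0) := by
  have hmem : ∀ n, MemLp (u n : I → ℝ) 1 volume := fun n =>
    ⟨(u n).aestronglyMeasurable, by
      rw [eLpNorm_one_eq_lintegral_enorm]
      exact (lintegral_le_marcinkiewiczNorm hφ (u n)).trans_lt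
        (ENNReal.mul_lt_top (hu n) ENNReal.ofReal_lt_top)⟩
  have hφ1 : ENNReal.ofReal (φ 1) ≠ 0 := (ENNReal.ofReal_pos.2 (hφ 1 ⟨zero_lt_one, le_rfl⟩)).ne'
  set v : ℕ → Lp ℝ 1 (volume : Measure I) := fun n => (hmem n).toLp (u n)
  have hv : CauchySeq v := by
    rw [EMetric.cauchySeq_iff]
    intro ε hε
    obtain ⟨N, hN⟩ := hcau (ε / ENNReal.ofReal (φ 1))
      (ENNReal.div_pos hε.ne' ENNReal.ofReal_ne_top)
    refine ⟨N, fun m hm n hn => ?_⟩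
    rw [Lp.edist_toLp_toLp, eLpNorm_one_eq_lintegral_enorm]
    have h1 : ∫⁻ a, ‖((u m : I → ℝ) - u n) a‖ₑ = ∫⁻ a, ‖(u m - u n : L0) a‖ₑ := by
      refine lintegral_congr_ae ?_
      filter_upwards [coe_sub_ae (u m) (u n)] with a ha
      rw [ha, Pi.sub_apply]
    rw [h1]
    refine (lintegral_le_marcinkiewiczNorm hφ _).trans_lt ?_
    exact (ENNReal.lt_div_iff_mul_lt (Or.inl hφ1) (Or.inl ENNReal.ofReal_ne_top)).1
      (hN m hm n hn)
  obtain ⟨y, hy⟩ := cauchySeq_tendsto_of_complete hv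
  have hy1 : Tendsto (fun n => ∫⁻ a, ‖(u n - (y : L0) : L0) a‖ₑ) atTop (𝓝 0) := by
    have h1 := (tendsto_iff_edist_tendsto_0).1 hy
    refine h1.congr fun n => ?_
    rw [Lp.edist_def, eLpNorm_one_eq_lintegral_enorm]
    refine lintegral_congr_ae ?_
    filter_upwards [coe_sub_ae (u n) (y : L0), (hmem n).coeFn_toLp] with a ha hb
    rw [ha, Pi.sub_apply, hb]
  have key : ∀ ε : ℝ≥0∞, ∀ N : ℕ, (∀ m ≥ N, ∀ n ≥ N, marcinkiewiczNorm φ (u m - u n) < ε) →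
      ∀ n ≥ N, marcinkiewiczNorm φ (u n - (y : L0)) ≤ ε := by
    intro ε N hN n hn
    rw [marcinkiewiczNorm_le_iff hφ]
    intro t ht
    have h1 : Tendsto (fun m => ε * ENNReal.ofReal (φ t) + ∫⁻ a, ‖(u m - (y : L0) : L0) a‖ₑ) atTop
        (𝓝 (ε * ENNReal.ofReal (φ t) + 0)) := hy1.const_add _
    rw [add_zero] at h1
    refine ge_of_tendsto h1 (eventually_atTop.2 ⟨N, fun m hm => ?_⟩)
    refine (topIntegral_add_le (measurable_coe _) (measurable_coe (u n - u m))
      (measurable_coe (u m - (y : L0))) ht ?_).trans (add_le_add ?_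
      (topIntegral_le_lintegral (measurable_coe _) ht.2))
    · filter_upwards [coe_sub_ae (u n) (y : L0), coe_sub_ae (u n) (u m), coe_sub_ae (u m) (y : L0)]
        with a h1 h2 h3
      rw [h1, h2, h3]
      exact abs_sub_le _ _ _
    · exact (topIntegral_le_marcinkiewiczNorm hφ _ ht).trans (by gcongr; exact (hN n hn m hm).le)
  refine ⟨y, ?_, ?_⟩
  · obtain ⟨N, hN⟩ := hcau 1 one_pos
    have h1 := key 1 N hN N le_rfl
    have h2 : (y : L0) = u N + (-1 : ℝ) • (u N - (y : L0)) := by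
      rw [neg_one_smul]; abel
    rw [h2]
    refine (marcinkiewiczNorm_add_le hφ _ _).trans_lt (ENNReal.add_lt_top.2 ⟨hu N, ?_⟩)
    rw [marcinkiewiczNorm_smul]
    simpa using h1.trans_lt ENNReal.one_lt_top
  · rw [ENNReal.tendsto_atTop_zero]
    intro ε hε
    obtain ⟨N, hN⟩ := hcau ε hε
    exact ⟨N, key ε N hN⟩

/-- `x'' ≤ x` for the norms: this half of the duality is Hölder's inequality. -/
lemma kotheDual_kotheDual_le {ρ : L0 → ℝ≥0∞} (hsmul : ∀ (c : ℝ) (x : L0), ρ (c • x) = ‖c‖ₑ * ρ x)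
    (hzero : ∀ x, ρ x = 0 → x = 0) (x : L0) : kotheDual (kotheDual ρ) x ≤ ρ x := by
  refine iSup₂_le fun y hy => ?_
  rcases eq_or_ne (ρ x) 0 with h0 | h0
  · have h1 : ∫⁻ t : I, ‖x t * y t‖ₑ = ∫⁻ _ : I, 0 := by
      refine lintegral_congr_ae ?_
      filter_upwards [AEEqFun.coeFn_zero (α := I) (β := ℝ) (μ := volume)] with u hu
      rw [hzero x h0, hu]
      simp
    rw [h1]
    simp
  rcases eq_or_ne (ρ x) ∞ with h1 | h1
  · rw [h1]; exact le_top
  set c := (ρ x).toReal with hc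
  have hc0 : 0 < c := ENNReal.toReal_pos h0 h1
  have hcx : ρ x = ‖c‖ₑ := by
    rw [Real.enorm_of_nonneg hc0.le, hc, ENNReal.ofReal_toReal h1]
  have h2 : ρ (c⁻¹ • x) ≤ 1 := by
    rw [hsmul, enorm_inv hc0.ne', hcx]
    exact ENNReal.inv_mul_le_one _
  have h3 : ∫⁻ t : I, ‖y t * (c⁻¹ • x : L0) t‖ₑ ≤ 1 :=
    (le_iSup₂ (f := fun (z : L0) (_ : ρ z ≤ 1) => ∫⁻ t : I, ‖y t * z t‖ₑ) (c⁻¹ • x) h2).trans hy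
  have h4 : ∫⁻ t : I, ‖x t * y t‖ₑ = ‖c‖ₑ * ∫⁻ t : I, ‖y t * (c⁻¹ • x : L0) t‖ₑ := by
    rw [← lintegral_const_mul' _ _ enorm_ne_top]
    refine lintegral_congr_ae ?_
    filter_upwards [AEEqFun.coeFn_smul c⁻¹ x] with u hu
    rw [hu, ← enorm_mul, Pi.smul_apply, smul_eq_mul]
    congr 1
    field_simp
  rw [h4, hcx]
  exact mul_le_of_le_one_right' h3

/-- `M_φ` coincides with its second Köthe dual: the weights attaining `∫_0^t x^*` belong, after
division by `φ(t)`, to the unit ball of the dual. -/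
lemma marcinkiewiczNorm_le_kotheDual (hφ : ∀ t ∈ Ioc (0 : ℝ) 1, 0 < φ t) (x : L0) :
    marcinkiewiczNorm φ x ≤ kotheDual (kotheDual (marcinkiewiczNorm φ)) x := by
  refine iSup₂_le fun t ht => ?_
  have hφt := hφ t ht
  obtain ⟨w, hwm, hw0, hw1, hwt, hw⟩ := exists_weight (μ := volume) (measurable_coe x) ht
  set y : L0 := AEEqFun.mk (fun u => w u / φ t) (hwm.div_const _).aestronglyMeasurable with hydef
  have hy : ∀ᵐ u : I, y u = w u / φ t := AEEqFun.coeFn_mk _ _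
  have hz : ∀ z : L0, ∫⁻ u : I, ‖z u * y u‖ₑ =
      (∫⁻ u : I, ENNReal.ofReal (|z u| * w u)) / ENNReal.ofReal (φ t) := by
    intro z
    have hzm := measurable_coe z
    rw [div_eq_mul_inv, ← lintegral_mul_const _ (by fun_prop)]
    refine lintegral_congr_ae ?_
    filter_upwards [hy] with u hu
    rw [hu, ← div_eq_mul_inv, ← ENNReal.ofReal_div_of_pos hφt, Real.enorm_eq_ofReal_abs, abs_mul,
      abs_of_nonneg (div_nonneg (hw0 u) hφt.le), mul_div_assoc]
  have hy1 : kotheDual (marcinkiewiczNorm φ) y ≤ 1 := by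
    refine iSup₂_le fun z hz1 => ?_
    simp_rw [mul_comm (y _)]
    rw [hz z]
    refine le_trans (ENNReal.div_le_div_right
      (lintegral_mul_weight_le (measurable_coe z) hwm hw0 hw1 ht hwt) _) (le_trans ?_ hz1)
    exact le_iSup₂ (f := fun (t : ℝ) (_ : t ∈ Ioc (0 : ℝ) 1) =>
      topIntegral volume z t / ENNReal.ofReal (φ t)) t ht
  calc _ ≤ (∫⁻ u : I, ENNReal.ofReal (|x u| * w u)) / ENNReal.ofReal (φ t) :=
        ENNReal.div_le_div_right hw _
    _ = ∫⁻ u : I, ‖x u * y u‖ₑ := (hz x).symm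
    _ ≤ _ := le_iSup₂ (f := fun (y : L0) (_ : kotheDual (marcinkiewiczNorm φ) y ≤ 1) =>
        ∫⁻ u : I, ‖x u * y u‖ₑ) y hy1

lemma marcinkiewiczNorm_one_lt_top (hφ : ∀ t ∈ Ioc (0 : ℝ) 1, 0 < φ t)
    (hlin : ∀ t ∈ Ioc (0 : ℝ) 1, t ≤ φ t) : marcinkiewiczNorm φ 1 < ∞ := by
  refine lt_of_le_of_lt ((marcinkiewiczNorm_le_iff hφ (C := 1)).2 fun t ht => ?_)
    ENNReal.one_lt_top
  refine (topIntegral_le (c := 1) (measurable_coe _) zero_le_one ht.2).trans ?_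
  have h1 : stopLoss volume (1 : L0) 1 = ∫⁻ _ : I, 0 := by
    refine lintegral_congr_ae ?_
    filter_upwards [AEEqFun.coeFn_one (α := I) (β := ℝ) (μ := volume)] with u hu
    rw [hu]
    simp
  rw [h1]
  simpa using ENNReal.ofReal_le_ofReal (hlin t ht)

/-- The Marcinkiewicz space `M_φ` as an r.i. space. -/
noncomputable def marcinkiewiczSpace (φ : ℝ → ℝ) (hφ : ∀ t ∈ Ioc (0 : ℝ) 1, 0 < φ t)
    (hlin : ∀ t ∈ Ioc (0 : ℝ) 1, t ≤ φ t) : RISpace where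
  norm := marcinkiewiczNorm φ
  norm_add_le := marcinkiewiczNorm_add_le hφ
  norm_smul := marcinkiewiczNorm_smul
  eq_zero_of_norm := eq_zero_of_marcinkiewiczNorm hφ
  complete := marcinkiewiczNorm_complete hφ
  ideal _ _ := marcinkiewiczNorm_mono
  symmetric x y h := marcinkiewiczNorm_congr
    ((equimeasurable_iff (measurable_coe x) (measurable_coe y)).1 h)
  nontrivial := by
    refine ⟨1, fun h => ?_, marcinkiewiczNorm_one_lt_top hφ hlin⟩
    have h1 := AEEqFun.coeFn_one (α := I) (β := ℝ) (μ := volume)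
    have h2 := AEEqFun.coeFn_zero (α := I) (β := ℝ) (μ := volume)
    rw [h] at h1
    obtain ⟨u, hu⟩ := (h1.symm.trans h2).exists
    simp at hu
  separable_or_maximal := Or.inr fun x => le_antisymm (marcinkiewiczNorm_le_kotheDual hφ x)
    (kotheDual_kotheDual_le marcinkiewiczNorm_smul (eq_zero_of_marcinkiewiczNorm hφ) x)

end Marcinkiewicz

/-! ### The Kruglov property of `M_{ψ_ε}` -/

section KruglovProperty

variable {ε δ t : ℝ}

/-- The restriction of `g_ε` to `[0,1]`. -/
noncomputable def gI (ε : ℝ) (u : I) : ℝ := g ε u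

lemma measurable_gI (hε : ε ∈ Ioo (0 : ℝ) 1) : Measurable (gI ε) :=
  (measurable_g hε).comp measurable_subtype_coe

lemma gI_nonneg (hε : ε ∈ Ioo (0 : ℝ) 1) (u : I) : 0 ≤ gI ε u := g_nonneg hε.1.le _

/-- An element of `M_{ψ_ε}` has a rearrangement dominated by a multiple of `g_ε`. -/
lemma exists_rearr_le_mul_g (hε : ε ∈ Ioo (0 : ℝ) 1) {x : L0}
    (hx : marcinkiewiczNorm (psi ε) x < ∞) :
    ∃ C : ℝ, 0 < C ∧ ∀ u : I, rearr volume x u ≤ C * g ε u := by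
  obtain ⟨C, hC, hpsi⟩ := psi_le_mul_g hε
  set N := (marcinkiewiczNorm (psi ε) x).toReal with hN
  have hN0 : 0 ≤ N := ENNReal.toReal_nonneg
  refine ⟨(N + 1) * C, by positivity, fun u => ?_⟩
  have hg := g_nonneg hε.1.le (u : ℝ)
  rcases eq_or_lt_of_le u.2.1 with h0 | h0
  · rw [rearr_of_nonpos h0.symm.le]
    positivity
  have hu : (u : ℝ) ∈ Ioc (0 : ℝ) 1 := ⟨h0, u.2.2⟩
  have h1 := (mul_rearr_le_topIntegral (μ := volume) (measurable_coe x) h0).trans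
    (topIntegral_le_marcinkiewiczNorm (fun t ht => psi_pos hε ht) x hu)
  have hp := psi_nonneg hε.1.le h0.le
  rw [← ENNReal.ofReal_toReal hx.ne, ← hN, ← ENNReal.ofReal_mul hN0,
    ENNReal.ofReal_le_ofReal_iff (mul_nonneg hN0 hp)] at h1
  have h2 : N * psi ε u ≤ (N + 1) * (C * (u * g ε u)) :=
    (mul_le_mul_of_nonneg_left (hpsi u hu) hN0).trans
      (mul_le_mul_of_nonneg_right (by linarith) (mul_nonneg hC.le (mul_nonneg h0.le hg)))
  refine le_of_mul_le_mul_left ?_ h0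
  linarith

lemma absLaw_abs {α : Type*} [MeasurableSpace α] (μ : Measure α) (f : α → ℝ) :
    absLaw μ (fun a => |f a|) = absLaw μ f := by
  simp only [absLaw, abs_abs]

lemma abs_kruglov_le (f : I → ℝ) (ω : Ω) : |kruglov f ω| ≤ kruglov (fun u => |f u|) ω :=
  Finset.abs_sum_le_sum_abs _ _

lemma kruglov_mono {f f' : I → ℝ} (h : ∀ u, f u ≤ f' u) (ω : Ω) : kruglov f ω ≤ kruglov f' ω :=
  Finset.sum_le_sum fun _ _ => h _

lemma kruglov_const_mul (c : ℝ) (f : I → ℝ) (ω : Ω) :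
    kruglov (fun u => c * f u) ω = c * kruglov f ω :=
  (Finset.mul_sum _ _ _).symm

/-- `π(f)` is dominated in distribution by `π(f')` when `f^* ≤ f'` on `[0,1]`. -/
lemma topIntegral_kruglov_le {f f' : I → ℝ} (hf : Measurable f) (hf' : Measurable f')
    (h : ∀ u : I, rearr volume f u ≤ f' u) (t : ℝ) :
    topIntegral P (kruglov f) t ≤ topIntegral P (kruglov f') t := by
  set r : I → ℝ := fun u => rearr volume f u
  have hr : Measurable r := (measurable_rearr hf).comp measurable_subtype_coe
  have hr0 : ∀ u, 0 ≤ r u := fun u => rearr_nonneg _ _ _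
  have hlaw : absLaw volume (fun u => |f u|) = absLaw volume r := by
    rw [absLaw_abs]
    exact (absLaw_rearr_unitInterval hf).symm
  have h1 := absLaw_kruglov_congr hf.abs hr (fun u => abs_nonneg _) hr0 hlaw
  calc _ ≤ topIntegral P (kruglov fun u => |f u|) t := by
        refine topIntegral_mono_ae (measurable_kruglov hf.abs) (ae_of_all _ fun ω => ?_) t
        exact (abs_kruglov_le f ω).trans (le_abs_self _)
    _ = topIntegral P (kruglov r) t := by
        rw [topIntegral_congr (measurable_kruglov hf.abs) (measurable_kruglov hr) h1]
    _ ≤ _ := by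
        refine topIntegral_mono_ae (measurable_kruglov hf') (ae_of_all _ fun ω => ?_) t
        exact abs_le_abs_of_nonneg (kruglov_nonneg hr0 ω) (kruglov_mono h ω)

lemma kruglov_gI (hε : ε ∈ Ioo (0 : ℝ) 1) (ω : Ω) :
    kruglov (gI ε) ω = ∑' n, ε ^ n * kruglov (hI n) ω := by
  simp only [kruglov, gI, g, Finset.mul_sum]
  exact (Summable.tsum_finsetSum fun i _ => summable_g hε _).symm

lemma summable_kruglov (hε : ε ∈ Ioo (0 : ℝ) 1) (ω : Ω) :
    Summable fun n => ε ^ n * kruglov (hI n) ω := by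
  simp only [kruglov, Finset.mul_sum]
  exact summable_sum fun i _ => summable_g hε _

lemma topIntegral_kruglov_hI (n : ℕ) (t : ℝ) :
    topIntegral P (kruglov (hI n)) t = topIntegral volume (hI (n + 1)) t := by
  rw [topIntegral_congr (measurable_hI _) (measurable_kruglov (measurable_hI n))
    (absLaw_hI_succ n)]

/-- `π` shifts the series `g_ε` by one term, and so multiplies it by at most `ε⁻¹`. -/
lemma topIntegral_kruglov_gI_le (hε : ε ∈ Ioo (0 : ℝ) 1) (ht : t ∈ Ioc (0 : ℝ) 1) :
    topIntegral P (kruglov (gI ε)) t ≤ ENNReal.ofReal ε⁻¹ * ENNReal.ofReal (psi ε t) := by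
  have hpow : ∀ n : ℕ, 0 ≤ ε ^ n := fun n => pow_nonneg hε.1.le n
  have hk : ∀ n, Measurable (kruglov (hI n)) := fun n => measurable_kruglov (measurable_hI n)
  have h1 : topIntegral P (kruglov (gI ε)) t ≤
      ∑' n, topIntegral P (fun ω => ε ^ n * kruglov (hI n) ω) t := by
    refine topIntegral_tsum_le (measurable_kruglov (measurable_gI hε))
      (fun n => (hk n).const_mul _) ht ?_ (ae_of_all _ fun ω => ?_)
    · have h2 : ∀ n : ℕ, rearr P (fun ω => ε ^ n * kruglov (hI n) ω) t = ε ^ n * h (n + 1) t := by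
        intro n
        rw [rearr_smul (hk n) _ _ ht.1, abs_of_nonneg (hpow n), h_succ]
      simp_rw [h2]
      have h3 := ((summable_nat_add_iff 1).2 (summable_g hε t)).mul_left ε⁻¹
      refine h3.congr fun n => ?_
      have := hε.1
      field_simp
      ring
    · have h2 : ∀ n, 0 ≤ ε ^ n * kruglov (hI n) ω := fun n =>
        mul_nonneg (hpow n) (kruglov_nonneg (hI_nonneg n) ω)
      simp_rw [fun n => abs_of_nonneg (h2 n)]
      rw [abs_of_nonneg (kruglov_nonneg (gI_nonneg hε) ω), kruglov_gI hε,
        ENNReal.ofReal_tsum_of_nonneg h2 (summable_kruglov hε ω)]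
  refine h1.trans ?_
  rw [ofReal_psi hε (Ioc_subset_Icc_self ht), ← ENNReal.tsum_mul_left]
  calc _ = ∑' n : ℕ, (fun k => ENNReal.ofReal ε⁻¹ *
        (ENNReal.ofReal (ε ^ k) * topIntegral volume (hI k) t)) (n + 1) := by
        refine tsum_congr fun n => ?_
        simp only
        rw [topIntegral_smul (hk n), topIntegral_kruglov_hI, ← mul_assoc,
          ← ENNReal.ofReal_mul (inv_nonneg.2 hε.1.le), Real.enorm_of_nonneg (hpow n)]
        congr 2
        have := hε.1
        field_simp
        ring
    _ ≤ _ := ENNReal.tsum_comp_le_tsum_of_injective (add_left_injective 1) _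

/-- A realization of `π(f)` on `[0,1]`. -/
noncomputable def realize (f : I → ℝ) (hf : Measurable f) : L0 :=
  AEEqFun.mk (fun u : I => rearr P (kruglov f) u)
    ((measurable_rearr (measurable_kruglov hf)).comp measurable_subtype_coe).aestronglyMeasurable

lemma absLaw_congr_ae {α : Type*} [MeasurableSpace α] {μ : Measure α} {f₁ f₂ : α → ℝ}
    (h : ∀ᵐ a ∂μ, f₁ a = f₂ a) : absLaw μ f₁ = absLaw μ f₂ := by
  refine Measure.map_congr ?_
  filter_upwards [h] with a ha
  rw [ha]

lemma absLaw_realize (f : I → ℝ) (hf : Measurable f) :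
    absLaw volume (realize f hf) = absLaw P (kruglov f) := by
  rw [← absLaw_rearr_unitInterval (measurable_kruglov hf)]
  exact absLaw_congr_ae (AEEqFun.coeFn_mk _ _)

theorem hasKruglovProperty_marcinkiewicz {E : RISpace} (hε : ε ∈ Ioo (0 : ℝ) 1)
    (hE : E.norm = marcinkiewiczNorm (psi ε)) : E.HasKruglovProperty := by
  have hpos : ∀ t ∈ Ioc (0 : ℝ) 1, 0 < psi ε t := fun t ht => psi_pos hε ht
  intro f
  have hfm := measurable_coe f
  rw [hE]
  constructor
  · intro hf
    obtain ⟨C, hC, hle⟩ := exists_rearr_le_mul_g hε hf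
    refine ⟨realize f hfm, ?_, (equimeasurable_iff (measurable_coe _)
      (measurable_kruglov hfm)).2 (absLaw_realize _ _)⟩
    refine lt_of_le_of_lt ((marcinkiewiczNorm_le_iff hpos
      (C := ENNReal.ofReal C * ENNReal.ofReal ε⁻¹)).2 fun t ht => ?_)
      (ENNReal.mul_lt_top ENNReal.ofReal_lt_top ENNReal.ofReal_lt_top)
    rw [topIntegral_congr (measurable_coe _) (measurable_kruglov hfm) (absLaw_realize _ _)]
    refine (topIntegral_kruglov_le hfm ((measurable_gI hε).const_mul C) hle t).trans ?_
    have h1 : kruglov (fun u => C * gI ε u) = fun ω => C * kruglov (gI ε) ω :=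
      funext fun ω => kruglov_const_mul C _ ω
    rw [h1, topIntegral_smul (measurable_kruglov (measurable_gI hε)), mul_assoc,
      Real.enorm_of_nonneg hC.le]
    gcongr
    exact topIntegral_kruglov_gI_le hε ht
  · rintro ⟨x, hx, hxf⟩
    rw [equimeasurable_iff (measurable_coe x) (measurable_kruglov hfm)] at hxf
    refine lt_of_le_of_lt ((marcinkiewiczNorm_le_iff hpos
      (C := ENNReal.ofReal (Real.exp 1) * marcinkiewiczNorm (psi ε) x)).2 fun t ht => ?_)
      (ENNReal.mul_lt_top ENNReal.ofReal_lt_top hx)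
    refine (topIntegral_le_of_stopLoss hfm (measurable_kruglov hfm)
      (Real.one_le_exp zero_le_one) (fun c _ => stopLoss_le_kruglov hfm c) ht).trans ?_
    rw [← topIntegral_congr (measurable_coe x) (measurable_kruglov hfm) hxf, mul_assoc]
    gcongr
    exact topIntegral_le_marcinkiewiczNorm hpos x ht

lemma le_psi (hε : ε ∈ Ioo (0 : ℝ) 1) (ht : t ∈ Ioc (0 : ℝ) 1) : t ≤ psi ε t := by
  have := mul_le_psi_sub hε (m := 1) le_rfl ht.1.le ht.2 fun s hs =>
    one_le_g hε ⟨hs.1, hs.2.trans ht.2⟩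
  rw [psi_zero] at this
  linarith

lemma psi_mono_param (hε : 0 < ε) (hεδ : ε ≤ δ) (hδ : δ < 1) (ht : t ∈ Icc (0 : ℝ) 1) :
    psi ε t ≤ psi δ t := by
  have hε' : ε ∈ Ioo (0 : ℝ) 1 := ⟨hε, hεδ.trans_lt hδ⟩
  have hδ' : δ ∈ Ioo (0 : ℝ) 1 := ⟨hε.trans_le hεδ, hδ⟩
  rw [← ENNReal.ofReal_le_ofReal_iff (psi_nonneg hδ'.1.le ht.1), ofReal_psi hε' ht,
    ofReal_psi hδ' ht]
  exact ENNReal.tsum_le_tsum fun n => by gcongr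

lemma space_marcinkiewicz_mono (hε : 0 < ε) (hεδ : ε ≤ δ) (hδ : δ < 1) :
    space (marcinkiewiczNorm (psi ε)) ⊆ space (marcinkiewiczNorm (psi δ)) := by
  intro x hx
  have hx : marcinkiewiczNorm (psi ε) x < ∞ := hx
  refine lt_of_le_of_lt (iSup₂_mono fun t ht => ?_) hx
  exact ENNReal.div_le_div_left
    (ENNReal.ofReal_le_ofReal (psi_mono_param hε hεδ hδ (Ioc_subset_Icc_self ht))) _

end KruglovProperty

/-! ### Minimality among the spaces with the Kruglov property -/

section Minimality

variable {ε : ℝ} {F F' : I → ℝ}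

/-- The class of a measurable function. -/
noncomputable def toL0 (F : I → ℝ) (hF : Measurable F) : L0 :=
  AEEqFun.mk F hF.aestronglyMeasurable

lemma coe_toL0 (hF : Measurable F) : ∀ᵐ u : I, toL0 F hF u = F u := AEEqFun.coeFn_mk _ _

lemma absLaw_toL0 (hF : Measurable F) : absLaw volume (toL0 F hF) = absLaw volume F :=
  absLaw_congr_ae (coe_toL0 hF)

namespace RISpace

variable (E : RISpace)

lemma norm_congr {x y : L0} (h : absLaw volume x = absLaw volume y) : E.norm x = E.norm y :=
  E.symmetric x y ((equimeasurable_iff (measurable_coe x) (measurable_coe y)).2 h)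

lemma norm_toL0_mono (hF : Measurable F) (hF' : Measurable F') (h : ∀ᵐ u, |F u| ≤ |F' u|) :
    E.norm (toL0 F hF) ≤ E.norm (toL0 F' hF') := by
  refine E.ideal _ _ ?_
  filter_upwards [h, coe_toL0 hF, coe_toL0 hF'] with u h1 h2 h3
  rwa [h2, h3]

lemma norm_rearr (x : L0) : E.norm (toL0 (fun u : I => rearr volume x u)
    ((measurable_rearr (measurable_coe x)).comp measurable_subtype_coe)) = E.norm x := by
  refine E.norm_congr ?_
  rw [absLaw_toL0, absLaw_rearr_unitInterval (measurable_coe x)]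

lemma norm_le_of_measure_le {x y : L0}
    (h : ∀ τ, 0 ≤ τ → volume {u | τ < |x u|} ≤ volume {u | τ < |y u|}) : E.norm x ≤ E.norm y := by
  rw [← E.norm_rearr x, ← E.norm_rearr y]
  refine E.norm_toL0_mono _ _ (ae_of_all _ fun u => ?_)
  refine abs_le_abs_of_nonneg (rearr_nonneg _ _ _) ?_
  rcases eq_or_lt_of_le u.2.1 with h0 | h0
  · rw [rearr_of_nonpos h0.symm.le, rearr_of_nonpos h0.symm.le]
  · exact rearr_le_rearr (measurable_coe y) h0 h

lemma norm_zero : E.norm 0 = 0 := by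
  have := E.norm_smul 0 0
  simpa using this

lemma norm_toL0_const_mul (hF : Measurable F) (c : ℝ) :
    E.norm (toL0 (fun u => c * F u) (hF.const_mul c)) = ‖c‖ₑ * E.norm (toL0 F hF) := by
  rw [← E.norm_smul]
  rfl

lemma norm_sub_comm (x y : L0) : E.norm (x - y) = E.norm (y - x) := by
  have := E.norm_smul (-1) (x - y)
  simpa using this.symm

lemma norm_toL0_sum_le {f : ℕ → I → ℝ} (hf : ∀ n, Measurable (f n)) (s : Finset ℕ) :
    E.norm (toL0 (fun u => ∑ k ∈ s, f k u) (Finset.measurable_sum s fun k _ => hf k)) ≤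
      ∑ k ∈ s, E.norm (toL0 (f k) (hf k)) := by
  classical
  induction s using Finset.induction_on with
  | empty =>
    simp only [Finset.sum_empty]
    exact E.norm_zero.le
  | insert a s ha ih =>
    rw [Finset.sum_insert ha]
    refine le_trans (le_of_eq ?_) ((E.norm_add_le (toL0 (f a) (hf a))
      (toL0 (fun u => ∑ k ∈ s, f k u)
      (Finset.measurable_sum s fun k _ => hf k))).trans (by gcongr))
    congr 1
    simp only [Finset.sum_insert ha]
    rfl

/-- A series of non-negative functions with summable norms has a majorant in the space. -/
lemma exists_majorant {f : ℕ → I → ℝ} (hf : ∀ n, Measurable (f n)) (hf0 : ∀ n u, 0 ≤ f n u)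
    (hsum : ∑' n, E.norm (toL0 (f n) (hf n)) ≠ ∞) :
    ∃ (X : I → ℝ) (hX : Measurable X), (∀ u, 0 ≤ X u) ∧ E.norm (toL0 X hX) < ∞ ∧
      ∀ n, ∀ᵐ u, ∑ k ∈ Finset.range n, f k u ≤ X u := by
  set S : ℕ → I → ℝ := fun n u => ∑ k ∈ Finset.range n, f k u with hS
  have hSm : ∀ n, Measurable (S n) := fun n => Finset.measurable_sum _ fun k _ => hf k
  have hSmono : ∀ {m n}, m ≤ n → ∀ u, S m u ≤ S n u := fun {m n} hmn u =>
    Finset.sum_le_sum_of_subset_of_nonneg (Finset.range_mono hmn) fun k _ _ => hf0 k u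
  set s : ℕ → L0 := fun n => toL0 (S n) (hSm n) with hs
  set T : ℕ → ℝ≥0∞ := fun N => ∑' k, E.norm (toL0 (f (k + N)) (hf (k + N))) with hT
  have hT0 : Tendsto T atTop (𝓝 0) := ENNReal.tendsto_sum_nat_add _ hsum
  have htail : ∀ N m, N ≤ m → E.norm (s m - s N) ≤ T N := by
    intro N m hNm
    obtain ⟨j, rfl⟩ := Nat.exists_eq_add_of_le hNm
    have h1 : s (N + j) - s N = toL0 (fun u => ∑ k ∈ Finset.range j, f (k + N) u)
        (Finset.measurable_sum _ fun k _ => hf (k + N)) := by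
      have h2 : (fun u => ∑ k ∈ Finset.range j, f (k + N) u) = fun u => S (N + j) u - S N u := by
        funext u
        simp only [hS]
        rw [Finset.sum_range_add, add_sub_cancel_left]
        simp only [add_comm]
      simp only [h2]
      rfl
    rw [h1]
    exact (E.norm_toL0_sum_le (fun k => hf (k + N)) _).trans (ENNReal.sum_le_tsum _)
  obtain ⟨x, hx, hlim⟩ := E.complete s
    (fun n => (E.norm_toL0_sum_le hf _).trans_lt ((ENNReal.sum_le_tsum _).trans_lt hsum.lt_top)) (by
      intro ε hε
      obtain ⟨N, hN⟩ := (hT0.eventually (gt_mem_nhds (ENNReal.half_pos hε.ne'))).exists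
      refine ⟨N, fun m hm n hn => ?_⟩
      have h1 : s m - s n = (s m - s N) + (s N - s n) := by abel
      rw [h1]
      refine (E.norm_add_le _ _).trans_lt ?_
      rw [E.norm_sub_comm (s N)]
      calc _ < ε / 2 + ε / 2 := ENNReal.add_lt_add ((htail N m hm).trans_lt hN)
            ((htail N n hn).trans_lt hN)
        _ = ε := ENNReal.add_halves ε)
  have hxm := measurable_coe x
  refine ⟨fun u => |x u|, hxm.abs, fun u => abs_nonneg _, ?_, fun n => ?_⟩
  · refine lt_of_le_of_lt (E.ideal _ _ ?_) hx
    filter_upwards [coe_toL0 hxm.abs] with u hu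
    rw [hu, abs_abs]
  -- The positive part of `S n - x` is dominated by `S m - x` for all `m ≥ n`, so it vanishes.
  set Z : I → ℝ := fun u => max (S n u - x u) 0 with hZ
  have hZm : Measurable Z := ((hSm n).sub hxm).max measurable_const
  have hz : E.norm (toL0 Z hZm) = 0 := by
    refine le_antisymm (ge_of_tendsto hlim (eventually_atTop.2 ⟨n, fun m hm => ?_⟩)) zero_le
    refine E.ideal _ _ ?_
    filter_upwards [coe_toL0 hZm, coe_sub_ae (s m) x, coe_toL0 (hSm m)] with u h1 h2 h3
    rw [h1, h2, h3, abs_of_nonneg (le_max_right _ _)]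
    refine max_le ?_ (abs_nonneg _)
    exact le_trans (by linarith [hSmono hm u]) (le_abs_self _)
  have hz0 := E.eq_zero_of_norm _ hz
  filter_upwards [coe_toL0 hZm, AEEqFun.coeFn_zero (α := I) (β := ℝ) (μ := volume)] with u h1 h2
  rw [hz0, h2] at h1
  have h3 : S n u - x u ≤ Z u := le_max_left _ _
  rw [← h1] at h3
  simp only [Pi.zero_apply] at h3
  exact le_trans (by linarith) (le_abs_self _)

/-- Every r.i. space contains the constants: `[0,1]` is a finite union of sets whose indicators
are dominated in distribution by a multiple of a given non-zero element. -/
lemma norm_const_lt_top : E.norm (toL0 (fun _ => 1) measurable_const) < ∞ := by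
  obtain ⟨x, hx0, hx⟩ := E.nontrivial
  have hxm := measurable_coe x
  -- a level set of positive measure, larger than the pieces `A k` of measure `1 / n` below
  obtain ⟨δ, hδ, hd⟩ : ∃ δ : ℝ, 0 < δ ∧ 0 < volume {u : I | δ < |x u|} := by
    by_contra! hcon
    refine hx0 (AEEqFun.ext ?_)
    have h1 : volume {u : I | 0 < |x u|} = 0 := by
      rw [measure_abs_pos_eq_iSup]
      refine le_antisymm (iSup_le fun n => hcon _ Nat.one_div_pos_of_nat) zero_le
    have h2 : ∀ᵐ u : I, ¬ 0 < |x u| := by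
      rw [ae_iff]
      simpa using h1
    filter_upwards [h2, AEEqFun.coeFn_zero (α := I) (β := ℝ) (μ := volume)] with u hu hu0
    rw [hu0]
    simpa using hu
  obtain ⟨n, hn⟩ := ENNReal.exists_inv_nat_lt hd.ne'
  have hn0 : n ≠ 0 := by
    rintro rfl
    simp at hn
  have hnpos : (0 : ℝ) < n := by positivity
  set A : ℕ → Set I := fun k => Subtype.val ⁻¹' Ico ((k : ℝ) / n) ((k + 1) / n) with hA
  have hAm : ∀ k, MeasurableSet (A k) := fun k => measurable_subtype_coe measurableSet_Ico
  have hAv : ∀ k, volume (A k) ≤ (n : ℝ≥0∞)⁻¹ := by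
    intro k
    rw [hA, unitInterval.measurePreserving_coe.measure_preimage measurableSet_Ico.nullMeasurableSet]
    refine (Measure.restrict_apply_le _ _).trans (le_of_eq ?_)
    rw [Real.volume_Ico, ← sub_div, add_sub_cancel_left, one_div, ENNReal.ofReal_inv_of_pos hnpos,
      ENNReal.ofReal_natCast]
  have hfm : ∀ k, Measurable ((A k).indicator (fun _ => (1 : ℝ))) := fun k =>
    measurable_const.indicator (hAm k)
  have hk : ∀ k, E.norm (toL0 _ (hfm k)) < ∞ := by
    intro k
    have h1 : E.norm (toL0 _ ((hfm k).const_mul δ)) ≤ E.norm x := by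
      refine E.norm_le_of_measure_le fun τ hτ => ?_
      rw [← absLaw_Ioi (measurable_coe _), absLaw_toL0, absLaw_Ioi ((hfm k).const_mul δ)]
      rcases lt_or_ge τ δ with hτδ | hτδ
      · calc _ ≤ volume (A k) := by
              refine measure_mono fun u hu => ?_
              by_contra huA
              simp only [mem_ofPred_eq, indicator_of_notMem huA, mul_zero, abs_zero] at hu
              exact absurd hu (not_lt.2 hτ)
          _ ≤ volume {u : I | δ < |x u|} := (hAv k).trans hn.le
          _ ≤ _ := measure_mono fun u (hu : δ < |x u|) => hτδ.trans hu
      · refine le_trans (le_of_eq ?_) zero_le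
        convert measure_empty (μ := (volume : Measure I))
        ext u
        simp only [mem_ofPred_eq, mem_empty_iff_false, iff_false, not_lt]
        refine le_trans ?_ hτδ
        rw [abs_mul, abs_of_pos hδ]
        refine mul_le_of_le_one_right hδ.le ?_
        by_cases hu : u ∈ A k <;> simp [hu]
    rw [E.norm_toL0_const_mul (hfm k)] at h1
    by_contra! htop
    rw [top_le_iff.1 htop, ENNReal.mul_top (by simpa using hδ.ne')] at h1
    exact absurd (h1.trans_lt hx) (lt_irrefl _)
  refine lt_of_le_of_lt (E.norm_toL0_mono (F' := fun u => ∑ k ∈ Finset.range (n + 1),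
    (A k).indicator (fun _ => (1 : ℝ)) u) _ (Finset.measurable_sum _ fun k _ => hfm k)
    (ae_of_all _ fun u => ?_)) ((E.norm_toL0_sum_le hfm _).trans_lt
      (ENNReal.sum_lt_top.2 fun k _ => hk k))
  have hnu : 0 ≤ (n : ℝ) * u := mul_nonneg hnpos.le u.2.1
  have hmem : u ∈ A ⌊(n : ℝ) * u⌋₊ := by
    refine ⟨?_, ?_⟩
    · rw [div_le_iff₀ hnpos]
      linarith [Nat.floor_le hnu]
    · rw [lt_div_iff₀ hnpos, mul_comm]
      exact Nat.lt_floor_add_one _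
  have hle : ⌊(n : ℝ) * u⌋₊ ∈ Finset.range (n + 1) := by
    rw [Finset.mem_range, Nat.lt_succ_iff]
    refine Nat.floor_le_of_le ?_
    exact mul_le_of_le_one_right hnpos.le u.2.2
  have h1 := Finset.single_le_sum (f := fun k => (A k).indicator (fun _ => (1 : ℝ)) u)
    (fun k _ => indicator_nonneg (fun _ _ => zero_le_one) u) hle
  simp only [indicator_of_mem hmem] at h1
  rw [abs_one]
  exact h1.trans (le_abs_self _)

lemma norm_realize_lt_top {E : RISpace} (hK : E.HasKruglovProperty) (hF : Measurable F)
    (h : E.norm (toL0 F hF) < ∞) : E.norm (realize F hF) < ∞ := by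
  obtain ⟨y, hy, hyF⟩ := (hK (toL0 F hF)).1 h
  have hm := measurable_coe (toL0 F hF)
  rw [equimeasurable_iff (measurable_coe y) (measurable_kruglov hm),
    absLaw_kruglov_congr_of_map hm hF (Measure.map_congr (coe_toL0 hF)), ← absLaw_realize F hF]
    at hyF
  rw [← E.norm_congr hyF]
  exact hy

lemma norm_realize_mono (hF : Measurable F) (hF' : Measurable F') (h0 : ∀ u, 0 ≤ F u)
    (h0' : ∀ u, 0 ≤ F' u) (h : ∀ᵐ u, F u ≤ F' u) :
    E.norm (realize F hF) ≤ E.norm (realize F' hF') := by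
  -- `min F F'` agrees with `F` almost everywhere and lies below `F'` everywhere
  have hm : Measurable fun u => min (F u) (F' u) := hF.min hF'
  have h1 : absLaw P (kruglov F) = absLaw P (kruglov fun u => min (F u) (F' u)) := by
    refine absLaw_kruglov_congr_of_map hF hm (Measure.map_congr ?_)
    filter_upwards [h] with u hu
    rw [min_eq_left hu]
  have h2 : E.norm (realize F hF) = E.norm (realize _ hm) := by
    refine E.norm_congr ?_
    rw [absLaw_realize, absLaw_realize, h1]
  rw [h2]
  refine E.norm_le_of_measure_le fun τ _ => ?_
  rw [← absLaw_Ioi (measurable_coe _), ← absLaw_Ioi (measurable_coe _), absLaw_realize,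
    absLaw_realize, absLaw_Ioi (measurable_kruglov hm), absLaw_Ioi (measurable_kruglov hF')]
  refine measure_mono fun ω (hω : τ < _) => hω.trans_le ?_
  exact abs_le_abs_of_nonneg (kruglov_nonneg (fun u => le_min (h0 u) (h0' u)) ω)
    (kruglov_mono (fun u => min_le_right _ _) ω)

lemma norm_realize_const_mul (hF : Measurable F) (c : ℝ) :
    E.norm (realize (fun u => c * F u) (hF.const_mul c)) = ‖c‖ₑ * E.norm (realize F hF) := by
  rw [← E.norm_smul]
  refine E.norm_congr ?_
  rw [absLaw_realize]
  have h1 : absLaw volume (c • realize F hF : L0) =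
      absLaw volume (fun u => c * realize F hF u) := by
    refine absLaw_congr_ae ?_
    filter_upwards [AEEqFun.coeFn_smul c (realize F hF)] with u hu
    rw [hu]; rfl
  have h2 : ∀ {α : Type} [MeasurableSpace α] (μ : Measure α) (v : α → ℝ), Measurable v →
      absLaw μ (fun a => c * v a) = (absLaw μ v).map fun y => |c| * y := by
    intro α _ μ v hv
    rw [absLaw, absLaw, Measure.map_map (by fun_prop) hv.abs]
    simp only [abs_mul]
    rfl
  have h3 : kruglov (fun u => c * F u) = fun ω => c * kruglov F ω :=
    funext fun ω => kruglov_const_mul c F ω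
  rw [h1, h3, h2 _ _ (measurable_kruglov hF), h2 _ _ (measurable_coe _), absLaw_realize]

/-- The Kruglov operator is bounded on a space with the Kruglov property. If not, a rapidly
converging series of functions with large images has a majorant in the space whose image is
larger than each of these. -/
lemma exists_norm_realize_le {E : RISpace} (hK : E.HasKruglovProperty) :
    ∃ C : ℝ, 1 ≤ C ∧ ∀ (F : I → ℝ) (hF : Measurable F), (∀ u, 0 ≤ F u) →
      E.norm (toL0 F hF) < ∞ → E.norm (realize F hF) ≤ ENNReal.ofReal C * E.norm (toL0 F hF) := by
  by_contra! hcon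
  choose F hF hF0 hfin hbig using fun n : ℕ => hcon (4 ^ n) (one_le_pow₀ (by norm_num))
  have hR : ∀ n, E.norm (realize (F n) (hF n)) < ∞ := fun n => norm_realize_lt_top hK _ (hfin n)
  set R : ℕ → ℝ := fun n => (E.norm (realize (F n) (hF n))).toReal with hRdef
  have hR0 : ∀ n, 0 < R n := fun n =>
    ENNReal.toReal_pos (pos_of_gt (hbig n)).ne' (hR n).ne
  have hRe : ∀ n, E.norm (realize (F n) (hF n)) = ENNReal.ofReal (R n) := fun n =>
    (ENNReal.ofReal_toReal (hR n).ne).symm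
  -- scaled so that the image of `c n * F n` has norm `2 ^ n`, and `c n * F n` itself has norm at
  -- most `2 ^ (-n)`
  set c : ℕ → ℝ := fun n => 2 ^ n / R n with hc
  have hc0 : ∀ n, 0 < c n := fun n => div_pos (by positivity) (hR0 n)
  have hsmall : ∀ n, E.norm (toL0 _ ((hF n).const_mul (c n))) ≤ ENNReal.ofReal ((1 / 2) ^ n) := by
    intro n
    rw [E.norm_toL0_const_mul (hF n), Real.enorm_of_nonneg (hc0 n).le]
    set N := (E.norm (toL0 (F n) (hF n))).toReal with hN
    have hNe : E.norm (toL0 (F n) (hF n)) = ENNReal.ofReal N :=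
      (ENNReal.ofReal_toReal (hfin n).ne).symm
    have h1 := hbig n
    rw [hRe, hNe, ← ENNReal.ofReal_mul (by positivity),
      ENNReal.ofReal_lt_ofReal_iff (hR0 n)] at h1
    rw [hNe, ← ENNReal.ofReal_mul (hc0 n).le]
    refine ENNReal.ofReal_le_ofReal ?_
    have h4 : (4 : ℝ) ^ n = 2 ^ n * 2 ^ n := by rw [← mul_pow]; norm_num
    rw [hc, div_mul_eq_mul_div, div_le_iff₀ (hR0 n), div_pow, one_pow, div_mul_eq_mul_div, one_mul,
      le_div_iff₀ (by positivity)]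
    rw [h4] at h1
    linarith
  have hsum : ∑' n, E.norm (toL0 _ ((hF n).const_mul (c n))) ≠ ∞ :=
    ((ENNReal.tsum_le_tsum hsmall).trans_lt
      (tsum_ofReal_pow_ne_top (ε := 1 / 2) ⟨by norm_num, by norm_num⟩).lt_top).ne
  obtain ⟨X, hX, hX0, hXfin, hmaj⟩ := E.exists_majorant (fun n => (hF n).const_mul (c n))
    (fun n u => mul_nonneg (hc0 n).le (hF0 n u)) hsum
  have hlow : ∀ n, ENNReal.ofReal (2 ^ n) ≤ E.norm (realize X hX) := by
    intro n
    have h1 : E.norm (realize _ ((hF n).const_mul (c n))) = ENNReal.ofReal (2 ^ n) := by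
      rw [E.norm_realize_const_mul (hF n), Real.enorm_of_nonneg (hc0 n).le, hRe,
        ← ENNReal.ofReal_mul (hc0 n).le, hc, div_mul_cancel₀ _ (hR0 n).ne']
    rw [← h1]
    refine E.norm_realize_mono _ hX (fun u => mul_nonneg (hc0 n).le (hF0 n u)) hX0 ?_
    filter_upwards [hmaj (n + 1)] with u hu
    refine le_trans ?_ hu
    exact Finset.single_le_sum (f := fun k => c k * F k u)
      (fun k _ => mul_nonneg (hc0 k).le (hF0 k u)) (by simp)
  have hXr := norm_realize_lt_top hK hX hXfin
  obtain ⟨n, hn⟩ := pow_unbounded_of_one_lt (E.norm (realize X hX)).toReal one_lt_two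
  have h1 := (ENNReal.ofReal_le_iff_le_toReal hXr.ne).1 (hlow n)
  linarith

end RISpace

theorem exists_space_subset {E : RISpace} (hK : E.HasKruglovProperty) :
    ∃ ε₀ ∈ Ioo (0 : ℝ) 1, ∀ ε ∈ Ioo (0 : ℝ) ε₀,
      space (marcinkiewiczNorm (psi ε)) ⊆ space E.norm := by
  obtain ⟨C, hC, hbound⟩ := RISpace.exists_norm_realize_le hK
  have hC0 : 0 < C := by linarith
  refine ⟨1 / (2 * C), ⟨by positivity, ?_⟩, fun ε hε => ?_⟩
  · rw [div_lt_one (by positivity)]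
    linarith
  have hεC : ε * C < 1 / 2 := by
    have := (lt_div_iff₀ (by positivity)).1 hε.2
    linarith
  have hε' : ε ∈ Ioo (0 : ℝ) 1 := ⟨hε.1, by nlinarith [hε.1]⟩
  set a : ℕ → ℝ≥0∞ := fun n => E.norm (toL0 (hI n) (measurable_hI n)) with ha
  have ha0 : a 0 < ∞ := by
    refine lt_of_le_of_lt (E.norm_toL0_mono _ _ (ae_of_all _ fun u => ?_)) E.norm_const_lt_top
    rw [abs_of_nonneg (hI_nonneg 0 u), abs_one]
    rcases eq_or_lt_of_le u.2.1 with h0 | h0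
    · rw [hI, h_of_nonpos h0.symm.le]
      exact zero_le_one
    · exact (h_zero ⟨h0, u.2.2⟩).le
  have hstep : ∀ n, a n < ∞ → a (n + 1) ≤ ENNReal.ofReal C * a n := by
    intro n hn
    refine le_trans (le_of_eq (E.norm_congr ?_))
      (hbound (hI n) (measurable_hI n) (hI_nonneg n) hn)
    rw [absLaw_toL0, absLaw_hI_succ, absLaw_realize]
  have hpow : ∀ n, a n ≤ ENNReal.ofReal (C ^ n) * a 0 := by
    intro n
    induction n with
    | zero => simp
    | succ n ih =>
      have hn : a n < ∞ := ih.trans_lt (ENNReal.mul_lt_top ENNReal.ofReal_lt_top ha0)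
      refine (hstep n hn).trans ((mul_le_mul_right ih _).trans (le_of_eq ?_))
      rw [← mul_assoc, ← ENNReal.ofReal_mul hC0.le, pow_succ']
  have hsum : ∑' n, E.norm (toL0 _ ((measurable_hI n).const_mul (ε ^ n))) ≠ ∞ := by
    have h1 : ∀ n, E.norm (toL0 _ ((measurable_hI n).const_mul (ε ^ n))) ≤
        ENNReal.ofReal ((ε * C) ^ n) * a 0 := by
      intro n
      have hεn : 0 ≤ ε ^ n := pow_nonneg hε.1.le n
      rw [E.norm_toL0_const_mul (measurable_hI n), Real.enorm_of_nonneg hεn]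
      refine (mul_le_mul_right (hpow n) _).trans (le_of_eq ?_)
      rw [← mul_assoc, ← ENNReal.ofReal_mul hεn, mul_pow]
    refine ((ENNReal.tsum_le_tsum h1).trans_lt ?_).ne
    rw [ENNReal.tsum_mul_right]
    exact ENNReal.mul_lt_top (tsum_ofReal_pow_ne_top
      ⟨mul_pos hε.1 hC0, hεC.trans (by norm_num)⟩).lt_top ha0
  obtain ⟨X, hX, hX0, hXfin, hmaj⟩ := E.exists_majorant
    (fun n => (measurable_hI n).const_mul (ε ^ n))
    (fun n u => mul_nonneg (pow_nonneg hε.1.le n) (hI_nonneg n u)) hsum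
  have hgX : ∀ᵐ u, gI ε u ≤ X u := by
    filter_upwards [ae_all_iff.2 hmaj] with u hu
    exact Real.tsum_le_of_sum_range_le
      (fun n => mul_nonneg (pow_nonneg hε.1.le n) (hI_nonneg n u)) hu
  intro x hx
  obtain ⟨D, hD, hle⟩ := exists_rearr_le_mul_g hε' hx
  have h1 : E.norm x ≤ E.norm (toL0 _ (hX.const_mul D)) := by
    rw [← E.norm_rearr x]
    refine E.norm_toL0_mono _ _ ?_
    filter_upwards [hgX] with u hu
    refine abs_le_abs_of_nonneg (rearr_nonneg _ _ _) ((hle u).trans ?_)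
    exact mul_le_mul_of_nonneg_left hu hD.le
  rw [E.norm_toL0_const_mul hX] at h1
  exact h1.trans_lt (ENNReal.mul_lt_top enorm_lt_top hXfin)

end Minimality

/-! ### Growth of `h_n` at zero -/

section Growth

variable {ε δ s t m : ℝ} {n : ℕ}

lemma tendsto_iterate_log (n : ℕ) : Tendsto (Real.log^[n]) atTop atTop :=
  Real.tendsto_log_atTop.iterate n

lemma eventually_iterate_exp_iterate_log (n : ℕ) :
    ∀ᶠ L : ℝ in atTop, Real.exp^[n] (Real.log^[n] L) = L := by
  induction n with
  | zero => simp
  | succ n ih =>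
    filter_upwards [ih, (tendsto_iterate_log n).eventually_gt_atTop 0] with L h1 h2
    rw [Function.iterate_succ_apply, Function.iterate_succ_apply' Real.log, Real.exp_log h2, h1]

lemma eventually_iterate_log_le (n : ℕ) :
    ∀ᶠ x : ℝ in atTop, ∀ y, x ≤ y → Real.log^[n] x ≤ Real.log^[n] y := by
  induction n with
  | zero => simp
  | succ n ih =>
    filter_upwards [ih, (tendsto_iterate_log n).eventually_gt_atTop 0] with x h1 h2 y hxy
    rw [Function.iterate_succ_apply', Function.iterate_succ_apply']
    exact Real.log_le_log h2 (h1 y hxy)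

lemma iterate_exp_pos (n : ℕ) (s : ℝ) : 0 < Real.exp^[n + 1] s := by
  rw [Function.iterate_succ_apply']
  exact Real.exp_pos _

/-- The exponential moments of `h_n` are bounded by iterated exponentials. -/
lemma lintegral_exp_hI_le (n : ℕ) (s : ℝ) :
    ∫⁻ u, ENNReal.ofReal (Real.exp (s * hI n u)) ≤ ENNReal.ofReal (Real.exp^[n + 1] s) := by
  induction n with
  | zero =>
    rw [lintegral_hI_zero (Φ := fun x => ENNReal.ofReal (Real.exp (s * x))) (by fun_prop)]
    simp
  | succ n ih =>
    rw [lintegral_hI_succ n (Φ := fun x => ENNReal.ofReal (Real.exp (s * x))) (by fun_prop)]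
    refine (lintegral_exp_kruglov_le (measurable_hI n) (iterate_exp_pos n s).le ih).trans ?_
    rw [Function.iterate_succ_apply' _ (n + 1)]
    exact ENNReal.ofReal_le_ofReal (Real.exp_le_exp.2 (by linarith))

/-- Chebyshev's inequality for `h_n`. -/
lemma mul_h_le_of_lintegral_exp (hs : 0 ≤ s) (hm : 0 < m)
    (hle : ∫⁻ u, ENNReal.ofReal (Real.exp (s * hI n u)) ≤ ENNReal.ofReal m) {L : ℝ} (hL : 0 ≤ L) :
    s * h n (Real.exp (-L)) ≤ L + Real.log m := by
  set t := Real.exp (-L) with ht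
  have ht0 : 0 < t := Real.exp_pos _
  have ht1 : t ≤ 1 := Real.exp_le_one_iff.2 (by linarith)
  rw [lintegral_hI_eq n (Φ := fun x => ENNReal.ofReal (Real.exp (s * x))) (by fun_prop)] at hle
  have h1 : ENNReal.ofReal (t * Real.exp (s * h n t)) ≤ ENNReal.ofReal m := by
    refine le_trans ?_ hle
    calc _ = ∫⁻ x in Ioc (0 : ℝ) t, ENNReal.ofReal (Real.exp (s * h n t)) := by
          simp [ENNReal.ofReal_mul ht0.le, mul_comm]
      _ ≤ ∫⁻ x in Ioc (0 : ℝ) t, ENNReal.ofReal (Real.exp (s * h n x)) := by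
          refine setLIntegral_mono (by fun_prop) fun x hx => ?_
          refine ENNReal.ofReal_le_ofReal (Real.exp_le_exp.2 ?_)
          exact mul_le_mul_of_nonneg_left (h_antitoneOn n hx.1 ht0 hx.2) hs
      _ ≤ _ := lintegral_mono_set (Ioc_subset_Ioc_right ht1)
  rw [ENNReal.ofReal_le_ofReal_iff hm.le, ht, ← Real.exp_add] at h1
  have h2 := Real.log_le_log (Real.exp_pos _) h1
  rw [Real.log_exp] at h2
  linarith

lemma eventually_h_mul_le (n : ℕ) :
    ∀ᶠ L : ℝ in atTop, h n (Real.exp (-L)) * Real.log^[n] L ≤ 2 * L := by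
  cases n with
  | zero =>
    filter_upwards [eventually_ge_atTop 0] with L hL
    rw [h_zero ⟨Real.exp_pos _, Real.exp_le_one_iff.2 (by linarith)⟩]
    simp only [Function.iterate_zero, id]
    linarith
  | succ n =>
    filter_upwards [eventually_ge_atTop 0, eventually_iterate_exp_iterate_log (n + 1),
      (tendsto_iterate_log (n + 1)).eventually_ge_atTop 0] with L hL h1 h2
    have h3 := mul_h_le_of_lintegral_exp h2 (iterate_exp_pos (n + 1) _)
      (lintegral_exp_hI_le (n + 1) (Real.log^[n + 1] L)) hL
    rw [Function.iterate_succ_apply' Real.exp, Real.log_exp, h1] at h3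
    linarith

lemma le_measure_hI (n : ℕ) (hs : s ∈ Ioc (0 : ℝ) 1) :
    ENNReal.ofReal s ≤ volume {u : I | h n s ≤ hI n u} := by
  rw [← lintegral_indicator_one (measurableSet_le measurable_const (measurable_hI n))]
  change _ ≤ ∫⁻ u, (Ici (h n s)).indicator 1 (hI n u)
  rw [lintegral_hI_eq n (measurable_one.indicator measurableSet_Ici)]
  calc ENNReal.ofReal s = ∫⁻ x in Ioc (0 : ℝ) s, 1 := by simp
    _ ≤ ∫⁻ x in Ioc (0 : ℝ) s, (Ici (h n s)).indicator 1 (h n x) := by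
      refine setLIntegral_mono' measurableSet_Ioc fun x hx => ?_
      rw [indicator_of_mem (show h n x ∈ Ici (h n s) from h_antitoneOn n hx.1 hs.1 hx.2)]
      rfl
    _ ≤ _ := lintegral_mono_set (Ioc_subset_Ioc_right hs.2)

/-- With probability at least `e⁻¹ k^{-2k}` the variable `π(h_n)` has `k` summands, all of them at
least `h_n(1/k)`. -/
lemma mul_h_le_h_succ (n : ℕ) {k : ℕ} (hk : 0 < k) {L : ℝ} (hL : 1 + 2 * (k * Real.log k) ≤ L) :
    k * h n (Real.exp (-Real.log k)) ≤ h (n + 1) (Real.exp (-L)) := by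
  have hkpos : (0 : ℝ) < k := by exact_mod_cast hk
  have hk1 : (1 : ℝ) ≤ k := by exact_mod_cast hk
  have hlog : 0 ≤ Real.log k := Real.log_nonneg hk1
  set s := Real.exp (-Real.log k) with hs
  have hsk : s = (k : ℝ)⁻¹ := by rw [hs, Real.exp_neg, Real.exp_log hkpos]
  have hs1 : s ∈ Ioc (0 : ℝ) 1 := ⟨Real.exp_pos _, Real.exp_le_one_iff.2 (by linarith)⟩
  rw [h_succ]
  refine le_rearr_of_le_measure (measurable_kruglov (measurable_hI n)) (Real.exp_pos _) ?_
  simp only [abs_of_nonneg (kruglov_nonneg (hI_nonneg n) _)]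
  refine le_trans ?_ (le_measure_kruglov (measurable_hI n) (h n s) k)
  refine le_trans ?_ (mul_le_mul_right (pow_le_pow_left' (le_measure_hI n hs1) k) _)
  rw [poissonWeight, ← ENNReal.ofReal_pow hs1.1.le, ← ENNReal.ofReal_mul (by positivity)]
  refine ENNReal.ofReal_le_ofReal ?_
  have hfact : (k.factorial : ℝ) ≤ (k : ℝ) ^ k := by exact_mod_cast Nat.factorial_le_pow k
  calc Real.exp (-L) ≤ Real.exp (-1 + k * -Real.log k + k * -Real.log k) :=
        Real.exp_le_exp.2 (by linarith)
    _ = Real.exp (-1) / (k : ℝ) ^ k * s ^ k := by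
        rw [Real.exp_add, Real.exp_add, Real.exp_nat_mul, ← hs, hsk, inv_pow]
        ring
    _ ≤ _ := by
        have := hs1.1
        gcongr

lemma exists_le_h_mul (n : ℕ) :
    ∃ c : ℝ, 0 < c ∧ ∀ᶠ L : ℝ in atTop, c * L ≤ h n (Real.exp (-L)) * Real.log^[n] L := by
  induction n with
  | zero =>
    refine ⟨1, one_pos, ?_⟩
    filter_upwards [eventually_ge_atTop 0] with L hL
    rw [h_zero ⟨Real.exp_pos _, Real.exp_le_one_iff.2 (by linarith)⟩]
    simp
  | succ n ih =>
    obtain ⟨c, hc, hlow⟩ := ih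
    refine ⟨c / 16, by positivity, ?_⟩
    -- `k` has the order of the largest integer with `1 + 2 k log k ≤ L`
    set k : ℝ → ℕ := fun L => ⌊L / (4 * Real.log L)⌋₊ with hk
    have hquot : Tendsto (fun L : ℝ => L / (4 * Real.log L)) atTop atTop := by
      have h1 : Tendsto (fun L : ℝ => Real.log L / L) atTop (𝓝[>] 0) := by
        refine tendsto_nhdsWithin_iff.2 ⟨Real.isLittleO_log_id_atTop.tendsto_div_nhds_zero, ?_⟩
        filter_upwards [eventually_gt_atTop 1] with L hL
        exact div_pos (Real.log_pos hL) (by linarith)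
      have h2 := (tendsto_inv_nhdsGT_zero.comp h1).const_mul_atTop
        (show (0 : ℝ) < 1 / 4 by norm_num)
      refine h2.congr fun L => ?_
      simp only [Function.comp, inv_div]
      field_simp
    have hklog : Tendsto (fun L => Real.log (k L)) atTop atTop :=
      Real.tendsto_log_atTop.comp (tendsto_natCast_atTop_atTop.comp
        (tendsto_nat_floor_atTop.comp hquot))
    have hroot : ∀ᶠ L : ℝ in atTop, Real.log L ≤ 1 / 8 * L ^ (1 / 2 : ℝ) := by
      have := (isLittleO_log_rpow_atTop (show (0 : ℝ) < 1 / 2 by norm_num)).bound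
        (show (0 : ℝ) < 1 / 8 by norm_num)
      filter_upwards [this, eventually_ge_atTop 1] with L h1 h2
      rwa [Real.norm_of_nonneg (Real.log_nonneg h2), Real.norm_of_nonneg (by positivity)] at h1
    filter_upwards [hklog.eventually hlow, hklog.eventually (eventually_iterate_log_le n),
      hklog.eventually ((tendsto_iterate_log n).eventually_gt_atTop 0), hroot,
      hquot.eventually_ge_atTop 1, eventually_ge_atTop (Real.exp 1)] with L h1 h2 h3 h4 h5 h6
    have hL1 : 1 < L := lt_of_lt_of_le (by simp) h6
    have hL2 : 2 ≤ L := le_trans (by linarith [Real.add_one_le_exp (1 : ℝ)]) h6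
    have hlogL : 1 ≤ Real.log L := (Real.le_log_iff_exp_le (by linarith)).2 h6
    have hlogL0 : 0 < Real.log L := by linarith
    have hkpos : 0 < k L := Nat.floor_pos.2 h5
    have hkpos' : (0 : ℝ) < k L := by exact_mod_cast hkpos
    have hkle : (k L : ℝ) ≤ L / (4 * Real.log L) := Nat.floor_le (by linarith)
    have hkge : L / (8 * Real.log L) ≤ k L := by
      have h7 : L / (4 * Real.log L) < k L + 1 := Nat.lt_floor_add_one _
      have h8 : (1 : ℝ) ≤ k L := by exact_mod_cast hkpos
      have h9 : L / (8 * Real.log L) = L / (4 * Real.log L) / 2 := by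
        field_simp
        norm_num
      rw [h9]
      linarith
    have hklogle : Real.log (k L) ≤ Real.log L := by
      refine Real.log_le_log hkpos' (hkle.trans ?_)
      exact div_le_self (by linarith) (by linarith)
    have hkL : 4 * (k L * Real.log L) ≤ L := by
      rw [le_div_iff₀ (by positivity)] at hkle
      linarith
    have hkloge : 1 / 2 * Real.log L ≤ Real.log (k L) := by
      rw [← Real.log_rpow (by linarith)]
      refine Real.log_le_log (by positivity) (le_trans ?_ hkge)
      rw [le_div_iff₀ (by positivity)]
      have h7 : L ^ (1 / 2 : ℝ) * L ^ (1 / 2 : ℝ) = L := by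
        rw [← Real.rpow_add (by linarith)]
        norm_num
      nlinarith [Real.rpow_nonneg (show (0 : ℝ) ≤ L by linarith) (1 / 2)]
    have h7 := mul_h_le_h_succ n hkpos (L := L) (by
      have : (k L : ℝ) * Real.log (k L) ≤ k L * Real.log L :=
        mul_le_mul_of_nonneg_left hklogle hkpos'.le
      linarith)
    have h8 := h2 (Real.log L) hklogle
    rw [Function.iterate_succ_apply]
    set M := Real.log^[n] (Real.log L)
    set Mk := Real.log^[n] (Real.log (k L))
    have h9 := h_nonneg n (Real.exp (-Real.log (k L)))
    set η := h n (Real.exp (-Real.log (k L)))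
    calc c / 16 * L = L / (8 * Real.log L) * (c * (1 / 2 * Real.log L)) := by
          field_simp
          norm_num
      _ ≤ k L * (η * Mk) :=
          mul_le_mul hkge (le_trans (by gcongr) h1) (by positivity) hkpos'.le
      _ ≤ k L * (η * M) := by gcongr
      _ = k L * η * M := by ring
      _ ≤ _ := mul_le_mul_of_nonneg_right h7 (h3.le.trans h8)

/-- `h_n(t)` is of order `log(1/t)` divided by its `n`-fold iterated logarithm, so
`h_n = o(h_{n+1})` at zero. -/
lemma eventually_h_le_mul_h_succ (n : ℕ) {η : ℝ} (hη : 0 < η) :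
    ∀ᶠ L : ℝ in atTop, h n (Real.exp (-L)) ≤ η * h (n + 1) (Real.exp (-L)) := by
  obtain ⟨c, hc, hlow⟩ := exists_le_h_mul (n + 1)
  have hlog := (tendsto_iterate_log n).eventually (Real.isLittleO_log_id_atTop.bound
    (show (0 : ℝ) < η * c / 2 by positivity))
  filter_upwards [hlow, eventually_h_mul_le n, hlog,
    (tendsto_iterate_log n).eventually_gt_atTop 1] with L h1 h2 h3 h4
  rw [Function.iterate_succ_apply'] at h1
  set l := Real.log^[n] L
  have h0 := h_nonneg (n + 1) (Real.exp (-L))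
  rw [Real.norm_of_nonneg (Real.log_nonneg h4.le), id, Real.norm_of_nonneg (by linarith)] at h3
  have h5 : c * L ≤ h (n + 1) (Real.exp (-L)) * (η * c / 2 * l) :=
    h1.trans (mul_le_mul_of_nonneg_left h3 h0)
  have h6 : c * (h n (Real.exp (-L)) * l) ≤ c * (η * h (n + 1) (Real.exp (-L)) * l) := by
    nlinarith
  exact le_of_mul_le_mul_right (le_of_mul_le_mul_left h6 hc) (by linarith)

lemma eventually_topIntegral_le (n : ℕ) {η : ℝ} (hη : 0 < η) :
    ∀ᶠ t : ℝ in 𝓝[>] 0,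
      topIntegral volume (hI n) t ≤ ENNReal.ofReal η * topIntegral volume (hI (n + 1)) t := by
  obtain ⟨L, hL⟩ := eventually_atTop.1 (eventually_h_le_mul_h_succ n hη)
  filter_upwards [Ioc_mem_nhdsGT (Real.exp_pos (-L))] with t ht
  rw [topIntegral_hI, topIntegral_hI, ← lintegral_const_mul _ (by fun_prop)]
  refine setLIntegral_mono (by fun_prop) fun s hs => ?_
  rw [← ENNReal.ofReal_mul hη.le]
  refine ENNReal.ofReal_le_ofReal ?_
  have h1 := hL (-Real.log s) (by
    have := Real.log_le_log hs.1 (hs.2.trans ht.2)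
    rw [Real.log_exp] at this
    linarith)
  rwa [neg_neg, Real.exp_log hs.1] at h1

theorem tendsto_psi_div_psi (hε : 0 < ε) (hεδ : ε < δ) (hδ : δ < 1) :
    Tendsto (fun t => psi ε t / psi δ t) (𝓝[>] 0) (𝓝 0) := by
  have hε' : ε ∈ Ioo (0 : ℝ) 1 := ⟨hε, hεδ.trans hδ⟩
  have hδ' : δ ∈ Ioo (0 : ℝ) 1 := ⟨hε.trans hεδ, hδ⟩
  rw [Metric.tendsto_nhds]
  intro η hη
  obtain ⟨m, hm⟩ := exists_pow_lt_of_lt_one (show (0 : ℝ) < η / 4 by positivity)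
    (show ε / δ < 1 by rw [div_lt_one hδ'.1]; exact hεδ)
  have hη' : 0 < η / 4 * δ ^ m := mul_pos (by positivity) (pow_pos hδ'.1 m)
  have hall : ∀ᶠ t : ℝ in 𝓝[>] 0, ∀ n ∈ Finset.range m, topIntegral volume (hI n) t ≤
      ENNReal.ofReal (η / 4 * δ ^ m) * topIntegral volume (hI (n + 1)) t :=
    (eventually_all_finset _).2 fun n _ => eventually_topIntegral_le n hη'
  filter_upwards [hall, Ioc_mem_nhdsGT (zero_lt_one' ℝ)] with t ht ht1
  have hpos := psi_pos hδ' ht1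
  -- For `n < m` the `n`-th term is small compared with the next term of `ψ_δ`, since
  -- `h_n = o(h_{n+1})`; for `n ≥ m` compared with the `n`-th one, since `(ε / δ) ^ n` is small.
  have hterm : ∀ n : ℕ, ENNReal.ofReal (ε ^ n) * topIntegral volume (hI n) t ≤
      ENNReal.ofReal (η / 4) * (ENNReal.ofReal (δ ^ n) * topIntegral volume (hI n) t +
        ENNReal.ofReal (δ ^ (n + 1)) * topIntegral volume (hI (n + 1)) t) := by
    intro n
    have hδn : (0 : ℝ) < δ ^ n := pow_pos hδ'.1 n
    rw [mul_add]
    rcases lt_or_ge n m with hn | hn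
    · refine le_add_left ?_
      refine (mul_le_mul_right (ht n (Finset.mem_range.2 hn)) _).trans ?_
      rw [← mul_assoc, ← mul_assoc, ← ENNReal.ofReal_mul (pow_nonneg hε.le n),
        ← ENNReal.ofReal_mul (by positivity)]
      refine mul_le_mul' (ENNReal.ofReal_le_ofReal ?_) le_rfl
      have h1 : δ ^ m ≤ δ ^ (n + 1) := pow_le_pow_of_le_one hδ'.1.le hδ.le hn
      have h2 : ε ^ n ≤ 1 := pow_le_one₀ hε.le hε'.2.le
      calc ε ^ n * (η / 4 * δ ^ m) ≤ 1 * (η / 4 * δ ^ (n + 1)) := by gcongr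
        _ = _ := one_mul _
    · refine le_add_right ?_
      rw [← mul_assoc, ← ENNReal.ofReal_mul (by positivity)]
      refine mul_le_mul' (ENNReal.ofReal_le_ofReal ?_) le_rfl
      have h1 : (ε / δ) ^ n ≤ (ε / δ) ^ m :=
        pow_le_pow_of_le_one (div_nonneg hε.le hδ'.1.le) ((div_le_one hδ'.1).2 hεδ.le) hn
      calc ε ^ n = (ε / δ) ^ n * δ ^ n := by rw [div_pow, div_mul_cancel₀ _ hδn.ne']
        _ ≤ η / 4 * δ ^ n := by gcongr; linarith
  have hle : psi ε t ≤ η / 2 * psi δ t := by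
    have ht01 : t ∈ Icc (0 : ℝ) 1 := Ioc_subset_Icc_self ht1
    rw [← ENNReal.ofReal_le_ofReal_iff (by positivity), ofReal_psi hε' ht01]
    refine (ENNReal.tsum_le_tsum hterm).trans ?_
    rw [ENNReal.tsum_mul_left, ENNReal.tsum_add]
    have h1 : ∑' n : ℕ, ENNReal.ofReal (δ ^ (n + 1)) * topIntegral volume (hI (n + 1)) t ≤
        ENNReal.ofReal (psi δ t) := by
      rw [ofReal_psi hδ' ht01]
      exact ENNReal.tsum_comp_le_tsum_of_injective (add_left_injective 1)
        fun n => ENNReal.ofReal (δ ^ n) * topIntegral volume (hI n) t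
    rw [← ofReal_psi hδ' ht01]
    calc _ ≤ ENNReal.ofReal (η / 4) * (ENNReal.ofReal (psi δ t) + ENNReal.ofReal (psi δ t)) := by
          gcongr
      _ = _ := by
          rw [← ENNReal.ofReal_add hpos.le hpos.le, ← ENNReal.ofReal_mul (by positivity)]
          congr 1
          ring
  rw [Real.dist_eq, sub_zero, abs_of_nonneg (div_nonneg (psi_nonneg hε.le ht1.1.le) hpos.le),
    div_lt_iff₀ hpos]
  nlinarith

end Growth

/-! ### Exponential integrability -/

section Exponential

variable {ε δ s t : ℝ} {n : ℕ}

/-- The norm of `h_n` in `exp L_1` is at most `2^{n+1}`, as `e^x - 1 ≤ 2 x` on `[0,1]`. -/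
lemma lintegral_exp_hI_le_linear (n : ℕ) (hs0 : 0 ≤ s) (hs : 2 ^ (n + 1) * s ≤ 1) :
    ∫⁻ u, ENNReal.ofReal (Real.exp (s * hI n u)) ≤ ENNReal.ofReal (1 + 2 ^ (n + 1) * s) := by
  have hexp : ∀ x : ℝ, 0 ≤ x → x ≤ 1 → Real.exp x ≤ 1 + 2 * x := by
    intro x h0 h1
    have h2 := Real.abs_exp_sub_one_le (x := x) (by rwa [abs_of_nonneg h0])
    rw [abs_of_nonneg h0] at h2
    linarith [le_abs_self (Real.exp x - 1)]
  induction n with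
  | zero =>
    rw [lintegral_hI_zero (Φ := fun x => ENNReal.ofReal (Real.exp (s * x))) (by fun_prop)]
    refine ENNReal.ofReal_le_ofReal ?_
    have := hexp s hs0 (by norm_num at hs; linarith)
    simpa using this
  | succ n ih =>
    rw [lintegral_hI_succ n (Φ := fun x => ENNReal.ofReal (Real.exp (s * x))) (by fun_prop)]
    have h1 : 0 ≤ 2 ^ (n + 1) * s := by positivity
    have h2 : 2 ^ (n + 1 + 1) * s = 2 * (2 ^ (n + 1) * s) := by ring
    rw [h2] at hs ⊢
    refine (lintegral_exp_kruglov_le (measurable_hI n) (by linarith) (ih (by linarith))).trans ?_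
    refine ENNReal.ofReal_le_ofReal ?_
    rw [add_sub_cancel_left]
    exact hexp _ h1 (by linarith)

/-- The logarithmic bound that the exponential moment of `h_n` at `2^{-(n+1)}` gives. -/
lemma h_exp_neg_le (n : ℕ) {L : ℝ} (hL : 0 ≤ L) :
    h n (Real.exp (-L)) ≤ 2 ^ (n + 1) * (L + 1) := by
  have h1 := lintegral_exp_hI_le_linear n (s := (2 ^ (n + 1))⁻¹) (by positivity)
    (by rw [mul_inv_cancel₀ (by positivity)])
  have h2 := mul_h_le_of_lintegral_exp (by positivity) (by positivity) h1 hL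
  rw [mul_inv_cancel₀ (by positivity), inv_mul_le_iff₀ (by positivity)] at h2
  refine h2.trans ?_
  have : Real.log (1 + 1) ≤ 1 := by
    have := Real.log_le_sub_one_of_pos (show (0 : ℝ) < 1 + 1 by norm_num)
    linarith
  gcongr

lemma tendsto_h_div (n : ℕ) : Tendsto (fun L => h n (Real.exp (-L)) / L) atTop (𝓝 0) := by
  rw [Metric.tendsto_nhds]
  intro η hη
  filter_upwards [eventually_h_le_mul_h_succ n (η := η / 2 ^ (n + 4)) (by positivity),
    eventually_ge_atTop 1] with L h1 h2
  have hL : 0 < L := by linarith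
  have h3 := h_exp_neg_le (n + 1) hL.le
  rw [Real.dist_eq, sub_zero, abs_of_nonneg (div_nonneg (h_nonneg _ _) hL.le), div_lt_iff₀ hL]
  calc _ ≤ η / 2 ^ (n + 4) * (2 ^ (n + 1 + 1) * (L + L)) :=
        h1.trans (by gcongr; exact h3.trans (by gcongr))
    _ = η / 2 * L := by
        field_simp
        ring
    _ < _ := by nlinarith

/-- For `ε < 1/2` the function `g_ε(t)` is `o(log (1/t))`, the series being dominated by a geometric
one. -/
lemma tendsto_g_div (hε : 0 < ε) (hε2 : ε < 1 / 2) :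
    Tendsto (fun L => g ε (Real.exp (-L)) / L) atTop (𝓝 0) := by
  have h1 : Tendsto (fun L => ∑' n : ℕ, ε ^ n * (h n (Real.exp (-L)) / L)) atTop
      (𝓝 (∑' _ : ℕ, (0 : ℝ))) := by
    refine tendsto_tsum_of_dominated_convergence (bound := fun n : ℕ => 4 * (2 * ε) ^ n) ?_ ?_ ?_
    · exact (summable_geometric_of_lt_one (by linarith) (by linarith)).mul_left 4
    · intro n
      simpa using (tendsto_h_div n).const_mul (ε ^ n)
    · filter_upwards [eventually_ge_atTop 1] with L hL n
      have hL0 : 0 < L := by linarith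
      have h0 := h_nonneg n (Real.exp (-L))
      rw [Real.norm_of_nonneg (by positivity)]
      have h2 : h n (Real.exp (-L)) / L ≤ 4 * 2 ^ n := by
        rw [div_le_iff₀ hL0]
        refine (h_exp_neg_le n hL0.le).trans ?_
        calc (2 : ℝ) ^ (n + 1) * (L + 1) ≤ 2 ^ (n + 1) * (L + L) := by gcongr
          _ = _ := by ring
      calc _ ≤ ε ^ n * (4 * 2 ^ n) := by gcongr
        _ = _ := by rw [mul_pow]; ring
  rw [tsum_zero] at h1
  refine h1.congr fun L => ?_
  rw [g, ← tsum_div_const]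
  exact tsum_congr fun n => (mul_div_assoc _ _ _).symm

/-- The elements of `M_{ψ_ε}`, `ε < 1/2`, have all exponential moments. -/
lemma lintegral_exp_lt_top (hε : 0 < ε) (hε2 : ε < 1 / 2) {x : L0}
    (hx : marcinkiewiczNorm (psi ε) x < ∞) {l : ℝ} (hl : 0 < l) :
    ∫⁻ u : I, ENNReal.ofReal (Real.exp (|x u| / l)) < ∞ := by
  have hε' : ε ∈ Ioo (0 : ℝ) 1 := ⟨hε, by linarith⟩
  obtain ⟨C, hC, hle⟩ := exists_rearr_le_mul_g hε' hx
  have hη : 0 < l / (2 * C) := by positivity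
  obtain ⟨L, hL⟩ := eventually_atTop.1 (((Metric.tendsto_nhds.1 (tendsto_g_div hε hε2)) _ hη).and
    (eventually_gt_atTop 0))
  set B := C * g ε (Real.exp (-L)) with hB
  have hB0 : 0 ≤ B := mul_nonneg hC.le (g_nonneg hε.le _)
  -- `x^*(t) ≤ B + (l / 2) log (1/t)`
  have hbound : ∀ t ∈ Ioc (0 : ℝ) 1, rearr volume x t ≤ B + l / 2 * -Real.log t := by
    intro t ht
    have h1 := hle ⟨t, ht.1.le, ht.2⟩
    refine h1.trans ?_
    have hlog : 0 ≤ -Real.log t := by linarith [Real.log_nonpos ht.1.le ht.2]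
    rcases le_total L (-Real.log t) with h2 | h2
    · obtain ⟨h3, h4⟩ := hL _ h2
      rw [neg_neg, Real.exp_log ht.1, Real.dist_eq, sub_zero, abs_of_nonneg
        (div_nonneg (g_nonneg hε.le _) h4.le), div_lt_iff₀ h4] at h3
      have h5 : C * g ε t ≤ C * (l / (2 * C) * -Real.log t) := by gcongr
      have h6 : C * (l / (2 * C) * -Real.log t) = l / 2 * -Real.log t := by field_simp
      exact (h5.trans h6.le).trans (by linarith)
    · have h3 : Real.exp (-L) ≤ t := by
        rw [← Real.exp_log ht.1]
        exact Real.exp_le_exp.2 (by linarith)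
      have h4 : C * g ε t ≤ B :=
        mul_le_mul_of_nonneg_left (g_antitoneOn hε' (Real.exp_pos _) ht.1 h3) hC.le
      have : 0 ≤ l / 2 * -Real.log t := by positivity
      exact h4.trans (by linarith)
  rw [← lintegral_rearr (μ := volume) (measurable_coe x)
    (Φ := fun y => ENNReal.ofReal (Real.exp (y / l))) (by fun_prop)]
  have hint : IntegrableOn (fun t : ℝ => Real.exp (B / l) * t ^ (-(1 / 2) : ℝ)) (Ioc 0 1) :=
    ((intervalIntegrable_iff_integrableOn_Ioc_of_le zero_le_one).1
      (intervalIntegral.intervalIntegrable_rpow' (by norm_num))).const_mul _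
  refine lt_of_le_of_lt (setLIntegral_mono' measurableSet_Ioc fun t ht => ?_)
    hint.lintegral_lt_top
  refine ENNReal.ofReal_le_ofReal ?_
  rw [Real.rpow_def_of_pos ht.1, ← Real.exp_add]
  refine Real.exp_le_exp.2 ?_
  rw [div_le_iff₀ hl, add_mul, div_mul_cancel₀ _ hl.ne']
  linarith [hbound t ht]

lemma expNorm_le {x : L0} {l : ℝ} (hl : 0 < l)
    (h : ∫⁻ u : I, ENNReal.ofReal (Real.exp (|x u| / l) - 1) ≤ 1) :
    expNorm x ≤ ENNReal.ofReal l :=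
  iInf_le_of_le l (iInf_le_of_le hl (iInf_le_of_le h le_rfl))

/-- A function with all exponential moments is approximated in `exp L_1` by its truncations. -/
lemma mem_expL1Zero_of_lintegral_exp {x : L0}
    (hx : ∀ l : ℝ, 0 < l → ∫⁻ u : I, ENNReal.ofReal (Real.exp (|x u| / l)) < ∞) :
    x ∈ expL1Zero := by
  have hxm := measurable_coe x
  constructor
  · have h1 : Tendsto (fun n : ℕ => ∫⁻ u : I, ENNReal.ofReal (Real.exp (|x u| / ((n : ℝ) + 1)) - 1))
        atTop (𝓝 (∫⁻ _ : I, 0)) := by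
      refine tendsto_lintegral_of_dominated_convergence
        (fun u => ENNReal.ofReal (Real.exp (|x u| / 1))) (fun n => by fun_prop)
        (fun n => ae_of_all _ fun u => ?_) (hx 1 one_pos).ne (ae_of_all _ fun u => ?_)
      · refine ENNReal.ofReal_le_ofReal ?_
        have : Real.exp (|x u| / ((n : ℝ) + 1)) ≤ Real.exp (|x u| / 1) := by
          gcongr
          simp
        linarith
      · have h2 : Tendsto (fun n : ℕ => |x u| / ((n : ℝ) + 1)) atTop (𝓝 0) :=
          tendsto_const_nhds.div_atTop
            (tendsto_atTop_add_const_right _ _ tendsto_natCast_atTop_atTop)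
        have h3 := ((Real.continuous_exp.tendsto 0).comp h2).sub_const 1
        rw [Real.exp_zero, sub_self] at h3
        have h4 := (ENNReal.continuous_ofReal.tendsto 0).comp h3
        rwa [ENNReal.ofReal_zero] at h4
    rw [lintegral_zero] at h1
    obtain ⟨n, hn⟩ := (h1.eventually (gt_mem_nhds one_pos)).exists
    exact (expNorm_le (by positivity) hn.le).trans_lt ENNReal.ofReal_lt_top
  · intro ε hε
    obtain ⟨l, hl0, hlε⟩ : ∃ l : ℝ, 0 < l ∧ ENNReal.ofReal l < ε := by
      obtain ⟨r, hr0, hr⟩ := ENNReal.lt_iff_exists_nnreal_btwn.1 hε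
      exact ⟨r, by simpa using hr0, by simpa using hr⟩
    have hAm : ∀ n : ℕ, MeasurableSet {u : I | |x u| ≤ n} := fun n =>
      measurableSet_le hxm.abs measurable_const
    have hym : ∀ n : ℕ, Measurable ({u : I | |x u| ≤ n}.indicator x) := fun n =>
      hxm.indicator (hAm n)
    have h1 : Tendsto (fun n : ℕ => ∫⁻ u : I, ENNReal.ofReal
        (Real.exp (|x u - {u : I | |x u| ≤ n}.indicator x u| / l) - 1)) atTop
        (𝓝 (∫⁻ _ : I, 0)) := by
      refine tendsto_lintegral_of_dominated_convergence
        (fun u => ENNReal.ofReal (Real.exp (|x u| / l))) (fun n => by have := hym n; fun_prop)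
        (fun n => ae_of_all _ fun u => ?_) (hx l hl0).ne (ae_of_all _ fun u => ?_)
      · refine ENNReal.ofReal_le_ofReal ?_
        have : Real.exp (|x u - {u : I | |x u| ≤ n}.indicator x u| / l) ≤
            Real.exp (|x u| / l) := by
          refine Real.exp_le_exp.2 (div_le_div_of_nonneg_right ?_ hl0.le)
          by_cases hu : |x u| ≤ n
          · rw [indicator_of_mem (show u ∈ {u : I | |x u| ≤ n} from hu), sub_self, abs_zero]
            exact abs_nonneg _
          · rw [indicator_of_notMem (show u ∉ {u : I | |x u| ≤ n} from hu), sub_zero]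
        linarith
      · refine tendsto_const_nhds.congr' ?_
        filter_upwards [eventually_ge_atTop ⌈|x u|⌉₊] with n hn
        have hu : u ∈ {u : I | |x u| ≤ n} := 
          show |x u| ≤ n from Nat.ceil_le.1 hn
        rw [indicator_of_mem hu]
        simp
    rw [lintegral_zero] at h1
    obtain ⟨n, hn⟩ := (h1.eventually (gt_mem_nhds one_pos)).exists
    refine ⟨toL0 _ (hym n), ⟨n, ?_⟩, (expNorm_le hl0 ?_).trans_lt hlε⟩
    · filter_upwards [coe_toL0 (hym n)] with u hu
      rw [hu]
      by_cases hu : |x u| ≤ n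
      · rwa [indicator_of_mem (show u ∈ {u : I | |x u| ≤ n} from hu)]
      · rw [indicator_of_notMem (show u ∉ {u : I | |x u| ≤ n} from hu)]
        simp
    · refine le_trans (le_of_eq (lintegral_congr_ae ?_)) hn.le
      filter_upwards [coe_toL0 (hym n), coe_sub_ae x (toL0 _ (hym n))] with u h2 h3
      rw [h3, h2]

lemma gI_mem_space (hδ : δ ∈ Ioo (0 : ℝ) 1) :
    toL0 (gI δ) (measurable_gI hδ) ∈ space (marcinkiewiczNorm (psi δ)) := by
  have hpow : ∀ n : ℕ, 0 ≤ δ ^ n := fun n => pow_nonneg hδ.1.le n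
  refine lt_of_le_of_lt ((marcinkiewiczNorm_le_iff (fun t ht => psi_pos hδ ht) (C := 1)).2
    fun t ht => ?_) ENNReal.one_lt_top
  rw [topIntegral_congr (measurable_coe _) (measurable_gI hδ) (absLaw_toL0 _), one_mul,
    ofReal_psi hδ (Ioc_subset_Icc_self ht)]
  refine (topIntegral_tsum_le (measurable_gI hδ) (u := fun n u => δ ^ n * hI n u)
    (fun n => (measurable_hI n).const_mul _) ht ?_ (ae_of_all _ fun u => ?_)).trans (le_of_eq ?_)
  · refine (summable_g hδ t).congr fun n => ?_
    rw [rearr_smul (measurable_hI n) _ _ ht.1, abs_of_nonneg (hpow n), ← h_eq_rearr]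
  · have h2 : ∀ n, 0 ≤ δ ^ n * hI n u := fun n => mul_nonneg (hpow n) (hI_nonneg n u)
    simp_rw [fun n => abs_of_nonneg (h2 n)]
    rw [abs_of_nonneg (gI_nonneg hδ u), ← ENNReal.ofReal_tsum_of_nonneg h2 (summable_g hδ u)]
    rfl
  · refine tsum_congr fun n => ?_
    rw [topIntegral_smul (measurable_hI n), Real.enorm_of_nonneg (hpow n)]

lemma psi_le_topIntegral (hδ : δ ∈ Ioo (0 : ℝ) 1) (ht : t ∈ Ioc (0 : ℝ) 1) :
    ENNReal.ofReal (psi δ t) ≤ topIntegral volume (gI δ) t := by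
  have hm : Measurable ((Ioc (0 : ℝ) t).indicator (fun _ => (1 : ℝ))) :=
    measurable_const.indicator measurableSet_Ioc
  have hw : Measurable fun u : I => (Ioc (0 : ℝ) t).indicator (fun _ => (1 : ℝ)) u :=
    hm.comp measurable_subtype_coe
  have hinter : Ioc (0 : ℝ) t ∩ Ioc 0 1 = Ioc 0 t :=
    inter_eq_left.2 (Ioc_subset_Ioc_right ht.2)
  have key : ∀ {v : ℝ → ℝ≥0∞}, Measurable v →
      ∫⁻ u : I, (Ioc (0 : ℝ) t).indicator v u = ∫⁻ s in Ioc (0 : ℝ) t, v s := by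
    intro v hv
    rw [lintegral_unitInterval (hv.indicator measurableSet_Ioc),
      setLIntegral_indicator measurableSet_Ioc, hinter]
  refine le_trans (le_of_eq ?_) (lintegral_mul_weight_le (measurable_gI hδ) hw
    (fun u => indicator_nonneg (fun _ _ => zero_le_one) _)
    (fun u => indicator_le_self' (fun _ _ => zero_le_one) _) ht ?_)
  · rw [ofReal_psi hδ (Ioc_subset_Icc_self ht), ← lintegral_g hδ,
      ← key (measurable_g hδ).ennreal_ofReal]
    refine lintegral_congr fun u => ?_
    by_cases hu : (u : ℝ) ∈ Ioc 0 t
    · rw [indicator_of_mem hu, indicator_of_mem hu, abs_of_nonneg (gI_nonneg hδ u), mul_one, gI]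
    · rw [indicator_of_notMem hu, indicator_of_notMem hu]
      simp
  · refine le_of_eq ?_
    calc _ = ∫⁻ u : I, (Ioc (0 : ℝ) t).indicator (fun _ => (1 : ℝ≥0∞)) u := by
          refine lintegral_congr fun u => ?_
          by_cases hu : (u : ℝ) ∈ Ioc 0 t
          · rw [indicator_of_mem hu, indicator_of_mem hu, ENNReal.ofReal_one]
          · rw [indicator_of_notMem hu, indicator_of_notMem hu, ENNReal.ofReal_zero]
      _ = _ := by
          rw [key measurable_const]
          simp

lemma gI_notMem_space (hε : 0 < ε) (hεδ : ε < δ) (hδ : δ < 1) :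
    toL0 (gI δ) (measurable_gI ⟨hε.trans hεδ, hδ⟩) ∉ space (marcinkiewiczNorm (psi ε)) := by
  intro hmem
  have hε' : ε ∈ Ioo (0 : ℝ) 1 := ⟨hε, hεδ.trans hδ⟩
  have hδ' : δ ∈ Ioo (0 : ℝ) 1 := ⟨hε.trans hεδ, hδ⟩
  have hfin : marcinkiewiczNorm (psi ε) (toL0 (gI δ) (measurable_gI hδ')) < ∞ := hmem
  set N := (marcinkiewiczNorm (psi ε) (toL0 (gI δ) (measurable_gI hδ'))).toReal with hN
  have hN0 : 0 ≤ N := ENNReal.toReal_nonneg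
  have h1 := (tendsto_psi_div_psi hε hεδ hδ).const_mul N
  rw [mul_zero] at h1
  obtain ⟨t, ht1, ht⟩ := ((h1.eventually (gt_mem_nhds one_pos)).and
    (Ioc_mem_nhdsGT (zero_lt_one' ℝ))).exists
  have h2 := topIntegral_le_marcinkiewiczNorm (fun t ht => psi_pos hε' ht)
    (toL0 (gI δ) (measurable_gI hδ')) ht
  rw [topIntegral_congr (measurable_coe _) (measurable_gI hδ') (absLaw_toL0 _)] at h2
  have h3 := (psi_le_topIntegral hδ' ht).trans h2
  rw [← ENNReal.ofReal_toReal hfin.ne, ← hN, ← ENNReal.ofReal_mul hN0, ENNReal.ofReal_le_ofReal_iff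
    (mul_nonneg hN0 (psi_nonneg hε.le ht.1.le))] at h3
  rw [← mul_div_assoc, div_lt_one (psi_pos hδ' ht)] at ht1
  linarith

theorem space_ssubset_expL1Zero (hε : 0 < ε) (hε2 : ε < 1 / 2) :
    space (marcinkiewiczNorm (psi ε)) ⊂ expL1Zero := by
  have hsub : ∀ {ε : ℝ}, 0 < ε → ε < 1 / 2 →
      space (marcinkiewiczNorm (psi ε)) ⊆ expL1Zero := fun h0 h2 x hx =>
    mem_expL1Zero_of_lintegral_exp fun _ hl => lintegral_exp_lt_top h0 h2 hx hl
  refine ⟨hsub hε hε2, fun hcon => ?_⟩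
  -- `g_δ` with `ε < δ < 1/2` separates the two spaces
  obtain ⟨δ, hεδ, hδ⟩ := exists_between hε2
  have hδ1 : δ < 1 := by linarith
  exact gI_notMem_space hε hεδ hδ1
    (hcon (hsub (hε.trans hεδ) hδ (gI_mem_space ⟨hε.trans hεδ, hδ1⟩)))

end Exponential

end Kruglov

theorem mainTheorem2 :
    -- the series defining `g_ε` converges on `(0,1]` and in `L_1`, and `ψ_ε` is increasing and
    -- concave with `ψ_ε(0) = 0`
    (∀ ε ∈ Set.Ioo (0 : ℝ) 1,
      (∀ t ∈ Set.Ioc (0 : ℝ) 1, Summable (fun n : ℕ => ε ^ n * Kruglov.h n t)) ∧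
      MeasureTheory.IntegrableOn (Kruglov.g ε) (Set.Ioc 0 1) ∧
      Filter.Tendsto
        (fun N : ℕ => ∫⁻ t in Set.Ioc (0 : ℝ) 1,
          ‖Kruglov.g ε t - ∑ n ∈ Finset.range N, ε ^ n * Kruglov.h n t‖ₑ)
        Filter.atTop (nhds 0) ∧
      Kruglov.psi ε 0 = 0 ∧
      StrictMonoOn (Kruglov.psi ε) (Set.Icc 0 1) ∧
      ConcaveOn ℝ (Set.Icc 0 1) (Kruglov.psi ε)) ∧
    -- the family is nested
    (∀ ε δ : ℝ, 0 < ε → ε ≤ δ → δ < 1 →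
      Kruglov.space (Kruglov.marcinkiewiczNorm (Kruglov.psi ε)) ⊆
        Kruglov.space (Kruglov.marcinkiewiczNorm (Kruglov.psi δ))) ∧
    -- each member is an r.i. space with the Kruglov property
    (∀ ε ∈ Set.Ioo (0 : ℝ) 1, ∃ E : Kruglov.RISpace,
      E.norm = Kruglov.marcinkiewiczNorm (Kruglov.psi ε) ∧ E.HasKruglovProperty) ∧
    -- each r.i. space with the Kruglov property contains the members with small `ε`
    (∀ E : Kruglov.RISpace, E.HasKruglovProperty →
      ∃ ε₀ ∈ Set.Ioo (0 : ℝ) 1, ∀ ε ∈ Set.Ioo (0 : ℝ) ε₀,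
        Kruglov.space (Kruglov.marcinkiewiczNorm (Kruglov.psi ε)) ⊆ Kruglov.space E.norm) ∧
    -- the functions `ψ_ε` are pairwise not equivalent at zero
    (∀ ε δ : ℝ, 0 < ε → ε < δ → δ < 1 →
      Filter.Tendsto (fun t : ℝ => Kruglov.psi ε t / Kruglov.psi δ t)
        (nhdsWithin 0 (Set.Ioi 0)) (nhds 0)) ∧
    -- strict inclusion in `(exp L_1)_0` for small `ε`
    (∃ ε₀ ∈ Set.Ioo (0 : ℝ) 1, ∀ ε ∈ Set.Ioo (0 : ℝ) ε₀,
      Kruglov.space (Kruglov.marcinkiewiczNorm (Kruglov.psi ε)) ⊂ Kruglov.expL1Zero) := by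
  refine ⟨fun ε hε => ⟨fun t _ => Kruglov.summable_g hε t, Kruglov.integrableOn_g hε,
      Kruglov.tendsto_lintegral_sub hε, Kruglov.psi_zero ε, Kruglov.psi_strictMonoOn hε,
      Kruglov.psi_concaveOn hε⟩,
    fun ε δ hε hεδ hδ => Kruglov.space_marcinkiewicz_mono hε hεδ hδ,
    fun ε hε => ⟨Kruglov.marcinkiewiczSpace (Kruglov.psi ε) (fun t ht => Kruglov.psi_pos hε ht)
      fun t ht => Kruglov.le_psi hε ht, rfl, Kruglov.hasKruglovProperty_marcinkiewicz hε rfl⟩,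
    fun E hE => Kruglov.exists_space_subset hE,
    fun ε δ hε hεδ hδ => Kruglov.tendsto_psi_div_psi hε hεδ hδ,
    1 / 2, by norm_num, fun ε hε => Kruglov.space_ssubset_expL1Zero hε.1 hε.2⟩
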